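/- A finite poset is a finite nonempty set $P$ with a reflexive, antisymmetric and transitive relation $\leq$; as an input it has universe $\{0,\dots,n-1\}$ and is written down as the matrix of its order relation. Its width is the maximum size of an antichain (a set of pairwise incomparable elements). A class $\mathcal{P}$ of finite posets has bounded width if there is $w \in \mathbb{N}$ such that every $\mathbf{P} \in \mathcal{P}$ has width at most $w$. Let $\mathcal{FO}(\forall,\exists,\wedge)$ be the set of (quantified) conjunctive positive sentences, that is, first-order sentences built from the atoms $x \leq y$ and $x = y$ using only $\wedge$, $\forall$ and $\exists$. The model checking problem $\mathrm{MC}(\mathcal{P},\mathcal{FO}(\forall,\exists,\wedge))$ is to decide, given $\mathbf{P} \in \mathcal{P}$ and $\phi \in \mathcal{FO}(\forall,\exists,\wedge)$, whether $\mathbf{P} \models \phi$; its parameter is the size $\|\phi\|$ of the encoding of $\phi$. **Corollary.** Let $\mathcal{P}$ be any class of finite posets of bounded width. Then $\mathrm{MC}(\mathcal{P},\mathcal{FO}(\forall,\exists,\wedge))$ is fixed-parameter tractable: there are a (multi-stack) Turing machine $M$, a computable function $f \colon \mathbb{N} \to \mathbb{N}$ and a polynomial $p$ such that, for all $\mathbf{P}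 \in \mathcal{P}$ and $\phi \in \mathcal{FO}(\forall,\exists,\wedge)$, the machine $M$, run on the encoding of $(\mathbf{P},\phi)$ over a finite alphabet, halts after at most $f(\|\phi\|) \cdot p(\|(\mathbf{P},\phi)\|)$ steps with the correct answer to whether $\mathbf{P} \models \phi$, where $\|(\mathbf{P},\phi)\|$ is the length of that encoding. -/

import Mathlib

open FirstOrder

/-! ## Fixed-parameter tractability -/

/-- A parameterized decision problem: a type of instances, each with a code word over a finite
alphabet, a set of yes-instances, and a parameter attached to each instance.  Words that are not
codes of instances are not inputs of the problem. -/
structure ParamProblem where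
  /-- the finite input alphabet -/
  Symbol : Type
  [symbolFintype : Fintype Symbol]
  /-- the instances -/
  Instance : Type
  /-- the code word of an instance -/
  encode : Instance → List Symbol
  encode_injective : Function.Injective encode
  /-- the yes-instances -/
  yes : Instance → Prop
  /-- the parameterization -/
  param : Instance → ℕ

open Classical in
/-- Fixed-parameter tractability: some Turing machine decides every instance `x` in at most
`f (param x) * p |x|` steps, where `f` is computable, `p` is a polynomial and `|x|` is the length
of the code word of `x`.  The answer is one Boolean on the output stack. -/
def ParamProblem.IsFPT (Q : ParamProblem) : Prop :=
  ∃ (M : Turing.TM2ComputableAux Q.Symbol Bool) (f : ℕ → ℕ) (p : Polynomial ℕ),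
    Computable f ∧
    ∀ x : Q.Instance,
      Nonempty (Turing.TM2OutputsInTime M.tm
        ((Q.encode x).map M.inputAlphabet.symm)
        (some ([decide (Q.yes x)].map M.outputAlphabet.symm))
        (f (Q.param x) * p.eval (Q.encode x).length))

/-! ## Finite posets -/

/-- A finite nonempty poset, with universe `{0, …, card - 1}`, given by the Boolean matrix of its
order relation. -/
@[ext]
structure FinPoset where
  /-- the number of elements -/
  card : ℕ
  card_pos : 0 < card
  /-- the matrix of the order relation -/
  rel : Fin card → Fin card → Bool
  rel_refl : ∀ a, rel a a = true
  rel_antisymm : ∀ a b, rel a b = true → rel b a = true → a = b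
  rel_trans : ∀ a b c, rel a b = true → rel b c = true → rel a c = true

/-- The universe of a finite poset; a separate name for `Fin P.card`, so that it carries the order
of `P` and not the numerical order of `Fin`. -/
def FinPoset.Carrier (P : FinPoset) : Type := Fin P.card

instance FinPoset.instFintypeCarrier (P : FinPoset) : Fintype P.Carrier :=
  inferInstanceAs (Fintype (Fin P.card))

instance FinPoset.instPartialOrderCarrier (P : FinPoset) : PartialOrder P.Carrier where
  le a b := P.rel a b = true
  le_refl := P.rel_refl
  le_trans := P.rel_trans
  le_antisymm := P.rel_antisymm

/-- A finite poset as a structure over the vocabulary `{≤}`. -/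
instance FinPoset.instStructureCarrier (P : FinPoset) : Language.order.Structure P.Carrier :=
  Language.orderStructure P.Carrier

open Classical in
/-- The width of a finite poset: the maximum size of an antichain. -/
noncomputable def FinPoset.width (P : FinPoset) : ℕ :=
  (Finset.univ.filter fun A : Finset P.Carrier =>
    IsAntichain (fun a b : P.Carrier => a ≤ b) (A : Set P.Carrier)).sup Finset.card

/-- A class of finite posets has bounded width. -/
def BoundedWidth (C : Set FinPoset) : Prop :=
  ∃ w : ℕ, ∀ P ∈ C, P.width ≤ w

/-! ## Conjunctive positive logic on posets -/

/-- Formulas over the vocabulary `{≤}` built from atoms `x = y` and `x ≤ y` with `∧`, `∀`, `∃`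
only.  As in `FirstOrder.Language.BoundedFormula`, variables are de Bruijn levels: in
`CPFormula n` the variables `0, …, n - 1` may occur free, and a quantifier there binds the
variable `n`. -/
inductive CPFormula : ℕ → Type
  | eq {n : ℕ} (i j : Fin n) : CPFormula n
  | le {n : ℕ} (i j : Fin n) : CPFormula n
  | and {n : ℕ} (φ ψ : CPFormula n) : CPFormula n
  | all {n : ℕ} (φ : CPFormula (n + 1)) : CPFormula n
  | ex {n : ℕ} (φ : CPFormula (n + 1)) : CPFormula n

/-- Conjunctive positive sentences: formulas without free variables. -/
abbrev CPSentence : Type := CPFormula 0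

/-- The first-order formula over the language of orders that a `CPFormula` stands for. -/
def CPFormula.toBoundedFormula : {n : ℕ} → CPFormula n → Language.order.BoundedFormula Empty n
  | _, .eq i j => Language.Term.bdEqual (Language.Term.var (Sum.inr i))
      (Language.Term.var (Sum.inr j))
  | _, .le i j => Language.Term.le (Language.Term.var (Sum.inr i)) (Language.Term.var (Sum.inr j))
  | _, .and φ ψ => φ.toBoundedFormula ⊓ ψ.toBoundedFormula
  | _, .all φ => φ.toBoundedFormula.all
  | _, .ex φ => φ.toBoundedFormula.ex

/-- A conjunctive positive sentence as a first-order sentence over the language of orders. -/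
def CPSentence.toSentence (φ : CPSentence) : Language.order.Sentence :=
  CPFormula.toBoundedFormula φ

/-- Truth of a conjunctive positive sentence in a finite poset. -/
def FinPoset.Models (P : FinPoset) (φ : CPSentence) : Prop :=
  Language.Sentence.Realize P.Carrier φ.toSentence

/-! ## Encoding of instances -/

/-- The input alphabet of the model checking problem. -/
inductive MCSymbol
  | bit (b : Bool)
  | row
  | tick
  | sep
  | eq
  | le
  | and
  | all
  | ex
  deriving DecidableEq, Fintype

/-- A poset is written down as the matrix of its order relation, row by row, each row being
followed by the mark `row`. -/
def FinPoset.encode (P : FinPoset) : List MCSymbol :=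
  (List.finRange P.card).flatMap fun i =>
    (List.finRange P.card).map (fun j => MCSymbol.bit (P.rel i j)) ++ [MCSymbol.row]

/-- The variable `i` is written in unary. -/
def encodeVar (i : ℕ) : List MCSymbol :=
  List.replicate i MCSymbol.tick ++ [MCSymbol.sep]

/-- Formulas are written in Polish notation. -/
def CPFormula.encode : {n : ℕ} → CPFormula n → List MCSymbol
  | _, .eq i j => MCSymbol.eq :: (encodeVar i ++ encodeVar j)
  | _, .le i j => MCSymbol.le :: (encodeVar i ++ encodeVar j)
  | _, .and φ ψ => MCSymbol.and :: (φ.encode ++ ψ.encode)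
  | _, .all φ => MCSymbol.all :: φ.encode
  | _, .ex φ => MCSymbol.ex :: φ.encode

/-- The size of a formula: the length of its code word. -/
def CPFormula.size {n : ℕ} (φ : CPFormula n) : ℕ := φ.encode.length

/-- An instance is written as the poset followed by the sentence. -/
def encodeInstance (P : FinPoset) (φ : CPSentence) : List MCSymbol :=
  P.encode ++ CPFormula.encode φ

theorem encodeVar_append_inj {i j : ℕ} {r s : List MCSymbol}
    (h : encodeVar i ++ r = encodeVar j ++ s) : i = j ∧ r = s := by
  induction i generalizing j with
  | zero => cases j <;> simp_all [encodeVar, List.replicate_succ]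
  | succ i ih =>
    cases j with
    | zero => simp [encodeVar, List.replicate_succ] at h
    | succ j =>
      have h' : encodeVar i ++ r = encodeVar j ++ s := by
        simpa [encodeVar, List.replicate_succ] using h
      obtain ⟨h1, h2⟩ := ih h'
      exact ⟨by rw [h1], h2⟩

theorem CPFormula.encode_append_inj {n : ℕ} (φ ψ : CPFormula n) (r s : List MCSymbol)
    (h : φ.encode ++ r = ψ.encode ++ s) : φ = ψ ∧ r = s := by
  induction φ generalizing r s with
  | eq i j =>
    cases ψ <;> simp only [CPFormula.encode, List.cons_append, List.append_assoc, List.cons.injEq,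
      reduceCtorEq, false_and, true_and] at h
    obtain ⟨h1, h⟩ := encodeVar_append_inj h
    obtain ⟨h2, h⟩ := encodeVar_append_inj h
    exact ⟨by rw [Fin.ext h1, Fin.ext h2], h⟩
  | le i j =>
    cases ψ <;> simp only [CPFormula.encode, List.cons_append, List.append_assoc, List.cons.injEq,
      reduceCtorEq, false_and, true_and] at h
    obtain ⟨h1, h⟩ := encodeVar_append_inj h
    obtain ⟨h2, h⟩ := encodeVar_append_inj h
    exact ⟨by rw [Fin.ext h1, Fin.ext h2], h⟩
  | and φ₁ φ₂ ih₁ ih₂ =>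
    cases ψ <;> simp only [CPFormula.encode, List.cons_append, List.append_assoc, List.cons.injEq,
      reduceCtorEq, false_and, true_and] at h
    obtain ⟨h1, h⟩ := ih₁ _ _ _ h
    obtain ⟨h2, h⟩ := ih₂ _ _ _ h
    exact ⟨by rw [h1, h2], h⟩
  | all φ ih =>
    cases ψ <;> simp only [CPFormula.encode, List.cons_append, List.cons.injEq,
      reduceCtorEq, false_and, true_and] at h
    obtain ⟨h1, h⟩ := ih _ _ _ h
    exact ⟨by rw [h1], h⟩
  | ex φ ih =>
    cases ψ <;> simp only [CPFormula.encode, List.cons_append, List.cons.injEq,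
      reduceCtorEq, false_and, true_and] at h
    obtain ⟨h1, h⟩ := ih _ _ _ h
    exact ⟨by rw [h1], h⟩

theorem CPFormula.count_row_encode {n : ℕ} (φ : CPFormula n) :
    φ.encode.count MCSymbol.row = 0 := by
  induction φ <;> simp_all [CPFormula.encode, encodeVar, List.count_replicate]

theorem FinPoset.count_row_encode (P : FinPoset) : P.encode.count MCSymbol.row = P.card := by
  have h (i : Fin P.card) : ((List.finRange P.card).map (fun j => MCSymbol.bit (P.rel i j))).count
      MCSymbol.row = 0 := by
    rw [List.count_eq_zero]; simp
  simp [FinPoset.encode, List.count_flatMap, h, Function.comp_def]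

theorem flatMap_inj_of_length {α β : Type} {f g : α → List β}
    (hl : ∀ a, (f a).length = (g a).length) (l : List α) (h : l.flatMap f = l.flatMap g) :
    ∀ a ∈ l, f a = g a := by
  induction l with
  | nil => simp
  | cons a l ih =>
    simp only [List.flatMap_cons] at h
    obtain ⟨h1, h2⟩ := List.append_inj h (hl a)
    intro b hb
    rcases List.mem_cons.1 hb with rfl | hb
    · exact h1
    · exact ih h2 b hb

theorem encodeInstance_inj {P P' : FinPoset} {φ φ' : CPSentence}
    (h : encodeInstance P φ = encodeInstance P' φ') : P = P' ∧ φ = φ' := by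
  have hc : P.card = P'.card := by
    have := congrArg (List.count MCSymbol.row) h
    simpa [encodeInstance, FinPoset.count_row_encode, CPFormula.count_row_encode] using this
  obtain ⟨n, hn, R, h1, h2, h3⟩ := P
  obtain ⟨n', hn', R', h1', h2', h3'⟩ := P'
  obtain rfl : n = n' := hc
  obtain ⟨hP, hφ⟩ := List.append_inj h (by simp [FinPoset.encode])
  have hR : R = R' := by
    funext i j
    have hi := flatMap_inj_of_length (fun a => by simp) _ hP i (List.mem_finRange i)
    have hi' := List.append_cancel_right hi
    have := List.map_inj_left.1 hi' j (List.mem_finRange j)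
    simpa using this
  subst hR
  refine ⟨rfl, ?_⟩
  exact (CPFormula.encode_append_inj φ φ' [] [] (by simpa using hφ)).1

/-! ## The model checking problem -/

/-- The problem of deciding, given a poset `P` in the class `C` and a conjunctive positive
sentence `φ`, whether `φ` is true in `P`, parameterized by the size of `φ`. -/
def modelChecking (C : Set FinPoset) : ParamProblem where
  Symbol := MCSymbol
  Instance := C × CPSentence
  encode x := encodeInstance x.1.1 x.2
  encode_injective _ _ h :=
    Prod.ext (Subtype.ext (encodeInstance_inj h).1) (encodeInstance_inj h).2
  yes x := x.1.1.Models x.2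
  param x := x.2.size

/-!
Why model checking conjunctive positive sentences is fixed-parameter tractable on posets of width
at most `w`.

*Colors.* By Dilworth's theorem the poset is a union of `w` chains; label each element by its
chain. The color of rank `0` of a pair of elements records the labels and the order between them;
the color of rank `q + 1` also records the set of pairs of colors of rank `q` that a third element
forms with the two given ones. The number of colors depends on `w` and `q` only. On the product of
two chains, color classes behave like sublattices up to a loss of rank (`col_rect`), so that the
elements of a chain that form a pair of a given color with a given element are convex
(`col_convex`). Convex sets of a chain that meet pairwise have a common element, by Helly's
theorem. Hence, if corresponding pairs of two tuples have the same color of rank `2 * q + 2`, each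
extension of one tuple by an element is matched by an extension of the other one, with colors of
rank `q` (`exists_extension`), and colors of pairs determine the truth of formulas of bounded
quantifier depth at tuples (`sat_of_col`).

*The algorithm.* Galvin's proof of Dilworth's theorem finds the chains in polynomial time for
fixed `w` (`isChainCover_chainCover`). Color refinement computes, on pairs of pairs, the relation
of having the same color of the rank that the given formula requires (`isColorRel_colorRel`). A
quantifier need only range over representatives of the elements up to the colors that they form
with the entries of the current tuple (`exists_mem_tupleList_snoc`); by the bound on the number of
colors, the number of representatives of tuples is bounded in terms of the width and the formula
(`length_tupleList_le`), and the formula is evaluated bottom-up on them (`foldl_evalStep_tokens`).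

*The machine.* The steps are carried out by structured programs on a stack of binary trees, which
compile to multi-stack Turing machines (`Cmd.Exec.reach`). The predicate `FPT` says that a
function between encoded types is computed by such a program in time bounded by a polynomial in
the size of the argument and a primitive recursive function of the parameter; it is closed under
composition, case distinctions and folds over lists with bounded accumulator (`FPT.foldl`), which
is all that the algorithm consists of.
-/

open Turing

/-! ### Structured programs on finitely many stacks -/

/-- Structured programs acting on stacks indexed by `K`.  A test inspects the top of one stack
(`none` if the stack is empty). -/
inductive Cmd {K : Type} (Γ : K → Type) : Type
  | skip
  | push (k : K) (a : Γ k)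
  | pop (k : K)
  | seq (c d : Cmd Γ)
  | ite (k : K) (p : Option (Γ k) → Bool) (c d : Cmd Γ)
  | loop (k : K) (p : Option (Γ k) → Bool) (c : Cmd Γ)

namespace Cmd

variable {K : Type} {Γ : K → Type}

/-- `Exec c S S' t`: from the stacks `S`, the program `c` terminates with the stacks `S'` after
exactly `t` machine steps. -/
inductive Exec [DecidableEq K] :
    Cmd Γ → (∀ k, List (Γ k)) → (∀ k, List (Γ k)) → ℕ → Prop
  | skip (S) : Exec skip S S 1
  | push (k a S) : Exec (push k a) S (Function.update S k (a :: S k)) 1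
  | pop (k S) : Exec (pop k) S (Function.update S k (S k).tail) 1
  | seq {c d S₁ S₂ S₃ t u} : Exec c S₁ S₂ t → Exec d S₂ S₃ u → Exec (seq c d) S₁ S₃ (t + u)
  | ite_true {k p c d S S' t} : p (S k).head? = true → Exec c S S' t →
      Exec (ite k p c d) S S' (1 + t)
  | ite_false {k p c d S S' t} : p (S k).head? = false → Exec d S S' t →
      Exec (ite k p c d) S S' (1 + t)
  | loop_true {k p c S₁ S₂ S₃ t u} : p (S₁ k).head? = true → Exec c S₁ S₂ t →
      Exec (loop k p c) S₂ S₃ u → Exec (loop k p c) S₁ S₃ (1 + (t + u))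
  | loop_false {k p c S} : p (S k).head? = false → Exec (loop k p c) S S 1

/-- The program points of a program. -/
def Label : Cmd Γ → Type
  | skip => Unit
  | push _ _ => Unit
  | pop _ => Unit
  | seq c d => Label c ⊕ Label d
  | ite _ _ c d => Option (Label c ⊕ Label d)
  | loop _ _ c => Option (Label c)

instance Label.instFintype : (c : Cmd Γ) → Fintype (Label c)
  | skip => inferInstanceAs (Fintype Unit)
  | push _ _ => inferInstanceAs (Fintype Unit)
  | pop _ => inferInstanceAs (Fintype Unit)
  | seq c d =>
    haveI := instFintype c; haveI := instFintype d
    inferInstanceAs (Fintype (Label c ⊕ Label d))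
  | ite _ _ c d =>
    haveI := instFintype c; haveI := instFintype d
    inferInstanceAs (Fintype (Option (Label c ⊕ Label d)))
  | loop _ _ c =>
    haveI := instFintype c
    inferInstanceAs (Fintype (Option (Label c)))

/-- The program point at which the execution of a program starts. -/
def entry : (c : Cmd Γ) → Label c
  | skip => ()
  | push _ _ => ()
  | pop _ => ()
  | seq c _ => Sum.inl (entry c)
  | ite _ _ _ _ => (none : Option _)
  | loop _ _ _ => (none : Option _)

/-- The machine code of a program whose program points are embedded by `inj` into the labels of a
machine, and which jumps to the label `ex` on termination.  The internal state is one Boolean, the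
outcome of the latest test. -/
def code {Λ : Type} : (c : Cmd Γ) → (Label c → Λ) → Λ → Label c → TM2.Stmt Γ Λ Bool
  | skip, _, ex, _ => .goto fun _ => ex
  | push k a, _, ex, _ => .push k (fun _ => a) (.goto fun _ => ex)
  | pop k, _, ex, _ => .pop k (fun v _ => v) (.goto fun _ => ex)
  | seq c d, inj, _, Sum.inl l =>
    code c (fun l => inj (Sum.inl l)) (inj (Sum.inr (entry d))) l
  | seq _ d, inj, ex, Sum.inr l => code d (fun l => inj (Sum.inr l)) ex l
  | ite k p c d, inj, _, none =>
    .peek k (fun _ s => p s) (.branch id (.goto fun _ => inj (some (Sum.inl (entry c))))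
      (.goto fun _ => inj (some (Sum.inr (entry d)))))
  | ite _ _ c _, inj, ex, some (Sum.inl l) => code c (fun l => inj (some (Sum.inl l))) ex l
  | ite _ _ _ d, inj, ex, some (Sum.inr l) => code d (fun l => inj (some (Sum.inr l))) ex l
  | loop k p c, inj, ex, none =>
    .peek k (fun _ s => p s) (.branch id (.goto fun _ => inj (some (entry c)))
      (.goto fun _ => ex))
  | loop _ _ c, inj, _, some l => code c (fun l => inj (some l)) (inj none) l

variable [DecidableEq K]

/-- The machine `M` passes from the configuration `a` to `b` in exactly `t` steps. -/
def Reach {Λ : Type} (M : Λ → TM2.Stmt Γ Λ Bool) (t : ℕ) (a b : TM2.Cfg Γ Λ Bool) : Prop :=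
  (flip bind (TM2.step M))^[t] (some a) = some b

theorem Reach.trans {Λ : Type} {M : Λ → TM2.Stmt Γ Λ Bool} {t u : ℕ} {a b c : TM2.Cfg Γ Λ Bool}
    (h : Reach M t a b) (h' : Reach M u b c) : Reach M (t + u) a c := by
  unfold Reach at *
  rw [Nat.add_comm, Function.iterate_add_apply, h, h']

theorem Reach.one {Λ : Type} {M : Λ → TM2.Stmt Γ Λ Bool} {l : Λ} {v : Bool}
    {S : ∀ k, List (Γ k)} {b : TM2.Cfg Γ Λ Bool} (h : TM2.stepAux (M l) v S = b) :
    Reach M 1 ⟨some l, v, S⟩ b := by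
  subst h; rfl

theorem Exec.reach {c : Cmd Γ} {S S' : ∀ k, List (Γ k)} {t : ℕ} (h : Exec c S S' t) {Λ : Type}
    (M : Λ → TM2.Stmt Γ Λ Bool) (inj : Label c → Λ) (ex : Λ)
    (hM : ∀ l, M (inj l) = code c inj ex l) (v : Bool) :
    ∃ v', Reach M t ⟨some (inj (entry c)), v, S⟩ ⟨some ex, v', S'⟩ := by
  induction h generalizing ex v with
  | skip S => exact ⟨v, .one (by rw [hM]; rfl)⟩
  | push k a S => exact ⟨v, .one (by rw [hM]; rfl)⟩
  | pop k S => exact ⟨v, .one (by rw [hM]; rfl)⟩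
  | seq _ _ ih₁ ih₂ =>
    obtain ⟨v₁, h₁⟩ := ih₁ (fun l => inj (Sum.inl l)) _ (fun l => hM (Sum.inl l)) v
    obtain ⟨v₂, h₂⟩ := ih₂ (fun l => inj (Sum.inr l)) ex (fun l => hM (Sum.inr l)) v₁
    exact ⟨v₂, h₁.trans h₂⟩
  | @ite_true k p c d S _ _ hp _ ih =>
    obtain ⟨v₁, h₁⟩ :=
      ih (fun l => inj (some (Sum.inl l))) ex (fun l => hM (some (Sum.inl l))) true
    refine ⟨v₁, Reach.trans (.one ?_) h₁⟩
    rw [show M (inj (entry (ite k p c d))) = _ from hM none]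
    simp [code, hp]
  | @ite_false k p c d S _ _ hp _ ih =>
    obtain ⟨v₁, h₁⟩ :=
      ih (fun l => inj (some (Sum.inr l))) ex (fun l => hM (some (Sum.inr l))) false
    refine ⟨v₁, Reach.trans (.one ?_) h₁⟩
    rw [show M (inj (entry (ite k p c d))) = _ from hM none]
    simp [code, hp]
  | @loop_true k p c _ _ _ _ _ hp _ _ ih₁ ih₂ =>
    obtain ⟨v₁, h₁⟩ := ih₁ (fun l => inj (some l)) (inj none) (fun l => hM (some l)) true
    obtain ⟨v₂, h₂⟩ := ih₂ inj ex hM v₁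
    refine ⟨v₂, Reach.trans (.one ?_) (h₁.trans h₂)⟩
    rw [show M (inj (entry (loop k p c))) = _ from hM none]
    simp [code, hp]
  | @loop_false k p c _ hp =>
    refine ⟨false, .one ?_⟩
    rw [show M (inj (entry (loop k p c))) = _ from hM none]
    simp [code, hp]

/-- `Runs c S S' T`: from the stacks `S`, the program `c` terminates with the stacks `S'` after at
most `T` machine steps. -/
def Runs (c : Cmd Γ) (S S' : ∀ k, List (Γ k)) (T : ℕ) : Prop :=
  ∃ t ≤ T, Exec c S S' t

theorem Runs.mono {c : Cmd Γ} {S S' : ∀ k, List (Γ k)} {T T' : ℕ} (h : Runs c S S' T)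
    (hT : T ≤ T') : Runs c S S' T' :=
  let ⟨t, ht, h⟩ := h
  ⟨t, ht.trans hT, h⟩

theorem Runs.skip (S : ∀ k, List (Γ k)) : Runs Cmd.skip S S 1 := ⟨1, le_rfl, .skip S⟩

theorem Runs.push {k : K} {a : Γ k} {S S' : ∀ k, List (Γ k)}
    (h : Function.update S k (a :: S k) = S') : Runs (Cmd.push k a) S S' 1 :=
  h ▸ ⟨1, le_rfl, .push k a S⟩

theorem Runs.pop {k : K} {S S' : ∀ k, List (Γ k)}
    (h : Function.update S k (S k).tail = S') : Runs (Cmd.pop k) S S' 1 :=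
  h ▸ ⟨1, le_rfl, .pop k S⟩

theorem Runs.seq {c d : Cmd Γ} {S₁ S₂ S₃ : ∀ k, List (Γ k)} {T U : ℕ} (h : Runs c S₁ S₂ T)
    (h' : Runs d S₂ S₃ U) : Runs (Cmd.seq c d) S₁ S₃ (T + U) :=
  let ⟨_, ht, h⟩ := h
  let ⟨_, hu, h'⟩ := h'
  ⟨_, Nat.add_le_add ht hu, .seq h h'⟩

theorem Runs.ite_true {k : K} {p : Option (Γ k) → Bool} {c d : Cmd Γ} {S S' : ∀ k, List (Γ k)}
    {T : ℕ} (hp : p (S k).head? = true) (h : Runs c S S' T) : Runs (Cmd.ite k p c d) S S' (1 + T) :=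
  let ⟨_, ht, h⟩ := h
  ⟨_, Nat.add_le_add_left ht 1, .ite_true hp h⟩

theorem Runs.ite_false {k : K} {p : Option (Γ k) → Bool} {c d : Cmd Γ} {S S' : ∀ k, List (Γ k)}
    {T : ℕ} (hp : p (S k).head? = false) (h : Runs d S S' T) :
    Runs (Cmd.ite k p c d) S S' (1 + T) :=
  let ⟨_, ht, h⟩ := h
  ⟨_, Nat.add_le_add_left ht 1, .ite_false hp h⟩

theorem Runs.loop_true {k : K} {p : Option (Γ k) → Bool} {c : Cmd Γ} {S₁ S₂ S₃ : ∀ k, List (Γ k)}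
    {T U : ℕ} (hp : p (S₁ k).head? = true) (h : Runs c S₁ S₂ T)
    (h' : Runs (Cmd.loop k p c) S₂ S₃ U) : Runs (Cmd.loop k p c) S₁ S₃ (1 + (T + U)) :=
  let ⟨_, ht, h⟩ := h
  let ⟨_, hu, h'⟩ := h'
  ⟨_, Nat.add_le_add_left (Nat.add_le_add ht hu) 1, .loop_true hp h h'⟩

theorem Runs.loop_false {k : K} {p : Option (Γ k) → Bool} {c : Cmd Γ} {S : ∀ k, List (Γ k)}
    (hp : p (S k).head? = false) : Runs (Cmd.loop k p c) S S 1 :=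
  ⟨1, le_rfl, .loop_false hp⟩

end Cmd

/-! ### Binary trees on a stack -/

/-- Binary trees, the data that the programs below operate on. -/
inductive Data : Type
  | nil
  | node (a b : Data)

namespace Data

/-- The code word of a tree in Polish notation.  With the code of `a` on top of the code of `b` on a
stack, pushing `true` forms the tree `node a b`, and popping takes it apart. -/
def code : Data → List Bool
  | nil => [false]
  | node a b => true :: (code a ++ code b)

/-- The length of the code word of a tree. -/
def size (x : Data) : ℕ := x.code.length

@[simp] theorem size_nil : size nil = 1 := rfl

@[simp] theorem size_node (a b : Data) : size (node a b) = size a + size b + 1 := by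
  simp [size, code]

theorem one_le_size (x : Data) : 1 ≤ x.size := by cases x <;> simp

theorem code_append_inj {x y : Data} {v w : List Bool} (h : x.code ++ v = y.code ++ w) :
    x = y ∧ v = w := by
  induction x generalizing y v w with
  | nil => cases y <;> simp_all [code]
  | node a b iha ihb =>
    cases y with
    | nil => simp [code] at h
    | node c d =>
      simp only [code, List.cons_append, List.append_assoc, List.cons.injEq, true_and] at h
      obtain ⟨h₁, h₂⟩ := iha h
      obtain ⟨h₃, h₄⟩ := ihb h₂
      exact ⟨by rw [h₁, h₃], h₄⟩

theorem code_injective : Function.Injective code := fun x y h =>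
  (code_append_inj (v := []) (w := []) (by simpa using h)).1

end Data

/-- The stacks of the machines below: an input stack, a stack of trees in Polish notation, two
auxiliary stacks, a unary counter, and an output stack. -/
inductive Stk
  | inp
  | dat
  | aux
  | aux'
  | cnt
  | out
  deriving DecidableEq

instance Stk.instFintype : Fintype Stk where
  elems := {.inp, .dat, .aux, .aux', .cnt, .out}
  complete x := by cases x <;> simp

/-- The stack alphabets: the input alphabet `A` on the input stack, bits elsewhere. -/
abbrev Stk.Alphabet (A : Type) : Stk → Type
  | .inp => A
  | .dat => Bool
  | .aux => Bool
  | .aux' => Bool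
  | .cnt => Bool
  | .out => Bool

section store

variable {A : Type}

/-- The stack contents `i` (input), `o` (output), `v` (trees), `a`, `b` (auxiliary) and `c`
(counter). -/
def store (i : List A) (o v a b c : List Bool) : ∀ k, List (Stk.Alphabet A k)
  | .inp => i
  | .dat => v
  | .aux => a
  | .aux' => b
  | .cnt => c
  | .out => o

variable (i : List A) (o v a b c : List Bool)

@[simp] theorem store_inp : store i o v a b c .inp = i := rfl
@[simp] theorem store_dat : store i o v a b c .dat = v := rfl
@[simp] theorem store_aux : store i o v a b c .aux = a := rfl
@[simp] theorem store_aux' : store i o v a b c .aux' = b := rfl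
@[simp] theorem store_cnt : store i o v a b c .cnt = c := rfl
@[simp] theorem store_out : store i o v a b c .out = o := rfl

@[simp] theorem update_inp (x : List A) :
    Function.update (store i o v a b c) .inp x = store x o v a b c := by
  funext k; cases k <;> rfl
@[simp] theorem update_dat (x : List Bool) :
    Function.update (store i o v a b c) .dat x = store i o x a b c := by
  funext k; cases k <;> rfl
@[simp] theorem update_aux (x : List Bool) :
    Function.update (store i o v a b c) .aux x = store i o v x b c := by
  funext k; cases k <;> rfl
@[simp] theorem update_aux' (x : List Bool) :
    Function.update (store i o v a b c) .aux' x = store i o v a x c := by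
  funext k; cases k <;> rfl
@[simp] theorem update_cnt (x : List Bool) :
    Function.update (store i o v a b c) .cnt x = store i o v a b x := by
  funext k; cases k <;> rfl
@[simp] theorem update_out (x : List Bool) :
    Function.update (store i o v a b c) .out x = store i x v a b c := by
  funext k; cases k <;> rfl

end store

/-! ### Programs that operate on trees -/

/-- Programs on the stacks `Stk`. -/
abbrev Prog (A : Type) : Type := Cmd (Stk.Alphabet A)

namespace Prog

open Cmd

/-- A sequence of two programs. -/
scoped infixr:60 " ⨾ " => Cmd.seq

/-- Run one of two programs according to the top symbol of a tree stack. -/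
def onDat (c d : Prog A) : Prog A := .ite .dat (fun s => s == some true) c d

/-- Repeat a program while the counter is not empty. -/
def whileCnt (c : Prog A) : Prog A := .loop .cnt (fun s => s.isSome) c

/-- Pop all symbols of the first buffer, running `c s` for each symbol `s`. -/
def drain (c : Bool → Prog A) : Prog A :=
  .loop .aux (fun s => s.isSome)
    (.ite .aux (fun s => s == some true) (.pop .aux ⨾ c true) (.pop .aux ⨾ c false))

/-- Pop all symbols of the second buffer, running `c s` for each symbol `s`. -/
def drain' (c : Bool → Prog A) : Prog A :=
  .loop .aux' (fun s => s.isSome)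
    (.ite .aux' (fun s => s == some true) (.pop .aux' ⨾ c true) (.pop .aux' ⨾ c false))

/-- Move as many trees as the counter says to a buffer, with the push operation `p` of the
buffer. -/
def scanLoop (p : Bool → Prog A) : Prog A :=
  whileCnt (onDat (.pop .dat ⨾ p true ⨾ .push .cnt true) (.pop .dat ⨾ p false ⨾ .pop .cnt))

/-- Move the top tree to the first buffer, reversing its code. -/
def scan : Prog A := .push .cnt true ⨾ scanLoop (fun s => .push .aux s)

/-- Move the top tree to the second buffer, reversing its code. -/
def scan' : Prog A := .push .cnt true ⨾ scanLoop (fun s => .push .aux' s)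

/-- Move a tree back from the first buffer. -/
def restore : Prog A := drain (fun s => .push .dat s)

/-- Move a tree back from the second buffer. -/
def restore' : Prog A := drain' (fun s => .push .dat s)

/-- Exchange the two top trees. -/
def swap : Prog A := scan ⨾ scan' ⨾ restore ⨾ restore'

/-- Duplicate the top tree. -/
def dup : Prog A :=
  scan ⨾ drain (fun s => .push .dat s ⨾ .push .aux' s) ⨾ drain' (fun s => .push .aux s) ⨾ restore

/-- Delete the top tree. -/
def drop : Prog A := scan ⨾ drain (fun _ => .skip)

/-- Join the second and the third tree to one tree. -/
def consUnder : Prog A := scan ⨾ .push .dat true ⨾ restore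

/-- Push the given tree. -/
def pushData : Data → Prog A
  | .nil => .push .dat false
  | .node a b => pushData b ⨾ pushData a ⨾ .push .dat true

variable {A : Type} {i : List A} {o v a b c : List Bool}

theorem runs_scanLoop_aux (x : Data) {S' : ∀ k, List (Stk.Alphabet A k)} {T : ℕ}
    (h : Runs (scanLoop (fun s => .push .aux s)) (store i o v (x.code.reverse ++ a) b c) S' T) :
    Runs (scanLoop (fun s => .push .aux s)) (store i o (x.code ++ v) a b (true :: c)) S'
      (T + 5 * x.size) := by
  induction x generalizing v a c T with
  | nil =>
    refine (Runs.loop_true (by simp) (Runs.ite_false (by simp [Data.code])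
      ((Runs.pop rfl).seq ((Runs.push rfl).seq (Runs.pop rfl)))) (T := 4) (U := T) ?_).mono
        (by simp; omega)
    simpa [Data.code, scanLoop, whileCnt, onDat] using h
  | node y z ihy ihz =>
    have h2 := ihy (ihz (v := v) (a := y.code.reverse ++ true :: a) (c := c) (T := T)
      (by simpa [Data.code] using h))
    refine (Runs.loop_true (by simp) (Runs.ite_true (by simp [Data.code])
      ((Runs.pop rfl).seq ((Runs.push rfl).seq (Runs.push rfl)))) (T := 4)
        (U := T + 5 * z.size + 5 * y.size) ?_).mono (by simp; omega)
    simpa [Data.code, scanLoop, whileCnt, onDat] using h2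

theorem runs_scanLoop_aux' (x : Data) {S' : ∀ k, List (Stk.Alphabet A k)} {T : ℕ}
    (h : Runs (scanLoop (fun s => .push .aux' s)) (store i o v a (x.code.reverse ++ b) c) S' T) :
    Runs (scanLoop (fun s => .push .aux' s)) (store i o (x.code ++ v) a b (true :: c)) S'
      (T + 5 * x.size) := by
  induction x generalizing v b c T with
  | nil =>
    refine (Runs.loop_true (by simp) (Runs.ite_false (by simp [Data.code])
      ((Runs.pop rfl).seq ((Runs.push rfl).seq (Runs.pop rfl)))) (T := 4) (U := T) ?_).mono
        (by simp; omega)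
    simpa [Data.code, scanLoop, whileCnt, onDat] using h
  | node y z ihy ihz =>
    have h2 := ihy (ihz (v := v) (b := y.code.reverse ++ true :: b) (c := c) (T := T)
      (by simpa [Data.code] using h))
    refine (Runs.loop_true (by simp) (Runs.ite_true (by simp [Data.code])
      ((Runs.pop rfl).seq ((Runs.push rfl).seq (Runs.push rfl)))) (T := 4)
        (U := T + 5 * z.size + 5 * y.size) ?_).mono (by simp; omega)
    simpa [Data.code, scanLoop, whileCnt, onDat] using h2

theorem runs_scan (x : Data) : Runs scan (store i o (x.code ++ v) a b [])
    (store i o v (x.code.reverse ++ a) b []) (2 + 5 * x.size) :=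
  ((Runs.push (by simp)).seq (runs_scanLoop_aux x (Runs.loop_false (by simp)))).mono (by omega)

theorem runs_scan' (x : Data) : Runs scan' (store i o (x.code ++ v) a b [])
    (store i o v a (x.code.reverse ++ b) []) (2 + 5 * x.size) :=
  ((Runs.push (by simp)).seq (runs_scanLoop_aux' x (Runs.loop_false (by simp)))).mono
    (by omega)

theorem runs_drain {p : Bool → Prog A} {V B : List Bool → List Bool} {T : ℕ}
    (h : ∀ s l a, Runs (p s) (store i o (V l) a (B l) c)
      (store i o (V (s :: l)) a (B (s :: l)) c) T) (l l' : List Bool) :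
    Runs (drain p) (store i o (V l') l (B l') c)
      (store i o (V (l.reverse ++ l')) [] (B (l.reverse ++ l')) c) (1 + (T + 3) * l.length) := by
  induction l generalizing l' with
  | nil => exact Runs.loop_false (by simp)
  | cons s l ih =>
    have ih := ih (s :: l')
    have hp : Runs (Cmd.pop .aux ⨾ p s) (store i o (V l') (s :: l) (B l') c)
        (store i o (V (s :: l')) l (B (s :: l')) c) (1 + T) :=
      (Runs.pop (by simp)).seq (h s l' l)
    have hl : Runs (.ite .aux (fun s => s == some true) (.pop .aux ⨾ p true) (.pop .aux ⨾ p false))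
        (store i o (V l') (s :: l) (B l') c) (store i o (V (s :: l')) l (B (s :: l')) c)
        (1 + (1 + T)) := by
      cases s
      · exact Runs.ite_false (by simp) hp
      · exact Runs.ite_true (by simp) hp
    refine (Runs.loop_true (by simp) hl (U := 1 + (T + 3) * l.length) ?_).mono
      (by simp [Nat.mul_add]; omega)
    simpa [drain] using ih

theorem runs_drain' {p : Bool → Prog A} {V B : List Bool → List Bool} {T : ℕ}
    (h : ∀ s l b, Runs (p s) (store i o (V l) (B l) b c)
      (store i o (V (s :: l)) (B (s :: l)) b c) T) (l l' : List Bool) :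
    Runs (drain' p) (store i o (V l') (B l') l c)
      (store i o (V (l.reverse ++ l')) (B (l.reverse ++ l')) [] c) (1 + (T + 3) * l.length) := by
  induction l generalizing l' with
  | nil => exact Runs.loop_false (by simp)
  | cons s l ih =>
    have ih := ih (s :: l')
    have hp : Runs (Cmd.pop .aux' ⨾ p s) (store i o (V l') (B l') (s :: l) c)
        (store i o (V (s :: l')) (B (s :: l')) l c) (1 + T) :=
      (Runs.pop (by simp)).seq (h s l' l)
    have hl : Runs (.ite .aux' (fun s => s == some true) (.pop .aux' ⨾ p true)
        (.pop .aux' ⨾ p false))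
        (store i o (V l') (B l') (s :: l) c) (store i o (V (s :: l')) (B (s :: l')) l c)
        (1 + (1 + T)) := by
      cases s
      · exact Runs.ite_false (by simp) hp
      · exact Runs.ite_true (by simp) hp
    refine (Runs.loop_true (by simp) hl (U := 1 + (T + 3) * l.length) ?_).mono
      (by simp [Nat.mul_add]; omega)
    simpa [drain'] using ih

theorem runs_restore (x : Data) : Runs restore (store i o v x.code.reverse b c)
    (store i o (x.code ++ v) [] b c) (1 + 4 * x.size) := by
  have := runs_drain (p := fun s => Cmd.push .dat s) (i := i) (o := o) (c := c)
    (V := fun l => l ++ v) (B := fun _ => b) (T := 1) (fun s l a => Runs.push (by simp))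
    x.code.reverse []
  simpa [Data.size, restore] using this

theorem runs_restore' (x : Data) : Runs restore' (store i o v a x.code.reverse c)
    (store i o (x.code ++ v) a [] c) (1 + 4 * x.size) := by
  have := runs_drain' (p := fun s => Cmd.push .dat s) (i := i) (o := o) (c := c)
    (V := fun l => l ++ v) (B := fun _ => a) (T := 1) (fun s l a => Runs.push (by simp))
    x.code.reverse []
  simpa [Data.size, restore'] using this

theorem runs_swap (x y : Data) : Runs swap (store i o (x.code ++ (y.code ++ v)) [] [] [])
    (store i o (y.code ++ (x.code ++ v)) [] [] []) (6 + 9 * (x.size + y.size)) := by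
  have h₁ := runs_scan (i := i) (o := o) (v := y.code ++ v) (a := []) (b := []) x
  have h₂ := runs_scan' (i := i) (o := o) (v := v) (a := x.code.reverse) (b := []) y
  simp only [List.append_nil] at h₁ h₂
  exact (h₁.seq (h₂.seq ((runs_restore x).seq (runs_restore' y)))).mono (by omega)

theorem runs_dup (x : Data) : Runs dup (store i o (x.code ++ v) [] [] [])
    (store i o (x.code ++ (x.code ++ v)) [] [] []) (5 + 18 * x.size) := by
  have h₁ := runs_scan (i := i) (o := o) (v := v) (a := []) (b := []) x
  have h₂ := runs_drain (p := fun s => Cmd.push .dat s ⨾ Cmd.push .aux' s) (i := i) (o := o)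
    (c := []) (V := fun l => l ++ v) (B := fun l => l) (T := 2)
    (fun s l a => (Runs.push rfl).seq (Runs.push (by simp))) x.code.reverse []
  have h₃ := runs_drain' (p := fun s => Cmd.push .aux s) (i := i) (o := o)
    (c := []) (V := fun _ => x.code ++ v) (B := fun l => l) (T := 1)
    (fun s l a => Runs.push (by simp)) x.code []
  simp only [List.append_nil, List.reverse_reverse, List.nil_append, List.length_reverse]
    at h₁ h₂ h₃
  refine (h₁.seq (h₂.seq (h₃.seq (runs_restore x)))).mono ?_
  simp only [Data.size]; omega

theorem runs_drop (x : Data) : Runs drop (store i o (x.code ++ v) [] [] [])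
    (store i o v [] [] []) (3 + 9 * x.size) := by
  have h₁ := runs_scan (i := i) (o := o) (v := v) (a := []) (b := []) x
  have h₂ := runs_drain (p := fun _ => Cmd.skip) (i := i) (o := o)
    (c := []) (V := fun _ => v) (B := fun _ => []) (T := 1)
    (fun s l a => Runs.skip _) x.code.reverse []
  simp only [List.append_nil, List.length_reverse] at h₁ h₂
  refine (h₁.seq h₂).mono ?_
  simp only [Data.size]; omega

theorem runs_consUnder (x y z : Data) :
    Runs consUnder (store i o (x.code ++ (y.code ++ (z.code ++ v))) [] [] [])
      (store i o (x.code ++ ((Data.node y z).code ++ v)) [] [] []) (4 + 9 * x.size) := by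
  have h₁ := runs_scan (i := i) (o := o) (v := y.code ++ (z.code ++ v)) (a := []) (b := []) x
  simp only [List.append_nil] at h₁
  refine (h₁.seq ((Runs.push rfl).seq (T := 1) (U := 1 + 4 * x.size) ?_)).mono (by omega)
  simpa [Data.code] using runs_restore (i := i) (o := o) (v := (Data.node y z).code ++ v)
    (b := []) (c := []) x

theorem runs_pushData (x : Data) : Runs (pushData x) (store i o v a b c)
    (store i o (x.code ++ v) a b c) x.size := by
  induction x generalizing v with
  | nil => exact Runs.push (by simp [Data.code])
  | node y z ihy ihz =>
    exact (ihz.seq (ihy.seq (Runs.push (by simp [Data.code])))).mono (by simp; omega)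

/-- Compare two buffered codes symbol by symbol; the counter is left empty iff they agree. -/
def compareLoop : Prog A :=
  .loop .aux (fun s => s.isSome)
    (.ite .aux (fun s => s == some true)
      (.ite .aux' (fun s => s == some true) (.pop .aux ⨾ .pop .aux') (.pop .aux ⨾ .push .cnt true))
      (.ite .aux' (fun s => s == some false) (.pop .aux ⨾ .pop .aux')
        (.pop .aux ⨾ .push .cnt true)))

/-- Replace the two top trees by the Boolean answer whether they are equal. -/
def eqData : Prog A :=
  scan ⨾ scan' ⨾ compareLoop ⨾ drain' (fun _ => .push .cnt true) ⨾
    .ite .cnt (fun s => s.isSome) (pushData .nil) (pushData (.node .nil .nil)) ⨾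
    whileCnt (.pop .cnt)

theorem runs_compareLoop (l l' : List Bool) (c : List Bool) :
    ∃ r c', ((r = [] ∧ c' = []) ↔ l = l' ∧ c = []) ∧ r.length ≤ l'.length ∧
      c'.length ≤ c.length + l.length ∧
      Runs compareLoop (store i o v l l' c) (store i o v [] r c') (1 + 5 * l.length) := by
  induction l generalizing l' c with
  | nil => exact ⟨l', c, by simp [eq_comm], le_rfl, by simp, Runs.loop_false (by simp)⟩
  | cons s l ih =>
    by_cases h : l'.head? = some s
    · obtain ⟨l', rfl⟩ : ∃ l₂, l' = s :: l₂ := by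
        cases l' with
        | nil => simp at h
        | cons t l' => simp at h; exact ⟨l', by rw [h]⟩
      obtain ⟨r, c', h₁, h₂, h₃, h₄⟩ := ih l' c
      refine ⟨r, c', by simpa using h₁, by simp; omega, by simp; omega, ?_⟩
      have hp : Runs (Γ := Stk.Alphabet A) (Cmd.pop .aux ⨾ Cmd.pop .aux')
          (store i o v (s :: l) (s :: l') c)
          (store i o v l l' c) (1 + 1) := (Runs.pop rfl).seq (Runs.pop (by simp))
      cases s
      · exact (Runs.loop_true (by simp) (Runs.ite_false (by simp) (Runs.ite_true (by simp) hp))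
          h₄).mono (by simp; omega)
      · exact (Runs.loop_true (by simp) (Runs.ite_true (by simp) (Runs.ite_true (by simp) hp))
          h₄).mono (by simp; omega)
    · obtain ⟨r, c', h₁, h₂, h₃, h₄⟩ := ih l' (true :: c)
      refine ⟨r, c', ?_, h₂, by simp at *; omega, ?_⟩
      · rw [h₁]
        constructor
        · simp
        · rintro ⟨rfl, -⟩
          simp at h
      have hp : Runs (Γ := Stk.Alphabet A) (Cmd.pop .aux ⨾ Cmd.push .cnt true)
          (store i o v (s :: l) l' c)
          (store i o v l l' (true :: c)) (1 + 1) := (Runs.pop rfl).seq (Runs.push (by simp))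
      cases s
      · exact (Runs.loop_true (by simp) (Runs.ite_false (by simp)
          (Runs.ite_false (by simpa using h) hp)) h₄).mono (by simp; omega)
      · exact (Runs.loop_true (by simp) (Runs.ite_true (by simp)
          (Runs.ite_false (by simpa using h) hp)) h₄).mono (by simp; omega)

theorem runs_clearCnt (c : List Bool) : Runs (whileCnt (.pop .cnt)) (store i o v a b c)
    (store i o v a b []) (1 + 2 * c.length) := by
  induction c with
  | nil => exact Runs.loop_false (by simp)
  | cons s c ih => exact (Runs.loop_true (by simp) (Runs.pop (by simp)) ih).mono (by simp; omega)

theorem runs_eqData (x y : Data) [Decidable (x = y)] :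
    Runs eqData (store i o (x.code ++ (y.code ++ v)) [] [] [])
      (store i o ((if x = y then Data.node .nil .nil else .nil).code ++ v) [] [] [])
      (20 + 20 * (x.size + y.size)) := by
  have h₁ := runs_scan (i := i) (o := o) (v := y.code ++ v) (a := []) (b := []) x
  have h₂ := runs_scan' (i := i) (o := o) (v := v) (a := x.code.reverse) (b := []) y
  simp only [List.append_nil] at h₁ h₂
  obtain ⟨r, c, h, hr, hc, h₃⟩ := runs_compareLoop (i := i) (o := o) (v := v) x.code.reverse
    y.code.reverse []
  have h₄ : ∃ c', (c' = [] ↔ x = y) ∧ c'.length ≤ x.size + y.size ∧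
      Runs (Γ := Stk.Alphabet A) (drain' (fun _ => .push .cnt true)) (store i o v [] r c)
        (store i o v [] [] c') (1 + 4 * y.size) := by
    have hxy : (r = [] ∧ c = []) ↔ x = y := by
      rw [h]
      simp [Data.code_injective.eq_iff]
    simp only [List.length_reverse, List.length_nil] at hr hc
    clear h h₁ h₂ h₃
    have : ∃ c', (c' = [] ↔ (r = [] ∧ c = [])) ∧
        c'.length ≤ c.length + r.length ∧
        Runs (Γ := Stk.Alphabet A) (drain' (fun _ => .push .cnt true)) (store i o v [] r c)
        (store i o v [] [] c') (1 + 4 * r.length) := by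
      clear hxy hr hc
      induction r generalizing c with
      | nil => exact ⟨c, by simp, by simp, Runs.loop_false (by simp)⟩
      | cons s r ih =>
        obtain ⟨c', h₁, h₂, h₃⟩ := ih (true :: c)
        refine ⟨c', by simpa using h₁, by simp at *; omega, ?_⟩
        have hp : Runs (Γ := Stk.Alphabet A) (Cmd.pop .aux' ⨾ Cmd.push .cnt true)
            (store i o v [] (s :: r) c)
            (store i o v [] r (true :: c)) (1 + 1) := (Runs.pop rfl).seq (Runs.push (by simp))
        cases s
        · exact (Runs.loop_true (by simp) (Runs.ite_false (by simp) hp) h₃).mono (by simp; omega)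
        · exact (Runs.loop_true (by simp) (Runs.ite_true (by simp) hp) h₃).mono (by simp; omega)
    obtain ⟨c', h₁, h₂, h₃⟩ := this
    exact ⟨c', h₁.trans hxy, by simp only [Data.size]; omega,
      h₃.mono (by simp only [Data.size]; omega)⟩
  obtain ⟨c', hc', hl, h₄⟩ := h₄
  have h₅ : Runs (Γ := Stk.Alphabet A) (.ite .cnt (fun s => s.isSome) (pushData .nil)
      (pushData (.node .nil .nil))) (store i o v [] [] c')
      (store i o ((if x = y then Data.node .nil .nil else .nil).code ++ v) [] [] c') 4 := by
    cases c' with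
    | nil =>
      rw [if_pos (hc'.1 rfl)]
      exact (Runs.ite_false (by simp) (runs_pushData _)).mono (by simp)
    | cons s c' =>
      rw [if_neg (fun h => by simpa using hc'.2 h)]
      exact (Runs.ite_true (by simp) (runs_pushData _)).mono (by simp)
  refine (h₁.seq (h₂.seq (h₃.seq (h₄.seq (h₅.seq (runs_clearCnt c')))))).mono ?_
  simp only [Data.size, List.length_reverse] at *
  omega

end Prog

/-! ### Encodings by trees -/

/-- An encoding of the elements of a type by binary trees. -/
class Enc (α : Type) where
  /-- the tree that encodes an element -/
  enc : α → Data
  enc_injective : Function.Injective enc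

open Enc (enc)

/-- The size of the encoding of an element. -/
def sz {α : Type} [Enc α] (x : α) : ℕ := (enc x).size

section instances

variable {α β : Type} [Enc α] [Enc β]

instance : Enc Bool where
  enc b := if b then .node .nil .nil else .nil
  enc_injective a b h := by cases a <;> cases b <;> simp_all

/-- The unary encoding of the natural numbers. -/
def encNat : ℕ → Data
  | 0 => .nil
  | n + 1 => .node .nil (encNat n)

instance : Enc ℕ where
  enc := encNat
  enc_injective m n h := by
    induction m generalizing n with
    | zero => cases n <;> simp_all [encNat]
    | succ m ih =>
      cases n with
      | zero => simp [encNat] at h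
      | succ n => rw [ih n (by simpa [encNat] using h)]

instance : Enc (α × β) where
  enc p := .node (enc p.1) (enc p.2)
  enc_injective p q h := by
    simp only [Data.node.injEq] at h
    exact Prod.ext (Enc.enc_injective h.1) (Enc.enc_injective h.2)

/-- The encoding of lists: the empty list is a leaf, a nonempty list is the pair of its head and its
tail. -/
def encList : List α → Data
  | [] => .nil
  | a :: l => .node (enc a) (encList l)

instance : Enc (List α) where
  enc := encList
  enc_injective l l' h := by
    induction l generalizing l' with
    | nil => cases l' <;> simp_all [encList]
    | cons a l ih =>
      cases l' with
      | nil => simp [encList] at h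
      | cons a' l' =>
        simp only [encList, Data.node.injEq] at h
        rw [Enc.enc_injective h.1, ih l' h.2]

/-- The symbols of the input alphabet are numbered. -/
def MCSymbol.toNat : MCSymbol → ℕ
  | .bit false => 0
  | .bit true => 1
  | .row => 2
  | .tick => 3
  | .sep => 4
  | .eq => 5
  | .le => 6
  | .and => 7
  | .all => 8
  | .ex => 9

instance : Enc MCSymbol where
  enc s := encNat s.toNat
  enc_injective s t h := by
    have h : s.toNat = t.toNat := Enc.enc_injective (α := ℕ) h
    rcases s with (_ | _) | _ <;> rcases t with (_ | _) | _ <;> simp_all [MCSymbol.toNat]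

theorem one_le_sz (x : α) : 1 ≤ sz x := Data.one_le_size _

@[simp] theorem sz_pair (x : α) (y : β) : sz (x, y) = sz x + sz y + 1 := Data.size_node _ _

@[simp] theorem sz_nil : sz ([] : List α) = 1 := rfl

@[simp] theorem sz_cons (a : α) (l : List α) : sz (a :: l) = sz a + sz l + 1 := Data.size_node _ _

theorem sz_bool_le (b : Bool) : sz b ≤ 3 := by cases b <;> simp [sz, enc]

theorem sz_nat (n : ℕ) : sz n = 2 * n + 1 := by
  induction n with
  | zero => rfl
  | succ n ih =>
    have : sz (n + 1) = sz n + 2 := by simp [sz, enc, encNat]; omega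
    omega

theorem sz_symbol_le (s : MCSymbol) : sz s ≤ 19 := by
  have : sz s = sz s.toNat := rfl
  rw [this, sz_nat]
  rcases s with (_ | _) | _ <;> simp [MCSymbol.toNat]

@[simp] theorem sz_append (l l' : List α) : sz (l ++ l') + 1 = sz l + sz l' := by
  induction l with
  | nil => simp; omega
  | cons a l ih => simp; omega

theorem length_le_sz (l : List α) : l.length ≤ sz l := by
  induction l with
  | nil => simp
  | cons a l ih => simp; omega

theorem sz_le_of_mem {a : α} {l : List α} (h : a ∈ l) : sz a ≤ sz l := by
  induction l with
  | nil => simp at h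
  | cons b l ih =>
    rcases List.mem_cons.1 h with rfl | h
    · simp; omega
    · have := ih h; simp; omega

theorem sz_sublist {l l' : List α} (h : l.Sublist l') : sz l ≤ sz l' := by
  induction h with
  | slnil => simp
  | cons a _ ih => simp; omega
  | cons_cons a _ ih => simp; omega

theorem sz_list_le {l : List α} {b : ℕ} (h : ∀ a ∈ l, sz a ≤ b) :
    sz l ≤ l.length * (b + 1) + 1 := by
  induction l with
  | nil => simp
  | cons a l ih =>
    have h₁ := ih fun a ha => h a (List.mem_cons_of_mem _ ha)
    have h₂ := h a List.mem_cons_self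
    simp only [sz_cons, List.length_cons, Nat.add_mul]
    omega

end instances

/-! ### Fixed-parameter bounds -/

/-- The function `t` is bounded by a polynomial in the size of the argument and a primitive
recursive function of the parameter `κ`. -/
def Bdd {α : Type} [Enc α] (κ : α → ℕ) (t : α → ℕ) : Prop :=
  ∃ (F : ℕ → ℕ) (d : ℕ), Nat.Primrec F ∧ ∀ x, t x ≤ (F (κ x) + sz x + 2) ^ d

namespace Bdd

variable {α β : Type} [Enc α] [Enc β] {κ : α → ℕ} {t u : α → ℕ}

theorem mono (hu : Bdd κ u) (h : ∀ x, t x ≤ u x) : Bdd κ t :=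
  let ⟨F, d, hF, hd⟩ := hu
  ⟨F, d, hF, fun x => (h x).trans (hd x)⟩

theorem param {F : ℕ → ℕ} (hF : Nat.Primrec F) : Bdd κ fun x => F (κ x) :=
  ⟨F, 1, hF, fun x => by simp only [pow_one]; omega⟩

theorem const (n : ℕ) : Bdd κ fun _ => n :=
  param (F := fun _ => n) (Nat.Primrec.const n)

theorem size : Bdd κ sz :=
  ⟨fun _ => 0, 1, Nat.Primrec.const 0, fun x => by simp only [pow_one]; omega⟩

theorem add_primrec {F G : ℕ → ℕ} (hF : Nat.Primrec F) (hG : Nat.Primrec G) :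
    Nat.Primrec fun n => F n + G n :=
  Primrec.nat_iff.1 (Primrec.nat_add.comp (Primrec.nat_iff.2 hF) (Primrec.nat_iff.2 hG))

theorem mul (ht : Bdd κ t) (hu : Bdd κ u) : Bdd κ fun x => t x * u x := by
  obtain ⟨F, d, hF, hd⟩ := ht
  obtain ⟨G, e, hG, he⟩ := hu
  refine ⟨fun n => F n + G n, d + e, add_primrec hF hG, fun x => ?_⟩
  dsimp only
  rw [pow_add]
  exact Nat.mul_le_mul ((hd x).trans (Nat.pow_le_pow_left (by omega) d))
    ((he x).trans (Nat.pow_le_pow_left (by omega) e))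

theorem add (ht : Bdd κ t) (hu : Bdd κ u) : Bdd κ fun x => t x + u x := by
  obtain ⟨F, d, hF, hd⟩ := ht
  obtain ⟨G, e, hG, he⟩ := hu
  refine ⟨fun n => F n + G n, d + e + 1, add_primrec hF hG, fun x => ?_⟩
  dsimp only
  have h₁ : (F (κ x) + sz x + 2) ^ d ≤ (F (κ x) + G (κ x) + sz x + 2) ^ (d + e) :=
    (Nat.pow_le_pow_left (by omega) d).trans (Nat.pow_le_pow_right (by omega) (by omega))
  have h₂ : (G (κ x) + sz x + 2) ^ e ≤ (F (κ x) + G (κ x) + sz x + 2) ^ (d + e) :=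
    (Nat.pow_le_pow_left (by omega) e).trans (Nat.pow_le_pow_right (by omega) (by omega))
  have h₃ := Nat.mul_le_mul_left ((F (κ x) + G (κ x) + sz x + 2) ^ (d + e))
    (show 2 ≤ F (κ x) + G (κ x) + sz x + 2 by omega)
  rw [pow_succ]
  have := hd x
  have := he x
  omega

theorem pow (ht : Bdd κ t) (n : ℕ) : Bdd κ fun x => t x ^ n := by
  induction n with
  | zero => simpa using const 1
  | succ n ih => simpa only [pow_succ] using ih.mul ht

/-- A bound on the values at pairs whose second component is bounded in terms of the first one. -/
theorem of_pair {t : α × β → ℕ} (ht : Bdd (fun p => κ p.1) t) {u : α → ℕ} (hu : Bdd κ u) :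
    ∃ G, Bdd κ G ∧ ∀ x b, sz b ≤ u x → t (x, b) ≤ G x := by
  obtain ⟨F, d, hF, hd⟩ := ht
  refine ⟨fun x => (F (κ x) + (sz x + (u x + 3))) ^ d,
    ((param hF).add (size.add (hu.add (const 3)))).pow d, fun x b hb => ?_⟩
  refine (hd (x, b)).trans (Nat.pow_le_pow_left ?_ d)
  simp only [sz_pair]
  omega

theorem comp {κ' : β → ℕ} {t : β → ℕ} (ht : Bdd κ' t) {f : α → β} (hκ : ∀ x, κ' (f x) = κ x)
    (hf : Bdd κ fun x => sz (f x)) : Bdd κ fun x => t (f x) := by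
  obtain ⟨F, d, hF, hd⟩ := ht
  refine (((param hF).add hf).add (const 2)).pow d |>.mono fun x => ?_
  have := hd (f x)
  rwa [hκ] at this

theorem comp₀ {t : β → ℕ} (ht : Bdd (fun _ => 0) t) {f : α → β}
    (hf : Bdd κ fun x => sz (f x)) : Bdd κ fun x => t (f x) := by
  obtain ⟨F, d, hF, hd⟩ := ht
  exact (((const (F 0)).add hf).add (const 2)).pow d |>.mono fun x => hd (f x)

end Bdd

/-! ### Functions computable in fixed-parameter time -/

/-- The program `c` replaces the tree `x` on top of the tree stack by the tree `y` in time `T`. -/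
def Prog.Computes (c : Prog MCSymbol) (x y : Data) (T : ℕ) : Prop :=
  ∀ i o v, Cmd.Runs c (store i o (x.code ++ v) [] [] []) (store i o (y.code ++ v) [] [] []) T

/-- The function `f` is computed by a program in time bounded by a polynomial in the size of the
argument and a primitive recursive function of the parameter `κ`, and its values are bounded in the
same way. -/
def FPT {α β : Type} [Enc α] [Enc β] (κ : α → ℕ) (f : α → β) : Prop :=
  (Bdd κ fun x => sz (f x)) ∧
    ∃ (c : Prog MCSymbol) (t : α → ℕ), Bdd κ t ∧ ∀ x, c.Computes (enc x) (enc (f x)) (t x)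

namespace FPT

open Cmd Prog

variable {α β γ σ : Type} [Enc α] [Enc β] [Enc γ] [Enc σ] {κ : α → ℕ}

theorem size_bdd {f : α → β} (hf : FPT κ f) : Bdd κ fun x => sz (f x) := hf.1

theorem congr {f g : α → β} (hf : FPT κ f) (h : ∀ x, f x = g x) : FPT κ g := by
  obtain rfl : f = g := funext h
  exact hf

theorem of_enc_eq {f : α → β} (h : ∀ x, enc (f x) = enc x) : FPT κ f :=
  ⟨Bdd.size.mono fun x => by simp [sz, h], .skip, fun _ => 1, Bdd.const 1, fun x i o v => by
    rw [h]; exact Runs.skip _⟩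

theorem id : FPT κ fun x : α => x := of_enc_eq fun _ => rfl

theorem comp {κ' : β → ℕ} {g : β → γ} {f : α → β} (hg : FPT κ' g) (hf : FPT κ f)
    (hκ : ∀ x, κ' (f x) = κ x) : FPT κ fun x => g (f x) := by
  obtain ⟨hg₁, d, u, hu, hd⟩ := hg
  obtain ⟨hf₁, c, t, ht, hc⟩ := hf
  exact ⟨hg₁.comp hκ hf₁, c ⨾ d, _, ht.add (hu.comp hκ hf₁), fun x i o v =>
    (hc x i o v).seq (hd (f x) i o v)⟩

/-- Composition with a function computable without parameter. -/
theorem comp₀ {g : β → γ} {f : α → β} (hg : FPT (fun _ => 0) g) (hf : FPT κ f) :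
    FPT κ fun x => g (f x) := by
  obtain ⟨hg₁, d, u, hu, hd⟩ := hg
  obtain ⟨hf₁, c, t, ht, hc⟩ := hf
  exact ⟨hg₁.comp₀ hf₁, c ⨾ d, _, ht.add (hu.comp₀ hf₁), fun x i o v =>
    (hc x i o v).seq (hd (f x) i o v)⟩

theorem const (b : β) : FPT κ fun _ : α => b :=
  ⟨Bdd.const _, drop ⨾ pushData (enc b), _,
    ((Bdd.const 3).add ((Bdd.const 9).mul Bdd.size)).add (Bdd.const (enc b).size),
    fun x _ _ _ => (runs_drop (enc x)).seq (runs_pushData (enc b))⟩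

theorem pair {f : α → β} {g : α → γ} (hf : FPT κ f) (hg : FPT κ g) :
    FPT κ fun x => (f x, g x) := by
  obtain ⟨hf₁, c, t, ht, hc⟩ := hf
  obtain ⟨hg₁, d, u, hu, hd⟩ := hg
  refine ⟨((hf₁.add hg₁).add (Bdd.const 1)).mono fun x => (sz_pair _ _).le,
    dup ⨾ c ⨾ swap ⨾ d ⨾ swap ⨾ .push .dat true, _,
    ((Bdd.const 5).add ((Bdd.const 18).mul Bdd.size)).add (ht.add
    (((Bdd.const 6).add ((Bdd.const 9).mul (hf₁.add Bdd.size))).add (hu.add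
    (((Bdd.const 6).add ((Bdd.const 9).mul (hg₁.add hf₁))).add (Bdd.const 1))))),
    fun x i o v => ?_⟩
  exact (runs_dup (enc x)).seq ((hc x _ _ _).seq ((runs_swap _ _).seq ((hd x _ _ _).seq
    ((runs_swap _ _).seq (Runs.push (by simp [enc, Data.code]))))))

theorem fst {κ : β × γ → ℕ} : FPT κ fun p : β × γ => p.1 := by
  refine ⟨Bdd.size.mono fun p => ?_, .pop .dat ⨾ swap ⨾ drop, _, ((Bdd.const 1).add
    (((Bdd.const 6).add ((Bdd.const 9).mul Bdd.size)).add
      ((Bdd.const 3).add ((Bdd.const 9).mul Bdd.size)))), fun p i o v => ?_⟩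
  · obtain ⟨x, y⟩ := p
    simp; omega
  · refine ((Runs.pop (S' := store i o ((enc p.1).code ++ ((enc p.2).code ++ v)) [] [] [])
      (by simp [enc, Data.code])).seq ((runs_swap _ _).seq (runs_drop _))).mono ?_
    have : sz p = sz p.1 + sz p.2 + 1 := sz_pair _ _
    simp only [sz] at this ⊢
    omega

theorem snd {κ : β × γ → ℕ} : FPT κ fun p : β × γ => p.2 := by
  refine ⟨Bdd.size.mono fun p => ?_, .pop .dat ⨾ drop, _, ((Bdd.const 1).add
      ((Bdd.const 3).add ((Bdd.const 9).mul Bdd.size))), fun p i o v => ?_⟩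
  · obtain ⟨x, y⟩ := p
    simp; omega
  · refine ((Runs.pop (S' := store i o ((enc p.1).code ++ ((enc p.2).code ++ v)) [] [] [])
      (by simp [enc, Data.code])).seq (runs_drop _)).mono ?_
    have : sz p = sz p.1 + sz p.2 + 1 := sz_pair _ _
    simp only [sz] at this ⊢
    omega

theorem cons {f : α → β} {g : α → List β} (hf : FPT κ f) (hg : FPT κ g) :
    FPT κ fun x => f x :: g x := by
  obtain ⟨h, c, t, ht, hc⟩ := hf.pair hg
  exact ⟨h, c, t, ht, hc⟩

/-- Case distinction by a Boolean. -/
theorem cond {p : α → Bool} {f g : α → β} (hp : FPT κ p) (hf : FPT κ f) (hg : FPT κ g) :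
    FPT κ fun x => if p x then f x else g x := by
  obtain ⟨h, c, t, ht, hc⟩ := hp.pair id
  obtain ⟨hf₁, d, u, hu, hd⟩ := hf
  obtain ⟨hg₁, e, w, hw, he⟩ := hg
  refine ⟨(hf₁.add hg₁).mono fun x => ?_, c ⨾ .pop .dat ⨾
      onDat (drop ⨾ d) (drop ⨾ e), _,
    ht.add ((Bdd.const 1).add ((Bdd.const 1).add ((Bdd.const 30).add (hu.add hw)))),
    fun x i o v => ?_⟩
  · dsimp only
    split <;> omega
  · refine (hc x _ _ _).seq ((Runs.pop (S' := store i o ((enc (p x)).code ++ ((enc x).code ++ v))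
      [] [] []) (by simp [enc, Data.code])).seq ?_)
    have h3 : (enc (p x)).size ≤ 3 := sz_bool_le (p x)
    dsimp only
    cases hx : p x
    · rw [if_neg Bool.false_ne_true]
      refine Runs.mono (Runs.ite_false (by simp [enc, Data.code])
        ((runs_drop _).seq (he x _ _ _))) ?_
      rw [hx] at h3; omega
    · rw [if_pos rfl]
      refine Runs.mono (Runs.ite_true (by simp [enc, Data.code])
        ((runs_drop _).seq (hd x _ _ _))) ?_
      rw [hx] at h3; omega

/-- Case distinction by a list. -/
theorem listCases {l : α → List β} {f : α → γ} {g : α → β → List β → γ} (hl : FPT κ l)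
    (hf : FPT κ f) (hg : FPT (fun p => κ p.1) fun p : α × (β × List β) => g p.1 p.2.1 p.2.2) :
    FPT κ fun x => match l x with
      | [] => f x
      | b :: m => g x b m := by
  obtain ⟨h, c, t, ht, hc⟩ := hl.pair id
  obtain ⟨hf₁, d, u, hu, hd⟩ := hf
  obtain ⟨hg₁, e, w, hw, he⟩ := hg
  obtain ⟨G, hG, hGw⟩ := Bdd.of_pair hw hl.size_bdd
  obtain ⟨H, hH, hHs⟩ := Bdd.of_pair hg₁ hl.size_bdd
  refine ⟨(hf₁.add hH).mono fun x => ?_, c ⨾ .pop .dat ⨾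
      onDat (swap ⨾ .push .dat true ⨾ e) (drop ⨾ d), _,
    ht.add ((Bdd.const 1).add ((Bdd.const 20).add (((Bdd.const 9).mul (hl.size_bdd.add
      Bdd.size)).add (hu.add hG)))), fun x i o v => ?_⟩
  · have := hHs x
    dsimp only
    cases hx : l x with
    | nil => dsimp only; omega
    | cons b m =>
      have := this (b, m) (by rw [hx]; simp)
      dsimp only at this ⊢; omega
  · refine (hc x _ _ _).seq ((Runs.pop (S' := store i o ((enc (l x)).code ++ ((enc x).code ++ v))
      [] [] []) (by simp [enc, Data.code])).seq ?_)
    dsimp only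
    cases hx : l x with
    | nil =>
      refine Runs.mono (Runs.ite_false (by simp [enc, encList, Data.code])
        ((runs_drop _).seq (hd x _ _ _))) ?_
      simp [enc, encList]; omega
    | cons b m =>
      have h₁ := hGw x (b, m) (by rw [hx]; simp)
      have h₂ := he (x, b, m) i o v
      have h₃ : Runs (Cmd.push .dat true) (store i o ((enc x).code ++ ((enc (b :: m)).code ++ v))
          [] [] []) (store i o ((enc (x, b, m)).code ++ v) [] [] []) 1 :=
        Runs.push (by simp [enc, encList, Data.code])
      refine Runs.mono (Runs.ite_true (by simp [enc, encList, Data.code])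
        ((runs_swap _ _).seq (h₃.seq h₂))) ?_
      simp only [sz]
      omega

theorem beq [DecidableEq β] {f g : α → β} (hf : FPT κ f) (hg : FPT κ g) :
    FPT κ fun x => decide (f x = g x) := by
  obtain ⟨h, c, t, ht, hc⟩ := hf.pair hg
  refine ⟨(Bdd.const 3).mono fun x => sz_bool_le _, c ⨾ .pop .dat ⨾ eqData, _,
    ht.add ((Bdd.const 1).add ((Bdd.const 20).add ((Bdd.const 20).mul
      (hf.size_bdd.add hg.size_bdd)))), fun x i o v => ?_⟩
  have hd : Decidable (enc (f x) = enc (g x)) :=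
    decidable_of_iff (f x = g x) Enc.enc_injective.eq_iff.symm
  have := runs_eqData (i := i) (o := o) (v := v) (enc (f x)) (enc (g x))
  refine (hc x _ _ _).seq ((Runs.pop (S' := store i o ((enc (f x)).code ++ ((enc (g x)).code ++ v))
      [] [] []) (by simp [enc, Data.code])).seq ?_)
  have he : (if enc (f x) = enc (g x) then Data.node .nil .nil else .nil) =
      enc (decide (f x = g x)) := by
    by_cases hx : f x = g x <;> simp [hx, enc, Enc.enc_injective.eq_iff]
  rw [← he]
  exact this

/-- Iteration along a list, with a bound on the accumulated values. -/
theorem foldl {l : α → List β} {a : α → σ} {g : α → σ → β → σ} (hl : FPT κ l) (ha : FPT κ a)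
    (hg : FPT (fun p => κ p.1) fun p : α × (β × σ) => g p.1 p.2.2 p.2.1) {B : α → ℕ}
    (hB : Bdd κ B) (h : ∀ x m, m <+: l x → sz (m.foldl (g x) (a x)) ≤ B x) :
    FPT κ fun x => (l x).foldl (g x) (a x) := by
  have hbody : FPT (fun p => κ p.2.1) fun p : β × (α × σ) => (p.2.1, g p.2.1 p.2.2 p.1) := by
    have hg' := hg.comp (f := fun p : β × (α × σ) => (p.2.1, (p.1, p.2.2)))
      (κ := fun p => κ p.2.1) ((fst.comp₀ snd).pair (fst.pair (snd.comp₀ snd))) (fun _ => rfl)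
    exact (fst.comp₀ snd).pair hg'
  obtain ⟨-, c, t, ht, hc⟩ := hbody
  obtain ⟨hi, d, u, hu, hd⟩ := hl.pair (id.pair ha)
  -- a bound on the time of one iteration
  obtain ⟨G, hG, hGt⟩ : ∃ G, Bdd κ G ∧ ∀ x b s, sz b ≤ sz (l x) → sz s ≤ B x →
      t (b, x, s) ≤ G x := by
    obtain ⟨F, n, hF, hn⟩ := ht
    refine ⟨fun x => (F (κ x) + (sz (l x) + (sz x + (B x + 4)))) ^ n, ((Bdd.param hF).add
      (hl.size_bdd.add (Bdd.size.add (hB.add (Bdd.const 4))))).pow n, fun x b s hb hs => ?_⟩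
    refine (hn _).trans (Nat.pow_le_pow_left ?_ n)
    simp only [sz_pair]
    omega
  -- a bound on the time of one iteration together with the rearrangement of the stack
  let per : α → ℕ := fun x => 100 + 100 * (sz (l x) + (sz x + B x)) + G x
  have hper : Bdd κ per :=
    ((Bdd.const 100).add ((Bdd.const 100).mul (hl.size_bdd.add (Bdd.size.add hB)))).add hG
  let body : Prog MCSymbol := .pop .dat ⨾ swap ⨾ consUnder ⨾ swap ⨾ c ⨾ swap
  -- on the tree stack, the rest of the list lies on the pair of the argument and the current value
  have hloop : ∀ x i o v (m : List β) (s : σ), (∀ m', m' <+: m → sz (m'.foldl (g x) s) ≤ B x) →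
      sz m ≤ sz (l x) →
      Runs (.loop .dat (fun s => s == some true) body)
        (store i o ((enc m).code ++ ((enc (x, s)).code ++ v)) [] [] [])
        (store i o (false :: ((enc (x, m.foldl (g x) s)).code ++ v)) [] [] [])
        (1 + per x * m.length) := by
    intro x i o v m
    induction m with
    | nil => exact fun s _ _ => Runs.loop_false (by simp [enc, encList, Data.code])
    | cons b m ih =>
      intro s hs hm
      rw [sz_cons] at hm
      have hs₀ : sz s ≤ B x := hs [] (List.nil_prefix)
      have hs₁ : sz (g x s b) ≤ B x := hs [b] (by simp)
      have ih := ih (g x s b) (fun m' hm' => hs (b :: m') (by simpa using hm')) (by omega)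
      have hbs := hGt x b s (by omega) hs₀
      have hstep : Runs body (store i o ((enc (b :: m)).code ++ ((enc (x, s)).code ++ v)) [] [] [])
          (store i o ((enc m).code ++ ((enc (x, g x s b)).code ++ v)) [] [] [])
          (1 + ((6 + 9 * (sz b + sz m)) + ((4 + 9 * sz m) + ((6 + 9 * (sz m + sz (b, x, s))) +
            (t (b, x, s) + (6 + 9 * (sz (x, g x s b) + sz m))))))) :=
        (Runs.pop (by simp [enc, encList, Data.code])).seq ((runs_swap _ _).seq
          ((runs_consUnder _ _ _).seq ((runs_swap _ _).seq ((hc (b, x, s) _ _ _).seq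
            (runs_swap _ _)))))
      refine (Runs.loop_true (by simp [enc, encList, Data.code]) hstep ih).mono ?_
      simp only [sz_pair, List.length_cons, Nat.mul_add, per] at *
      omega
  have hpop : ∀ x i o v, Runs (Γ := Stk.Alphabet MCSymbol) (Cmd.pop .dat)
      (store i o (false :: ((enc (x, (l x).foldl (g x) (a x))).code ++ v)) [] [] [])
      (store i o ((enc (x, (l x).foldl (g x) (a x))).code ++ v) [] [] []) 1 :=
    fun x i o v => Runs.pop (by simp)
  obtain ⟨-, e, w, hw, he⟩ := snd (β := α) (γ := σ) (κ := fun p => κ p.1)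
  obtain ⟨H, hH, hHw⟩ := Bdd.of_pair hw hB
  refine ⟨hB.mono fun x => h x _ (List.prefix_refl _), d ⨾ .pop .dat ⨾
    .loop .dat (fun s => s == some true) body ⨾ .pop .dat ⨾ e, _,
    hu.add ((Bdd.const 1).add (((Bdd.const 1).add (hper.mul hl.size_bdd)).add ((Bdd.const 1).add
      hH))), fun x i o v => ?_⟩
  refine ((hd x _ _ _).seq ((Runs.pop (S' := store i o ((enc (l x)).code ++
    ((enc (x, a x)).code ++ v)) [] [] []) (by simp [enc, Data.code])).seq
    ((hloop x i o v (l x) (a x) (h x) le_rfl).seq ((hpop x i o v).seq (he _ _ _ _))))).mono ?_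
  have h₁ := hHw x _ (h x _ (List.prefix_refl _))
  have h₂ := Nat.mul_le_mul_left (per x) (length_le_sz (l x))
  dsimp only at *
  omega

end FPT

/-! ### Fixed-parameter programs for lists -/

namespace FPT

variable {α β γ σ : Type} [Enc α] [Enc β] [Enc γ] [Enc σ] {κ : α → ℕ}

theorem congr_enc {f : α → β} {g : α → γ} (hf : FPT κ f) (h : ∀ x, enc (g x) = enc (f x)) :
    FPT κ g := by
  obtain ⟨h₁, c, t, ht, hc⟩ := hf
  exact ⟨h₁.mono fun x => by simp [sz, h], c, t, ht, fun x => by rw [h]; exact hc x⟩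

/-- A bound on the values of a program on the elements of a list. -/
theorem exists_bound_of_mem {l : α → List β} {f : α × β → γ} (hl : FPT κ l)
    (hf : FPT (fun p => κ p.1) f) :
    ∃ G, Bdd κ G ∧ ∀ x, ∀ b ∈ l x, sz (f (x, b)) ≤ G x := by
  obtain ⟨G, hG, h⟩ := Bdd.of_pair hf.size_bdd hl.size_bdd
  exact ⟨G, hG, fun x b hb => h x b (sz_le_of_mem hb)⟩

/-- Iteration along a list where each step increases the size by at most `G`. -/
theorem foldl_of_growth {l : α → List β} {a : α → σ} {g : α → σ → β → σ} (hl : FPT κ l)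
    (ha : FPT κ a) (hg : FPT (fun p => κ p.1) fun p : α × (β × σ) => g p.1 p.2.2 p.2.1)
    {G : α → ℕ} (hG : Bdd κ G) (h : ∀ x s, ∀ b ∈ l x, sz (g x s b) ≤ sz s + G x) :
    FPT κ fun x => (l x).foldl (g x) (a x) := by
  refine foldl hl ha hg (ha.size_bdd.add (hl.size_bdd.mul hG)) fun x m hm => ?_
  have key : ∀ (m : List β) (s : σ), (∀ b ∈ m, b ∈ l x) →
      sz (m.foldl (g x) s) ≤ sz s + m.length * G x := by
    intro m
    induction m with
    | nil => simp
    | cons b m ih =>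
      intro s hb
      have h₁ := h x s b (hb b List.mem_cons_self)
      have h₂ := ih (g x s b) fun c hc => hb c (List.mem_cons_of_mem _ hc)
      simp only [List.foldl_cons, List.length_cons, Nat.add_mul]
      omega
  refine (key m (a x) fun b hb => hm.subset hb).trans ?_
  exact Nat.add_le_add_left (Nat.mul_le_mul_right _ (hm.length_le.trans (length_le_sz _))) _

theorem reverse {l : α → List β} (hl : FPT κ l) : FPT κ fun x => (l x).reverse := by
  have h := foldl_of_growth (g := fun _ s b => b :: s) hl (const [])
    (cons (fst.comp₀ snd) (snd.comp₀ snd)) (hl.size_bdd.add (Bdd.const 1))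
    (fun x s b hb => by have := sz_le_of_mem hb; simp; omega)
  exact h.congr fun x => by simp

theorem foldr_of_growth {l : α → List β} {a : α → σ} {g : α → β → σ → σ} (hl : FPT κ l)
    (ha : FPT κ a) (hg : FPT (fun p => κ p.1) fun p : α × (β × σ) => g p.1 p.2.1 p.2.2)
    {G : α → ℕ} (hG : Bdd κ G) (h : ∀ x s, ∀ b ∈ l x, sz (g x b s) ≤ sz s + G x) :
    FPT κ fun x => (l x).foldr (g x) (a x) := by
  have h := foldl_of_growth (g := fun x s b => g x b s) hl.reverse ha hg hG
    (fun x s b hb => h x s b (List.mem_reverse.1 hb))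
  exact h.congr fun x => by rw [List.foldl_reverse]

theorem append {l m : α → List β} (hl : FPT κ l) (hm : FPT κ m) :
    FPT κ fun x => l x ++ m x := by
  have h := foldr_of_growth (g := fun _ b s => b :: s) hl hm
    (cons (fst.comp₀ snd) (snd.comp₀ snd)) (hl.size_bdd.add (Bdd.const 1))
    (fun x s b hb => by have := sz_le_of_mem hb; simp; omega)
  exact h.congr fun x => by simp

theorem map {l : α → List β} {f : α → β → γ} (hl : FPT κ l)
    (hf : FPT (fun p => κ p.1) fun p : α × β => f p.1 p.2) : FPT κ fun x => (l x).map (f x) := by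
  obtain ⟨G, hG, hGf⟩ := exists_bound_of_mem hl hf
  have h := foldr_of_growth (g := fun x b s => f x b :: s) hl (const [])
    (cons (hf.comp (fst.pair (fst.comp₀ snd)) fun _ => rfl) (snd.comp₀ snd)) (hG.add (Bdd.const 1))
    (fun x s b hb => by have := hGf x b hb; simp at this ⊢; omega)
  exact h.congr fun x => by simp

theorem flatMap {l : α → List β} {f : α → β → List γ} (hl : FPT κ l)
    (hf : FPT (fun p => κ p.1) fun p : α × β => f p.1 p.2) :
    FPT κ fun x => (l x).flatMap (f x) := by
  obtain ⟨G, hG, hGf⟩ := exists_bound_of_mem hl hf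
  have h := foldr_of_growth (g := fun x b s => f x b ++ s) hl (const [])
    (append (hf.comp (fst.pair (fst.comp₀ snd)) fun _ => rfl) (snd.comp₀ snd)) hG
    (fun x s b hb => by have := hGf x b hb; have := sz_append (f x b) s; dsimp only at *; omega)
  refine h.congr fun x => ?_
  induction l x with
  | nil => rfl
  | cons b m ih => simp [ih]

theorem filter {l : α → List β} {p : α → β → Bool} (hl : FPT κ l)
    (hp : FPT (fun p => κ p.1) fun x : α × β => p x.1 x.2) :
    FPT κ fun x => (l x).filter (p x) := by
  have h := foldr_of_growth (g := fun x b s => if p x b then b :: s else s) hl (const [])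
    (cond (hp.comp (fst.pair (fst.comp₀ snd)) fun _ => rfl)
      (cons (fst.comp₀ snd) (snd.comp₀ snd)) (snd.comp₀ snd)) (hl.size_bdd.add (Bdd.const 1))
    (fun x s b hb => by
      have := sz_le_of_mem hb
      split
      · rw [sz_cons]; omega
      · omega)
  refine h.congr fun x => ?_
  induction l x with
  | nil => rfl
  | cons b m ih => simp only [List.foldr_cons, List.filter_cons, ih]

theorem and {p q : α → Bool} (hp : FPT κ p) (hq : FPT κ q) : FPT κ fun x => p x && q x :=
  (cond hp hq (const false)).congr fun x => by cases p x <;> simp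

theorem or {p q : α → Bool} (hp : FPT κ p) (hq : FPT κ q) : FPT κ fun x => p x || q x :=
  (cond hp (const true) hq).congr fun x => by cases p x <;> simp

theorem not {p : α → Bool} (hp : FPT κ p) : FPT κ fun x => !p x :=
  (cond hp (const false) (const true)).congr fun x => by cases p x <;> simp

theorem any {l : α → List β} {p : α → β → Bool} (hl : FPT κ l)
    (hp : FPT (fun p => κ p.1) fun x : α × β => p x.1 x.2) :
    FPT κ fun x => (l x).any (p x) := by
  have h := foldr_of_growth (g := fun x b s => p x b || s) hl (const false)
    (or (hp.comp (fst.pair (fst.comp₀ snd)) fun _ => rfl) (snd.comp₀ snd)) (Bdd.const 3)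
    (fun x s b hb => (sz_bool_le _).trans (by omega))
  refine h.congr fun x => ?_
  induction l x with
  | nil => rfl
  | cons b m ih => simp [ih]

theorem all {l : α → List β} {p : α → β → Bool} (hl : FPT κ l)
    (hp : FPT (fun p => κ p.1) fun x : α × β => p x.1 x.2) :
    FPT κ fun x => (l x).all (p x) :=
  (hl.any (p := fun x b => !p x b) hp.not).not.congr fun x => by rw [List.all_eq_not_any_not]

theorem mem {b : α → β} {l : α → List β} {_ : ∀ x, Decidable (b x ∈ l x)} (hb : FPT κ b)
    (hl : FPT κ l) : FPT κ fun x => decide (b x ∈ l x) := by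
  classical
  have h := hl.any (p := fun x c => decide (b x = c))
    (beq (hb.comp fst fun _ => rfl) snd)
  exact h.congr fun x => by
    rw [Bool.eq_iff_iff]
    simp

theorem succ {f : α → ℕ} (hf : FPT κ f) : FPT κ fun x => f x + 1 :=
  ((const false).pair hf).congr_enc fun _ => rfl

theorem tail {l : α → List β} (hl : FPT κ l) : FPT κ fun x => (l x).tail :=
  (hl.listCases (g := fun _ _ m => m) (const []) (snd.comp₀ snd)).congr fun x => by
    cases l x <;> rfl

theorem getD {l : α → List β} {n : α → ℕ} {d : α → β} (hl : FPT κ l) (hn : FPT κ n)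
    (hd : FPT κ d) : FPT κ fun x => (l x).getD (n x) (d x) := by
  have hr : FPT κ fun x => List.replicate (n x) false := hn.congr_enc fun x => by
    have : ∀ m, enc (List.replicate m false) = encNat m := fun m => by
      induction m with
      | zero => rfl
      | succ m ih => exact congrArg (Data.node .nil) ih
    exact this _
  have h := foldl_of_growth (g := fun _ s _ => s.tail) hr hl (tail (snd.comp₀ snd)) (Bdd.const 0)
    (fun x s b _ => by cases s <;> simp; omega)
  refine (h.listCases (g := fun _ b _ => b) hd (fst.comp₀ snd)).congr fun x => ?_
  have : ∀ m (l : List β), (List.replicate m false).foldl (fun s _ => s.tail) l = l.drop m := by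
    intro m
    induction m with
    | zero => simp
    | succ m ih => intro l; simp [List.replicate_succ, ih]
  rw [this, List.getD_eq_getElem?_getD, ← List.head?_drop]
  cases (l x).drop (n x) <;> rfl

end FPT

/-! ### From programs to machines -/

namespace Prog

open Cmd

/-- Read one input symbol among those in a list and put its code in front of the list that is on
top of the tree stack. -/
def readSymbol : List MCSymbol → Prog MCSymbol
  | [] => .skip
  | s :: l => .ite .inp (fun t => t == some s) (.pop .inp ⨾ pushData (enc s) ⨾ .push .dat true)
      (readSymbol l)

/-- All symbols of the input alphabet. -/
def allSymbols : List MCSymbol :=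
  [.bit false, .bit true, .row, .tick, .sep, .eq, .le, .and, .all, .ex]

/-- Turn the input into the list of its symbols, in reversed order, on the tree stack. -/
def readInput : Prog MCSymbol :=
  .push .dat false ⨾ .loop .inp (fun s => s.isSome) (readSymbol allSymbols)

/-- Move a Boolean from the tree stack to the output. -/
def writeOutput : Prog MCSymbol :=
  onDat (drop ⨾ .push .out true) (drop ⨾ .push .out false)

theorem runs_readSymbol {i : List MCSymbol} {o v : List Bool} {s : MCSymbol} :
    ∀ {l : List MCSymbol}, s ∈ l → Runs (readSymbol l) (store (s :: i) o v [] [] [])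
      (store i o (true :: ((enc s).code ++ v)) [] [] []) (l.length + 21)
  | t :: l, h => by
    have hs : (enc s).size ≤ 19 := sz_symbol_le s
    by_cases hst : s = t
    · subst hst
      refine Runs.mono (Runs.ite_true (by simp) ((Runs.pop (S' := store i o v [] [] [])
        (by simp)).seq ((runs_pushData (enc s)).seq (Runs.push (by simp))))) ?_
      simp only [List.length_cons]
      omega
    · refine Runs.mono (Runs.ite_false (by simpa using hst)
        (runs_readSymbol ((List.mem_cons.1 h).resolve_left hst))) ?_
      simp only [List.length_cons]
      omega

theorem runs_readInput (i : List MCSymbol) : Runs readInput (store i [] [] [] [] [])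
    (store [] [] ((enc i.reverse).code) [] [] []) (2 + 32 * i.length) := by
  have h : ∀ i l : List MCSymbol, Runs (.loop .inp (fun s => s.isSome) (readSymbol allSymbols))
      (store i [] ((enc l).code) [] [] []) (store [] [] ((enc (i.reverse ++ l)).code) [] [] [])
      (1 + 32 * i.length) := by
    intro i
    induction i with
    | nil => exact fun l => Runs.loop_false (by simp)
    | cons s i ih =>
      intro l
      have h := ih (s :: l)
      have hs : Runs (readSymbol allSymbols) (store (s :: i) [] ((enc l).code) [] [] [])
          (store i [] ((enc (s :: l)).code) [] [] []) (10 + 21) := by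
        have := runs_readSymbol (i := i) (o := []) (v := (enc l).code) (s := s) (l := allSymbols)
          (by rcases s with (_ | _) | _ <;> simp [allSymbols])
        simpa [enc, encList, Data.code, show allSymbols.length = 10 from rfl] using this
      refine Runs.mono (Runs.loop_true (by simp) hs (by simpa using h)) ?_
      simp only [List.length_cons]
      omega
  refine Runs.mono ((Runs.push (S' := store i [] ((enc ([] : List MCSymbol)).code) [] [] [])
    (by simp [enc, encList, Data.code])).seq (by simpa using h i [])) (by omega)

theorem runs_writeOutput (b : Bool) : Runs writeOutput (store [] [] (enc b).code [] [] [])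
    (store [] [b] [] [] [] []) 32 := by
  have hb : (enc b).size ≤ 3 := sz_bool_le b
  have hd := runs_drop (i := ([] : List MCSymbol)) (o := []) (v := []) (enc b)
  rw [List.append_nil] at hd
  cases b
  · exact Runs.mono (Runs.ite_false (by simp [enc, Data.code])
      (hd.seq (Runs.push (by simp)))) (by omega)
  · exact Runs.mono (Runs.ite_true (by simp [enc, Data.code])
      (hd.seq (Runs.push (by simp)))) (by omega)

/-- The machine that executes a program from the input stack to the output stack. -/
def machine (c : Prog MCSymbol) : TM2ComputableAux MCSymbol Bool where
  tm :=
    { K := Stk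
      k₀ := .inp
      k₁ := .out
      Γ := Stk.Alphabet MCSymbol
      Λ := Option (Label c)
      main := some (entry c)
      σ := Bool
      initialState := false
      Γk₀Fin := inferInstanceAs (Fintype MCSymbol)
      m := fun l => match l with
        | none => .load (fun _ => false) .halt
        | some l => code c some none l }
  inputAlphabet := Equiv.refl _
  outputAlphabet := Equiv.refl _

theorem machine_outputsInTime {c : Prog MCSymbol} {i : List MCSymbol} {b : Bool} {T : ℕ}
    (h : Runs c (store i [] [] [] [] []) (store [] [b] [] [] [] []) T) :
    Nonempty (TM2OutputsInTime (machine c).tm (i.map (machine c).inputAlphabet.symm)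
      (some ([b].map (machine c).outputAlphabet.symm)) (T + 1)) := by
  obtain ⟨t, ht, h⟩ := h
  obtain ⟨v, hr⟩ := h.reach (machine c).tm.m some none (fun _ => rfl) false
  have hr := hr.trans (c := ⟨none, false, store [] [b] [] [] [] []⟩) (Reach.one (l := none) rfl)
  have h₁ : initList (machine c).tm (i.map (machine c).inputAlphabet.symm) =
      ⟨some (some (entry c)), false, store i [] [] [] [] []⟩ := by
    simp only [initList]
    congr 1
    funext k
    cases k <;> simp [machine, store]
    exact List.map_id i
  have h₂ : haltList (machine c).tm ([b].map (machine c).outputAlphabet.symm) =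
      ⟨none, false, store [] [b] [] [] [] []⟩ := by
    simp only [haltList]
    congr 1
    funext k
    cases k <;> simp [machine, store]
    rfl
  refine ⟨⟨⟨t + 1, ?_⟩, Nat.add_le_add_right ht 1⟩⟩
  rw [h₁, Option.map_some, h₂]
  exact hr

end Prog

/-- A decision procedure in the calculus of programs yields a machine: `code x` is the input word
for the instance `x`, which is encoded as a tree by the reversal of that word. -/
theorem FPT.exists_machine {β : Type} [Enc β] {κ : β → ℕ} {f : β → Bool} (hf : FPT κ f)
    {code : β → List MCSymbol} (hcode : ∀ x, enc x = enc (code x).reverse) :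
    ∃ (M : TM2ComputableAux MCSymbol Bool) (F : ℕ → ℕ) (p : Polynomial ℕ), Computable F ∧
      ∀ x, Nonempty (TM2OutputsInTime M.tm ((code x).map M.inputAlphabet.symm)
        (some ([f x].map M.outputAlphabet.symm)) (F (κ x) * p.eval (code x).length)) := by
  obtain ⟨-, c, t, ⟨F, d, hF, hd⟩, hc⟩ := hf
  refine ⟨Prog.machine (Cmd.seq Prog.readInput (Cmd.seq c Prog.writeOutput)),
    fun k => (F k + 3) ^ d + 1, (21 * Polynomial.X + 1) ^ d + 40 * Polynomial.X + 40, ?_,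
    fun x => ?_⟩
  · have hF : Primrec F := Primrec.nat_iff.2 hF
    have hpow : Primrec₂ fun m n : ℕ => m ^ n := Primrec₂.unpaired'.1 Nat.Primrec.pow
    exact (Primrec.nat_add.comp (hpow.comp (Primrec.nat_add.comp hF (Primrec.const 3))
      (Primrec.const d)) (Primrec.const 1)).to_comp
  · have h₁ := (Prog.runs_readInput (code x)).seq (d := Cmd.seq c Prog.writeOutput) (U := t x + 32)
      (S₃ := store [] [f x] [] [] [] []) (by
        have h₂ := hc x [] [] []
        rw [hcode, List.append_nil, List.append_nil] at h₂
        exact h₂.seq (Prog.runs_writeOutput (f x)))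
    obtain ⟨h⟩ := Prog.machine_outputsInTime h₁
    refine ⟨⟨h.toEvalsTo, h.steps_le_m.trans ?_⟩⟩
    -- a symbol contributes at most 20 to the size of a list of symbols
    have hsz : sz x ≤ 20 * (code x).length + 1 := by
      have : sz x = sz (code x).reverse := by simp only [sz, hcode]
      rw [this]
      refine (sz_list_le (b := 19) fun s _ => sz_symbol_le s).trans ?_
      rw [List.length_reverse]; omega
    have ht : t x ≤ (F (κ x) + 3) ^ d * (21 * (code x).length + 1) ^ d := by
      rw [← mul_pow]
      refine (hd x).trans (Nat.pow_le_pow_left ?_ d)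
      nlinarith [Nat.zero_le (F (κ x) * (code x).length)]
    have he : Polynomial.eval (code x).length
        ((21 * Polynomial.X + 1) ^ d + 40 * Polynomial.X + 40 : Polynomial ℕ) =
        (21 * (code x).length + 1) ^ d + 40 * (code x).length + 40 := by
      simp
    rw [he]
    dsimp only
    generalize (F (κ x) + 3) ^ d = a at *
    generalize (21 * (code x).length + 1) ^ d = b at *
    nlinarith [Nat.zero_le (a * (40 * (code x).length + 40))]

/-! ### Colors of pairs in a partial order with labelled chains -/

/-- The colors of rank `q` of pairs of elements, for labels from `Fin w`.  A color of rank `0` is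
the pair of labels and the order type; a color of rank `q + 1` refines a color `c` of rank `q` by
the set of pairs of colors of rank `q` of the two pairs that a third element forms with the given
ones. -/
def Color (w : ℕ) : ℕ → Type
  | 0 => (Fin w × Fin w) × (Prop × Prop)
  | q + 1 => Color w q × Set (Color w q × Color w q)

instance Color.instFinite (w : ℕ) : (q : ℕ) → Finite (Color w q)
  | 0 => inferInstanceAs (Finite ((Fin w × Fin w) × (Prop × Prop)))
  | q + 1 =>
    haveI := instFinite w q
    inferInstanceAs (Finite (Color w q × Set (Color w q × Color w q)))

/-- The number of colors of a given rank. -/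
def colorCount (w : ℕ) : ℕ → ℕ
  | 0 => w * w * 4
  | q + 1 => colorCount w q * 2 ^ (colorCount w q * colorCount w q)

theorem Color.card (w q : ℕ) : Nat.card (Color w q) = colorCount w q := by
  induction q with
  | zero =>
    change Nat.card ((Fin w × Fin w) × (Prop × Prop)) = w * w * 4
    simp
  | succ q ih =>
    change Nat.card (Color w q × Set (Color w q × Color w q)) = _
    have := Fintype.ofFinite (Color w q)
    rw [Nat.card_prod, ih, Nat.card_eq_fintype_card (α := Set _), Fintype.card_set,
      Fintype.card_prod, ← Nat.card_eq_fintype_card, ih, colorCount]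

section

variable {V : Type} {w : ℕ} (r : V → V → Prop) (lab : V → Fin w)

/-- The color of rank `q` of a pair of elements. -/
def col : (q : ℕ) → V → V → Color w q
  | 0, x, y => ((lab x, lab y), (r x y, r y x))
  | q + 1, x, y => (col q x y, {p | ∃ z, p = (col q x z, col q z y)})

variable {r lab} {q s : ℕ} {x y x' y' : V}

theorem col_zero_iff : col r lab 0 x y = col r lab 0 x' y' ↔
    (lab x = lab x' ∧ lab y = lab y') ∧ (r x y ↔ r x' y') ∧ (r y x ↔ r y' x') :=
  (Prod.ext_iff (α := Fin w × Fin w) (β := Prop × Prop)).trans (and_congr Prod.ext_iff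
    (Prod.ext_iff.trans (and_congr eq_iff_iff eq_iff_iff)))

theorem col_succ_iff : col r lab (q + 1) x y = col r lab (q + 1) x' y' ↔
    col r lab q x y = col r lab q x' y' ∧
      (∀ z, ∃ z', col r lab q x z = col r lab q x' z' ∧ col r lab q z y = col r lab q z' y') ∧
      (∀ z', ∃ z, col r lab q x z = col r lab q x' z' ∧ col r lab q z y = col r lab q z' y') := by
  refine (Prod.ext_iff (α := Color w q) (β := Set (Color w q × Color w q))).trans
    (and_congr Iff.rfl (Set.ext_iff.trans
      ⟨fun h => ⟨fun z => ?_, fun z => ?_⟩, fun h p => ⟨?_, ?_⟩⟩))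
  · obtain ⟨z', hz⟩ := (h _).1 ⟨z, rfl⟩
    exact ⟨z', (Prod.ext_iff.1 hz)⟩
  · obtain ⟨z', hz⟩ := (h _).2 ⟨z, rfl⟩
    exact ⟨z', (Prod.ext_iff.1 hz.symm)⟩
  · rintro ⟨z, rfl⟩
    obtain ⟨z', h₁, h₂⟩ := h.1 z
    exact ⟨z', by rw [h₁, h₂]⟩
  · rintro ⟨z, rfl⟩
    obtain ⟨z', h₁, h₂⟩ := h.2 z
    exact ⟨z', by rw [h₁, h₂]⟩

theorem col_mono (hqs : q ≤ s) (h : col r lab s x y = col r lab s x' y') :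
    col r lab q x y = col r lab q x' y' := by
  induction hqs with
  | refl => exact h
  | step _ ih => exact ih (col_succ_iff.1 h).1

theorem col_swap (h : col r lab q x y = col r lab q x' y') :
    col r lab q y x = col r lab q y' x' := by
  induction q generalizing x y x' y' with
  | zero =>
    rw [col_zero_iff] at h ⊢
    exact ⟨h.1.symm, h.2.symm⟩
  | succ q ih =>
    rw [col_succ_iff] at h ⊢
    refine ⟨ih h.1, fun z => ?_, fun z => ?_⟩
    · obtain ⟨z', h₁, h₂⟩ := h.2.1 z
      exact ⟨z', ih h₂, ih h₁⟩
    · obtain ⟨z', h₁, h₂⟩ := h.2.2 z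
      exact ⟨z', ih h₂, ih h₁⟩

/-- Reversing the order does not change which pairs have equal colors. -/
theorem col_flip_iff : col (flip r) lab q x y = col (flip r) lab q x' y' ↔
    col r lab q x y = col r lab q x' y' := by
  induction q generalizing x y x' y' with
  | zero =>
    rw [col_zero_iff, col_zero_iff]
    exact and_congr Iff.rfl and_comm
  | succ q ih => simp only [col_succ_iff, ih]

theorem lab_eq_of_col (h : col r lab q x y = col r lab q x' y') : lab x = lab x' ∧ lab y = lab y' :=
  (col_zero_iff.1 (col_mono (Nat.zero_le q) h)).1

theorem rel_iff_of_col (h : col r lab q x y = col r lab q x' y') : r x y ↔ r x' y' :=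
  (col_zero_iff.1 (col_mono (Nat.zero_le q) h)).2.1

theorem col_self_of_col [IsPartialOrder V r] (h : col r lab (q + 1) x y = col r lab (q + 1) x' y') :
    col r lab q y y = col r lab q y' y' := by
  obtain ⟨z, h₁, h₂⟩ := (col_succ_iff.1 h).2.1 y
  obtain rfl : z = y' := antisymm_of r ((rel_iff_of_col h₂).1 (refl_of r y))
    ((rel_iff_of_col (col_swap h₂)).1 (refl_of r y))
  exact h₂

/-- Elements with the same label form a chain. -/
def ChainLabels (r : V → V → Prop) (lab : V → Fin w) : Prop :=
  ∀ x y, lab x = lab y → r x y ∨ r y x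

/-- If two pairs that lie crosswise on two chains have the same color of rank `2 * q`, then the
pair of their smaller components has the same color of rank `q`.  Thus the color classes behave
like sublattices of the products of two chains. -/
theorem col_rect (q : ℕ) : ∀ (r : V → V → Prop) [IsPartialOrder V r], ChainLabels r lab →
    ∀ {a a' b b' : V}, r a a' → r b' b → col r lab (2 * q) a b = col r lab (2 * q) a' b' →
      col r lab q a b' = col r lab q a b := by
  induction q with
  | zero =>
    intro r _ _ a a' b b' haa hbb h
    have hl := lab_eq_of_col h
    have h₁ := rel_iff_of_col h
    have h₂ := rel_iff_of_col (col_swap h)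
    rw [col_zero_iff]
    exact ⟨⟨rfl, hl.2.symm⟩, ⟨fun h => trans_of r h hbb, fun h => trans_of r haa (h₁.1 h)⟩,
      ⟨fun h => h₂.2 (trans_of r h haa), fun h => trans_of r hbb h⟩⟩
  | succ q ih =>
    intro r _ hlab a a' b b' haa hbb h
    have hflip : IsPartialOrder V (flip r) :=
      { refl := fun x => refl_of r x
        trans := fun x y z h h' => trans_of r h' h
        antisymm := fun x y h h' => antisymm_of r h' h }
    have lower {x x' y y'} (h₁ : r x x') (h₂ : r y' y)
        (h : col r lab (2 * q) x y = col r lab (2 * q) x' y') :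
        col r lab q x y' = col r lab q x y := ih r hlab h₁ h₂ h
    -- the pair of larger components, by reversing the order
    have upper {x x' y y'} (h₁ : r x x') (h₂ : r y' y)
        (h : col r lab (2 * q) x y = col r lab (2 * q) x' y') :
        col r lab q x' y = col r lab q x y :=
      (col_flip_iff.1 (ih (flip r) (fun x y hxy => (hlab x y hxy).symm) h₁ h₂
        (col_flip_iff.2 h.symm))).trans (col_mono (by omega) h.symm)
    have h : col r lab (2 * q + 1 + 1) a b = col r lab (2 * q + 1 + 1) a' b' := h
    have hq : col r lab (q + 1) a' b' = col r lab (q + 1) a b := (col_mono (by omega) h).symm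
    obtain ⟨-, hf, hb⟩ := col_succ_iff.1 h
    refine col_succ_iff.2 ⟨lower haa hbb (col_mono (by omega) h), fun z => ?_, fun z => ?_⟩
    · -- `u` corresponds to `z` in the passage from `a, b` to `a', b'`, and `v` in the passage back
      obtain ⟨u, hu₁, hu₂⟩ := hf z
      obtain ⟨v, hv₁, hv₂⟩ := hb z
      rcases hlab u z (lab_eq_of_col hu₁).2.symm with huz | hzu
      · obtain ⟨z', h₁, h₂⟩ := (col_succ_iff.1 hq).2.1 z
        exact ⟨z', (upper haa huz (col_mono (by omega) hu₁)).symm.trans h₁, h₂⟩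
      rcases hlab v z (lab_eq_of_col hv₂).1 with hvz | hzv
      · exact ⟨z, rfl, ((upper hvz hbb (col_mono (by omega) hv₂)).trans
          (col_mono (by omega) hv₂)).symm⟩
      -- now `u` together with `b'` continues the color of `z` and `b'`
      obtain ⟨v', hv'₁, hv'₂⟩ := (col_succ_iff.1 hu₂).2.1 v
      have huv : r u v' := (rel_iff_of_col hv'₁).1 hzv
      obtain ⟨b'', hb''₁, -⟩ := (col_succ_iff.1 (col_swap hu₁)).2.1 b'
      have hub : col r lab q u b' = col r lab q z b' := by
        rcases hlab b'' b' (lab_eq_of_col hb''₁).2.symm with hbb'' | hbb''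
        · exact upper hzu hbb'' hb''₁
        · refine (lower huv hbb'' ?_).trans (col_mono (by omega) hb''₁.symm)
          exact hb''₁.symm.trans ((col_mono (by omega) hv₂.symm).trans hv'₂)
      obtain ⟨z', h₁, h₂⟩ := (col_succ_iff.1 hq).2.1 u
      exact ⟨z', (col_mono (by omega) hu₁).trans h₁, hub.symm.trans h₂⟩
    · obtain ⟨u, hu₁, hu₂⟩ := hf z
      rcases hlab z u (lab_eq_of_col hu₁).2 with hzu | huz
      · exact ⟨z, rfl, lower hzu hbb (col_mono (by omega) hu₂)⟩
      · exact ⟨u, lower haa huz (col_mono (by omega) hu₁), col_mono (by omega) hu₂.symm⟩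

/-- On a chain, the elements that form a pair of a given color with a fixed element are convex, up
to a loss of rank. -/
theorem col_convex [IsPartialOrder V r] (hlab : ChainLabels r lab) {a a' m y M : V}
    (hm : r m y) (hM : r y M) (h₁ : col r lab (2 * q) a m = col r lab (2 * q) a' y)
    (h₂ : col r lab (2 * q) a M = col r lab (2 * q) a' y) :
    col r lab q a y = col r lab q a' y := by
  rcases hlab a a' (lab_eq_of_col h₁).1 with h | h
  · exact (col_rect q r hlab h hM h₂).trans (col_mono (by omega) h₂)
  · have hflip : IsPartialOrder V (flip r) :=
      { refl := fun x => refl_of r x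
        trans := fun x y z h h' => trans_of r h' h
        antisymm := fun x y h h' => antisymm_of r h' h }
    exact (col_flip_iff.1 (col_rect q (flip r) (fun x y hxy => (hlab x y hxy).symm) h hm
      (col_flip_iff.2 h₁))).trans (col_mono (by omega) h₁)

/-- The number of elements below `x`. -/
noncomputable def numBelow (r : V → V → Prop) (x : V) : ℕ := {z | r z x}.ncard

theorem rel_of_numBelow_le [Finite V] [IsPartialOrder V r] (hlab : ChainLabels r lab)
    (hxy : lab x = lab y) (h : numBelow r x ≤ numBelow r y) : r x y := by
  rcases hlab x y hxy with h' | h'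
  · exact h'
  · have hs : {z | r z y} ⊆ {z | r z x} := fun z hz => trans_of r hz h'
    have := Set.eq_of_subset_of_ncard_le hs h (Set.toFinite _)
    have hx : x ∈ {z | r z x} := refl_of r x
    rwa [← this] at hx

/-- Helly's theorem for the convex sets of `col_convex`: if all pairs of two tuples have the same
colors of rank `2 * q + 2`, then each extension of the first tuple by an element is matched by an
extension of the second one, with respect to colors of rank `q`. -/
theorem exists_extension [Finite V] [IsPartialOrder V r] (hlab : ChainLabels r lab) {n : ℕ}
    {a a' : Fin n → V}
    (h : ∀ i j, col r lab (2 * q + 2) (a i) (a j) = col r lab (2 * q + 2) (a' i) (a' j)) (y : V) :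
    ∃ y', (∀ i, col r lab q (a i) y = col r lab q (a' i) y') ∧
      col r lab q y y = col r lab q y' y' := by
  rcases Nat.eq_zero_or_pos n with rfl | hn
  · exact ⟨y, fun i => i.elim0, rfl⟩
  have hne : (Finset.univ : Finset (Fin n)).Nonempty := ⟨⟨0, hn⟩, Finset.mem_univ _⟩
  have hY (i j) : ∃ z, col r lab (2 * q + 1) (a i) y = col r lab (2 * q + 1) (a' i) z ∧
      col r lab (2 * q + 1) (a j) y = col r lab (2 * q + 1) (a' j) z := by
    obtain ⟨z, h₁, h₂⟩ := (col_succ_iff.1 (h i j)).2.1 y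
    exact ⟨z, h₁, col_swap h₂⟩
  choose Y hY₁ hY₂ using hY
  have hlY i j : lab (Y i j) = lab y := (lab_eq_of_col (hY₁ i j)).2.symm
  -- the maximum over `i` of the minimum over `j` of the elements `Y i j`
  choose k hk using fun i => Finset.exists_min_image Finset.univ (fun j => numBelow r (Y i j)) hne
  obtain ⟨i, -, hi⟩ := Finset.exists_max_image Finset.univ (fun i => numBelow r (Y i (k i))) hne
  refine ⟨Y i (k i), fun j => ?_, col_self_of_col (col_mono (by omega) (hY₁ i (k i)))⟩
  have hm : r (Y j (k j)) (Y i (k i)) :=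
    rel_of_numBelow_le hlab (by rw [hlY, hlY]) (hi j (Finset.mem_univ _))
  have hM : r (Y i (k i)) (Y i j) :=
    rel_of_numBelow_le hlab (by rw [hlY, hlY]) ((hk i).2 j (Finset.mem_univ _))
  obtain ⟨b, hb, -⟩ := (col_succ_iff.1 (col_swap (hY₁ i (k i)))).2.1 (a j)
  have hb := col_swap hb
  refine (col_mono (by omega) hb).trans (Eq.symm ?_)
  refine col_convex hlab hm hM ?_ ?_
  · exact (col_mono (by omega) (hY₁ j (k j)).symm).trans hb
  · exact (col_mono (by omega) (hY₂ i j).symm).trans hb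

end

/-! ### Colors determine the truth of formulas -/

/-- Truth of a formula under an assignment, for a binary relation `r`. -/
def CPFormula.Sat {V : Type} (r : V → V → Prop) : {n : ℕ} → CPFormula n → (Fin n → V) → Prop
  | _, .eq i j, v => v i = v j
  | _, .le i j, v => r (v i) (v j)
  | _, .and φ ψ, v => φ.Sat r v ∧ ψ.Sat r v
  | n, .all φ, v => ∀ y, φ.Sat r (Fin.snoc (α := fun _ : Fin (n + 1) => V) v y)
  | n, .ex φ, v => ∃ y, φ.Sat r (Fin.snoc (α := fun _ : Fin (n + 1) => V) v y)

/-- The quantifier depth of a formula. -/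
def CPFormula.depth : {n : ℕ} → CPFormula n → ℕ
  | _, .eq _ _ => 0
  | _, .le _ _ => 0
  | _, .and φ ψ => max φ.depth ψ.depth
  | _, .all φ => φ.depth + 1
  | _, .ex φ => φ.depth + 1

/-- The rank of colors that determines the truth of formulas of quantifier depth `d`. -/
def rankFor : ℕ → ℕ
  | 0 => 0
  | d + 1 => 2 * rankFor d + 2

theorem rankFor_mono {d e : ℕ} (h : d ≤ e) : rankFor d ≤ rankFor e := by
  induction h with
  | refl => exact le_rfl
  | step _ ih => exact ih.trans (by simp only [rankFor]; omega)

section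

variable {V : Type} {w : ℕ} {r : V → V → Prop} {lab : V → Fin w}

theorem col_snoc {q n : ℕ} {a a' : Fin n → V} {y y' : V}
    (h : ∀ i j, col r lab q (a i) (a j) = col r lab q (a' i) (a' j))
    (hy : ∀ i, col r lab q (a i) y = col r lab q (a' i) y')
    (hyy : col r lab q y y = col r lab q y' y') (i j : Fin (n + 1)) :
    col r lab q (Fin.snoc (α := fun _ : Fin (n + 1) => V) a y i)
        (Fin.snoc (α := fun _ : Fin (n + 1) => V) a y j) =
      col r lab q (Fin.snoc (α := fun _ : Fin (n + 1) => V) a' y' i)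
        (Fin.snoc (α := fun _ : Fin (n + 1) => V) a' y' j) := by
  induction i using Fin.lastCases <;> induction j using Fin.lastCases <;>
    simp only [Fin.snoc_last, Fin.snoc_castSucc, h, hy, hyy, col_swap (hy _)]

/-- If corresponding pairs of two tuples have the same colors, then the formulas of bounded
quantifier depth that are true at the first tuple are true at the second one. -/
theorem sat_of_col [Finite V] [IsPartialOrder V r] (hlab : ChainLabels r lab) {n : ℕ}
    (φ : CPFormula n) {a a' : Fin n → V}
    (h : ∀ i j, col r lab (rankFor φ.depth) (a i) (a j) =
      col r lab (rankFor φ.depth) (a' i) (a' j)) (hφ : φ.Sat r a) : φ.Sat r a' := by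
  induction φ with
  | eq i j =>
    have hφ : a i = a j := hφ
    have h₁ := h i j
    rw [hφ] at h₁
    exact antisymm_of r ((rel_iff_of_col h₁).1 (refl_of r _))
      ((rel_iff_of_col (col_swap h₁)).1 (refl_of r _))
  | le i j => exact (rel_iff_of_col (h i j)).1 hφ
  | and φ ψ ih₁ ih₂ =>
    exact ⟨ih₁ (fun i j => col_mono (rankFor_mono (le_max_left _ _)) (h i j)) hφ.1,
      ih₂ (fun i j => col_mono (rankFor_mono (le_max_right _ _)) (h i j)) hφ.2⟩
  | all φ ih =>
    intro y'
    obtain ⟨y, h₁, h₂⟩ := exists_extension hlab (fun i j => (h i j).symm) y'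
    exact ih (col_snoc
      (fun i j => col_mono (by simp only [CPFormula.depth, rankFor]; omega) (h i j))
      (fun i => (h₁ i).symm) h₂.symm) (hφ y)
  | ex φ ih =>
    obtain ⟨y, hy⟩ := hφ
    obtain ⟨y', h₁, h₂⟩ := exists_extension hlab h y
    exact ⟨y', ih (col_snoc (fun i j => col_mono (by simp only [CPFormula.depth, rankFor]; omega)
      (h i j)) h₁ h₂) hy⟩

end

/-! ### Covering a list of bounded width by chains -/

section

variable {α : Type} (le : α → α → Bool)

/-- Sort a list into a linear extension of the order, by insertion. -/
def linearize (L : List α) : List α :=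
  L.foldl (fun S a => S.filter (fun x => !le a x) ++ a :: S.filter (fun x => le a x)) []

/-- Exhaustive search for an antichain of a given size. -/
def hasAntichain : ℕ → List α → Bool
  | 0, _ => true
  | m + 1, L => L.any fun x => hasAntichain m (L.filter fun y => !le x y && !le y x)

/-- The chains with top element `a` among which one is sought that meets all antichains of maximum
size: besides the chain `[a]`, the chains that prolong an initial segment of one of the given
chains. -/
def chainCandidates (Cs : List (List α)) (a : α) : List (List α) :=
  [a] :: Cs.flatMap fun C =>
    (C.filter fun x => le x a).map fun x => a :: C.filter fun z => le z x

/-- The elements of `L` that do not belong to `K`. -/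
abbrev without [DecidableEq α] (L K : List α) : List α := L.filter fun x => !decide (x ∈ K)

/-- One step of the chain covering.  The state consists of the elements `s.1` treated so far and a
cover `s.2` of them by chains; a first chain for the elements `s.1` and `a` is chosen such that the
remaining elements have smaller width, and these are covered by `rec`. -/
def coverStep [DecidableEq α] (k : ℕ) (rec : List α → List (List α))
    (s : List α × List (List α)) (a : α) : List α × List (List α) :=
  (s.1 ++ [a],
    match (chainCandidates le s.2 a).filter
      (fun K => !hasAntichain le (k + 1) (without (s.1 ++ [a]) K)) with
    | [] => []
    | K :: _ => K :: rec (without (s.1 ++ [a]) K))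

/-- Cover a linearly extended list of width at most `k` by `k` chains, following Galvin's proof of
Dilworth's theorem. -/
def chainCover [DecidableEq α] : ℕ → List α → List (List α)
  | 0, _ => []
  | k + 1, L => (L.foldl (coverStep le k (chainCover k)) ([], [])).2

/-- The elements of a list increase with respect to a linear extension of the order. -/
def Ascending (L : List α) : Prop := L.Pairwise fun x y => le y x = false

/-- The lists in `Cs` are at most `k` disjoint chains that cover the list `L`. -/
structure IsChainCover (k : ℕ) (L : List α) (Cs : List (List α)) : Prop where
  length_le : Cs.length ≤ k
  exists_mem : ∀ a ∈ L, ∃ C ∈ Cs, a ∈ C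
  mem_of_mem : ∀ C ∈ Cs, ∀ a ∈ C, a ∈ L
  total : ∀ C ∈ Cs, ∀ a ∈ C, ∀ b ∈ C, le a b = true ∨ le b a = true
  disjoint : ∀ C ∈ Cs, ∀ D ∈ Cs, ∀ a ∈ C, a ∈ D → C = D

variable {le}

theorem mem_linearize {L : List α} {a : α} : a ∈ linearize le L ↔ a ∈ L := by
  have h : ∀ L S : List α, a ∈ L.foldl
      (fun S a => S.filter (fun x => !le a x) ++ a :: S.filter (fun x => le a x)) S ↔
        a ∈ S ∨ a ∈ L := by
    intro L
    induction L with
    | nil => simp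
    | cons b L ih =>
      intro S
      rw [List.foldl_cons, ih]
      have : a ∈ S.filter (fun x => !le b x) ++ b :: S.filter (fun x => le b x) ↔
          a ∈ S ∨ a = b := by
        simp only [List.mem_append, List.mem_filter, List.mem_cons]
        cases le b a <;> simp; tauto
      rw [this, List.mem_cons]
      tauto
  simpa [linearize] using h L []

theorem ascending_linearize (hle : IsPartialOrder α fun a b => le a b = true) {L : List α}
    (hL : L.Nodup) : Ascending le (linearize le L) := by
  have h : ∀ L S : List α, Ascending le S → L.Nodup → (∀ a ∈ L, a ∉ S) → Ascending le (L.foldl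
      (fun S a => S.filter (fun x => !le a x) ++ a :: S.filter (fun x => le a x)) S) := by
    intro L
    induction L with
    | nil => exact fun S hS _ _ => hS
    | cons a L ih =>
      intro S hS hL hd
      rw [List.nodup_cons] at hL
      refine ih _ ?_ hL.2 fun b hb hbS => ?_
      · refine List.pairwise_append.2 ⟨hS.filter _, List.pairwise_cons.2 ⟨fun x hx => ?_,
          hS.filter _⟩, fun x hx y hy => ?_⟩
        · rw [List.mem_filter] at hx
          by_contra hxa
          rw [Bool.not_eq_false] at hxa
          have : a = x := hle.antisymm _ _ hx.2 hxa
          exact hd a List.mem_cons_self (this ▸ hx.1)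
        · simp only [List.mem_filter, Bool.not_eq_true'] at hx
          rcases List.mem_cons.1 hy with rfl | hy
          · exact hx.2
          · by_contra hyx
            rw [Bool.not_eq_false] at hyx
            have : le a x = true := hle.trans _ _ _ (List.mem_filter.1 hy).2 hyx
            rw [hx.2] at this
            exact Bool.false_ne_true this
      · have hbS : b ∈ S ∨ b = a := by
          simp only [List.mem_append, List.mem_filter, List.mem_cons] at hbS
          tauto
        rcases hbS with h | rfl
        · exact hd b (List.mem_cons_of_mem _ hb) h
        · exact hL.1 hb
  exact h L [] List.Pairwise.nil hL (by simp)

theorem exists_max_of_total (hle : IsPartialOrder α fun a b => le a b = true) {S : List α}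
    (hS : S ≠ []) (ht : ∀ a ∈ S, ∀ b ∈ S, le a b = true ∨ le b a = true) :
    ∃ x ∈ S, ∀ y ∈ S, le y x = true := by
  induction S with
  | nil => exact absurd rfl hS
  | cons a S ih =>
    by_cases hS' : S = []
    · subst hS'
      exact ⟨a, by simp, fun y hy => by rw [List.mem_singleton.1 hy]; exact hle.refl a⟩
    obtain ⟨x, hx, h⟩ := ih hS' fun b hb c hc => ht b (List.mem_cons_of_mem _ hb) c
      (List.mem_cons_of_mem _ hc)
    rcases ht a List.mem_cons_self x (List.mem_cons_of_mem _ hx) with hax | hxa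
    · refine ⟨x, List.mem_cons_of_mem _ hx, fun y hy => ?_⟩
      rcases List.mem_cons.1 hy with rfl | hy
      · exact hax
      · exact h y hy
    · refine ⟨a, List.mem_cons_self, fun y hy => ?_⟩
      rcases List.mem_cons.1 hy with rfl | hy
      · exact hle.refl y
      · exact hle.trans _ _ _ (h y hy) hxa

variable [DecidableEq α]

theorem hasAntichain_iff (hle : IsPartialOrder α fun a b => le a b = true) {m : ℕ} {L : List α} :
    hasAntichain le m L = true ↔ ∃ A : Finset α, (∀ x ∈ A, x ∈ L) ∧ A.card = m ∧
      ∀ x ∈ A, ∀ y ∈ A, x ≠ y → le x y = false := by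
  induction m generalizing L with
  | zero => exact ⟨fun _ => ⟨∅, by simp⟩, fun _ => rfl⟩
  | succ m ih =>
    simp only [hasAntichain, List.any_eq_true]
    constructor
    · rintro ⟨x, hx, h⟩
      obtain ⟨A, hA, hc, hanti⟩ := ih.1 h
      simp only [List.mem_filter, Bool.and_eq_true, Bool.not_eq_true'] at hA
      have hxA : x ∉ A := fun h => by
        have h₁ := (hA x h).2.1
        have h₂ : le x x = true := hle.refl x
        rw [h₁] at h₂
        exact Bool.false_ne_true h₂
      refine ⟨insert x A, ?_, by rw [Finset.card_insert_of_notMem hxA, hc], ?_⟩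
      · intro y hy
        rcases Finset.mem_insert.1 hy with rfl | hy
        · exact hx
        · exact (hA y hy).1
      · intro y hy z hz hyz
        rcases Finset.mem_insert.1 hy with rfl | hy' <;>
          rcases Finset.mem_insert.1 hz with rfl | hz'
        · exact absurd rfl hyz
        · exact (hA z hz').2.1
        · exact (hA y hy').2.2
        · exact hanti y hy' z hz' hyz
    · rintro ⟨A, hA, hc, hanti⟩
      obtain ⟨x, hx⟩ : A.Nonempty := Finset.card_pos.1 (by omega)
      refine ⟨x, hA x hx, ih.2 ⟨A.erase x, fun y hy => ?_, by
        rw [Finset.card_erase_of_mem hx, hc]; rfl, fun y hy z hz => hanti y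
          (Finset.mem_of_mem_erase hy) z (Finset.mem_of_mem_erase hz)⟩⟩
      obtain ⟨hyx, hy⟩ := Finset.mem_erase.1 hy
      simp [List.mem_filter, hA y hy, hanti x hx y hy hyx.symm, hanti y hy x hx hyx]

theorem hasAntichain_mono (hle : IsPartialOrder α fun a b => le a b = true) {m : ℕ}
    {L L' : List α} (h : ∀ x ∈ L, x ∈ L') (hL' : hasAntichain le m L' = false) :
    hasAntichain le m L = false := by
  by_contra hL
  rw [Bool.not_eq_false, hasAntichain_iff hle] at hL
  obtain ⟨A, hA, hc⟩ := hL
  rw [(hasAntichain_iff hle).2 ⟨A, fun x hx => h x (hA x hx), hc⟩] at hL'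
  exact absurd hL' (by simp)

/-- An antichain of maximum size meets each chain of the cover. -/
theorem IsChainCover.exists_mem_antichain {k : ℕ} {L : List α} {Cs : List (List α)}
    (hC : IsChainCover le k L Cs) {A : Finset α} (hA : ∀ x ∈ A, x ∈ L) (hc : A.card = k)
    (hanti : ∀ x ∈ A, ∀ y ∈ A, x ≠ y → le x y = false) :
    Cs.toFinset.card = k ∧ ∀ C ∈ Cs, ∃ x ∈ C, x ∈ A := by
  choose! f hf₁ hf₂ using fun x hx => hC.exists_mem x (hA x hx)
  have hinj : Set.InjOn f A := fun x hx y hy hxy => by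
    by_contra hne
    rcases hC.total _ (hf₁ x hx) x (hf₂ x hx) y (hxy ▸ hf₂ y hy) with h | h
    · rw [hanti x hx y hy hne] at h; exact Bool.false_ne_true h
    · rw [hanti y hy x hx (Ne.symm hne)] at h; exact Bool.false_ne_true h
  have hsub : A.image f ⊆ Cs.toFinset := fun C hC => by
    obtain ⟨x, hx, rfl⟩ := Finset.mem_image.1 hC
    exact List.mem_toFinset.2 (hf₁ x hx)
  have hcard : (A.image f).card = k := by rw [Finset.card_image_of_injOn hinj, hc]
  have hle : Cs.toFinset.card ≤ k := (List.toFinset_card_le _).trans hC.length_le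
  have heq := Finset.eq_of_subset_of_card_le hsub (by omega)
  refine ⟨by rw [← heq, hcard], fun C hC => ?_⟩
  rw [← List.mem_toFinset, ← heq, Finset.mem_image] at hC
  obtain ⟨x, hx, rfl⟩ := hC
  exact ⟨x, hf₂ x hx, hx⟩

/-- Galvin's lemma: some candidate chain meets all antichains of size `k + 1`. -/
theorem exists_good_candidate (hle : IsPartialOrder α fun a b => le a b = true) {k : ℕ}
    {R : List α} {a : α} {Cs : List (List α)} (hasc : Ascending le (R ++ [a]))
    (hw : hasAntichain le (k + 2) (R ++ [a]) = false) (hC : IsChainCover le (k + 1) R Cs) :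
    ∃ K ∈ chainCandidates le Cs a,
      hasAntichain le (k + 1) (without (R ++ [a]) K) = false := by
  have haR : ∀ x ∈ R, le a x = false := fun x hx =>
    (List.pairwise_append.1 hasc).2.2 x hx a (by simp)
  have haR' : a ∉ R := fun h => by
    have h₁ : le a a = true := hle.refl a
    rw [haR a h] at h₁
    exact Bool.false_ne_true h₁
  have hfilter (K : List α) (haK : a ∈ K) :
      ∀ x ∈ without (R ++ [a]) K, x ∈ R ∧ x ∉ K := fun x hx => by
    simp only [List.mem_filter, List.mem_append, List.mem_singleton, Bool.not_eq_true',
      decide_eq_false_iff_not] at hx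
    rcases hx.1 with h | rfl
    · exact ⟨h, hx.2⟩
    · exact absurd haK hx.2
  by_cases hR : hasAntichain le (k + 1) R = true
  · have : Nonempty α := ⟨a⟩
    obtain ⟨A₀, hA₀⟩ := (hasAntichain_iff hle).1 hR
    -- the greatest element of each chain that lies in an antichain of size `k + 1`
    have hX : ∀ C ∈ Cs, ∃ x ∈ C, (∃ A : Finset α, (∀ x ∈ A, x ∈ R) ∧ A.card = k + 1 ∧
        (∀ x ∈ A, ∀ y ∈ A, x ≠ y → le x y = false) ∧ x ∈ A) ∧
        ∀ y ∈ C, (∃ A : Finset α, (∀ x ∈ A, x ∈ R) ∧ A.card = k + 1 ∧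
        (∀ x ∈ A, ∀ y ∈ A, x ≠ y → le x y = false) ∧ y ∈ A) → le y x = true := by
      classical
      intro C hCC
      obtain ⟨x₀, hx₀, hx₀A⟩ := (hC.exists_mem_antichain hA₀.1 hA₀.2.1 hA₀.2.2).2 C hCC
      obtain ⟨x, hx, hmax⟩ := exists_max_of_total hle (S := C.filter fun x => decide
        (∃ A : Finset α, (∀ x ∈ A, x ∈ R) ∧ A.card = k + 1 ∧
        (∀ x ∈ A, ∀ y ∈ A, x ≠ y → le x y = false) ∧ x ∈ A))
        (List.ne_nil_of_mem (List.mem_filter.2 ⟨hx₀, decide_eq_true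
          ⟨A₀, hA₀.1, hA₀.2.1, hA₀.2.2, hx₀A⟩⟩))
        (fun a ha b hb => hC.total C hCC a (List.mem_filter.1 ha).1 b (List.mem_filter.1 hb).1)
      obtain ⟨hx₁, hx₂⟩ := List.mem_filter.1 hx
      exact ⟨x, hx₁, of_decide_eq_true hx₂, fun y hy h =>
        hmax y (List.mem_filter.2 ⟨hy, decide_eq_true h⟩)⟩
    choose! X hX₁ hX₂ hX₃ using hX
    have hXinj : ∀ C ∈ Cs, ∀ D ∈ Cs, X C = X D → C = D := fun C hCC D hD h =>
      hC.disjoint C hCC D hD (X C) (hX₁ C hCC) (h ▸ hX₁ D hD)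
    have hXanti : ∀ C ∈ Cs, ∀ D ∈ Cs, X C ≠ X D → le (X C) (X D) = false := by
      intro C hCC D hD hne
      by_contra hle'
      rw [Bool.not_eq_false] at hle'
      obtain ⟨A, hA₁, hA₂, hA₃, hA₄⟩ := hX₂ D hD
      obtain ⟨y, hy, hyA⟩ := (hC.exists_mem_antichain hA₁ hA₂ hA₃).2 C hCC
      have hyX := hX₃ C hCC y hy ⟨A, hA₁, hA₂, hA₃, hyA⟩
      have hyD : le y (X D) = true := hle.trans _ _ _ hyX hle'
      have : y = X D := by
        by_contra hne'
        rw [hA₃ y hyA _ hA₄ hne'] at hyD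
        exact Bool.false_ne_true hyD
      exact hne (by rw [hC.disjoint C hCC D hD y hy (this ▸ hX₁ D hD)])
    obtain ⟨C, hCC, hCa⟩ : ∃ C ∈ Cs, le (X C) a = true := by
      by_contra hno
      push Not at hno
      have hmem : ∀ x ∈ Cs.toFinset.image X, x ∈ R ∧ le x a = false ∧ ∃ C ∈ Cs, X C = x := by
        intro x hx
        obtain ⟨C, hCC, rfl⟩ := Finset.mem_image.1 hx
        rw [List.mem_toFinset] at hCC
        exact ⟨hC.mem_of_mem C hCC _ (hX₁ C hCC), Bool.eq_false_iff.2 (hno C hCC), C, hCC, rfl⟩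
      have hcard : (Cs.toFinset.image X).card = k + 1 := by
        rw [Finset.card_image_of_injOn fun C hCC D hD =>
          hXinj C (List.mem_toFinset.1 hCC) D (List.mem_toFinset.1 hD)]
        exact (hC.exists_mem_antichain hA₀.1 hA₀.2.1 hA₀.2.2).1
      have := (hasAntichain_iff hle (m := k + 2) (L := R ++ [a])).2
        ⟨insert a (Cs.toFinset.image X), fun x hx => ?_, ?_, fun x hx y hy hxy => ?_⟩
      · rw [hw] at this
        exact Bool.false_ne_true this
      · rcases Finset.mem_insert.1 hx with rfl | hx
        · simp
        · exact List.mem_append_left _ (hmem x hx).1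
      · rw [Finset.card_insert_of_notMem fun h => haR' (hmem a h).1, hcard]
      · rcases Finset.mem_insert.1 hx with rfl | hx' <;>
          rcases Finset.mem_insert.1 hy with rfl | hy'
        · exact absurd rfl hxy
        · exact haR y (hmem y hy').1
        · exact (hmem x hx').2.1
        · obtain ⟨-, -, C, hCC, rfl⟩ := hmem x hx'
          obtain ⟨-, -, D, hD, rfl⟩ := hmem y hy'
          exact hXanti C hCC D hD hxy
    refine ⟨a :: C.filter fun z => le z (X C), List.mem_cons_of_mem _ (List.mem_flatMap.2
      ⟨C, hCC, List.mem_map.2 ⟨X C, List.mem_filter.2 ⟨hX₁ C hCC, hCa⟩, rfl⟩⟩), ?_⟩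
    by_contra hB
    rw [Bool.not_eq_false, hasAntichain_iff hle] at hB
    obtain ⟨B, hB₁, hB₂, hB₃⟩ := hB
    have hB₁ := fun x hx => hfilter _ List.mem_cons_self x (hB₁ x hx)
    obtain ⟨z, hz, hzB⟩ :=
      (hC.exists_mem_antichain (fun x hx => (hB₁ x hx).1) hB₂ hB₃).2 C hCC
    refine (hB₁ z hzB).2 (List.mem_cons_of_mem _ (List.mem_filter.2 ⟨hz, ?_⟩))
    exact hX₃ C hCC z hz ⟨B, fun x hx => (hB₁ x hx).1, hB₂, hB₃, hzB⟩
  · refine ⟨[a], List.mem_cons_self, hasAntichain_mono hle (fun x hx => ?_)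
      (Bool.eq_false_iff.2 hR)⟩
    exact (hfilter [a] (by simp) x hx).1

theorem isChainCover_chainCover (hle : IsPartialOrder α fun a b => le a b = true) {k : ℕ}
    {L : List α} (hasc : Ascending le L) (hw : hasAntichain le (k + 1) L = false) :
    IsChainCover le k L (chainCover le k L) := by
  induction k generalizing L with
  | zero =>
    have hL : L = [] := by
      cases L with
      | nil => rfl
      | cons a L => simp [hasAntichain] at hw
    subst hL
    constructor <;> simp [chainCover]
  | succ k ih =>
    suffices h : ∀ M R Cs, R ++ M = L → IsChainCover le (k + 1) R Cs →
        IsChainCover le (k + 1) L (M.foldl (coverStep le k (chainCover le k)) (R, Cs)).2 by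
      exact h L [] [] rfl (by constructor <;> simp)
    intro M
    induction M with
    | nil =>
      intro R Cs hR hC
      rw [List.append_nil] at hR
      exact hR ▸ hC
    | cons a M ihM =>
      intro R Cs hR hC
      have hR' : (R ++ [a]) ++ M = L := by simpa using hR
      have hasc' : Ascending le (R ++ [a]) :=
        hasc.sublist (hR' ▸ List.sublist_append_left _ _)
      have hw' : hasAntichain le (k + 2) (R ++ [a]) = false :=
        hasAntichain_mono hle (fun x hx => hR' ▸ List.mem_append_left _ hx) hw
      obtain ⟨K₀, hK₀, hgood⟩ := exists_good_candidate hle hasc' hw' hC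
      cases hf : (chainCandidates le Cs a).filter (fun K => !hasAntichain le (k + 1)
          (without (R ++ [a]) K)) with
      | nil =>
        have : K₀ ∈ (chainCandidates le Cs a).filter (fun K => !hasAntichain le (k + 1)
          (without (R ++ [a]) K)) :=
          List.mem_filter.2 ⟨hK₀, by rw [hgood]; rfl⟩
        rw [hf] at this
        exact absurd this (by simp)
      | cons K Ks =>
        have hK : K ∈ (chainCandidates le Cs a).filter (fun K => !hasAntichain le (k + 1)
          (without (R ++ [a]) K)) := hf ▸ List.mem_cons_self
        obtain ⟨hKc, hKg⟩ := List.mem_filter.1 hK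
        rw [Bool.not_eq_true'] at hKg
        have hI := ih (hasc'.sublist List.filter_sublist) hKg
        have hKsub : (∀ x ∈ K, x ∈ R ++ [a]) ∧
            ∀ x ∈ K, ∀ y ∈ K, le x y = true ∨ le y x = true := by
          rcases List.mem_cons.1 hKc with rfl | hKc
          · refine ⟨by simp, fun x hx y hy => ?_⟩
            rw [List.mem_singleton.1 hx, List.mem_singleton.1 hy]
            exact Or.inl (hle.refl a)
          · obtain ⟨C, hCC, hKC⟩ := List.mem_flatMap.1 hKc
            obtain ⟨x₀, hx₀, rfl⟩ := List.mem_map.1 hKC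
            obtain ⟨hx₀C, hx₀a⟩ := List.mem_filter.1 hx₀
            have hlow : ∀ z ∈ C.filter (fun z => le z x₀), z ∈ C ∧ le z a = true := fun z hz =>
              ⟨(List.mem_filter.1 hz).1, hle.trans _ _ _ (List.mem_filter.1 hz).2 hx₀a⟩
            refine ⟨fun x hx => ?_, fun x hx y hy => ?_⟩
            · rcases List.mem_cons.1 hx with rfl | hx
              · simp
              · exact List.mem_append_left _ (hC.mem_of_mem C hCC x (hlow x hx).1)
            · rcases List.mem_cons.1 hx with hxa | hx <;> rcases List.mem_cons.1 hy with hya | hy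
              · rw [hxa, hya]; exact Or.inl (hle.refl _)
              · rw [hxa]; exact Or.inr (hlow _ hy).2
              · rw [hya]; exact Or.inl (hlow _ hx).2
              · exact hC.total C hCC x (hlow x hx).1 y (hlow y hy).1
        have hrest : ∀ C ∈ chainCover le k (without (R ++ [a]) K), ∀ x ∈ C,
            x ∈ R ++ [a] ∧ x ∉ K := fun C hCC x hx => by
          have := List.mem_filter.1 (hI.mem_of_mem C hCC x hx)
          exact ⟨this.1, by simpa using this.2⟩
        have hstep : coverStep le k (chainCover le k) (R, Cs) a =
            (R ++ [a], K :: chainCover le k (without (R ++ [a]) K)) := by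
          simp only [coverStep]
          rw [hf]
        rw [List.foldl_cons, hstep]
        refine ihM (R ++ [a]) _ hR' ?_
        refine ⟨Nat.succ_le_succ hI.length_le, fun x hx => ?_, fun C hCC x hx => ?_,
          fun C hCC => ?_, fun C hCC D hD x hx hx' => ?_⟩
        · by_cases hxK : x ∈ K
          · exact ⟨K, List.mem_cons_self, hxK⟩
          · obtain ⟨C, hCC, hxC⟩ := hI.exists_mem x (List.mem_filter.2 ⟨hx, by simpa using hxK⟩)
            exact ⟨C, List.mem_cons_of_mem _ hCC, hxC⟩
        · rcases List.mem_cons.1 hCC with rfl | hCC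
          · exact hKsub.1 x hx
          · exact (hrest C hCC x hx).1
        · rcases List.mem_cons.1 hCC with rfl | hCC
          · exact hKsub.2
          · exact hI.total C hCC
        · rcases List.mem_cons.1 hCC with rfl | hCC <;> rcases List.mem_cons.1 hD with rfl | hD
          · rfl
          · exact absurd hx (hrest D hD x hx').2
          · exact absurd hx' (hrest C hCC x hx).2
          · exact hI.disjoint C hCC D hD x hx hx'

end

/-! ### The steps of the algorithm -/

/-- The function `f` is computed by a program in polynomial time; this is the case of a constant
parameter. -/
abbrev PolyTime {α β : Type} [Enc α] [Enc β] (f : α → β) : Prop := FPT (fun _ => 0) f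

/-- A row of the matrix of an order relation. -/
abbrev Row : Type := List Bool

/-- Comparison of two elements of a poset that are given by their rows, that is, by their sets of
upper bounds: an element is at most another one iff it has all upper bounds of the other one. -/
def rowLE (r s : Row) : Bool :=
  let p := s.foldl (fun (p : Bool × Row) b => match p.2 with
    | [] => (false, [])
    | a :: r => (p.1 && (!b || a), r)) (true, r)
  p.1 && decide (p.2 = [])

theorem rowLE_iff {r s : Row} :
    rowLE r s = true ↔ List.Forall₂ (fun a b : Bool => b = true → a = true) r s := by
  have h : ∀ (s r : Row) (c : Bool), ((s.foldl (fun (p : Bool × Row) b => match p.2 with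
      | [] => (false, [])
      | a :: r => (p.1 && (!b || a), r)) (c, r)).1 = true ∧ (s.foldl (fun (p : Bool × Row) b =>
      match p.2 with
      | [] => (false, [])
      | a :: r => (p.1 && (!b || a), r)) (c, r)).2 = []) ↔
      c = true ∧ List.Forall₂ (fun a b : Bool => b = true → a = true) r s := by
    intro s
    induction s with
    | nil => intro r c; simp
    | cons b s ih =>
      intro r c
      cases r with
      | nil =>
        rw [List.foldl_cons, ih]
        simp
      | cons a r =>
        rw [List.foldl_cons, ih]
        cases b <;> simp [and_assoc]
  simp only [rowLE, Bool.and_eq_true, decide_eq_true_eq, h s r true, true_and]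

theorem rowLE_isPartialOrder : IsPartialOrder Row fun r s => rowLE r s = true where
  refl r := rowLE_iff.2 (List.forall₂_same.2 fun _ _ h => h)
  trans r s t h h' := by
    rw [rowLE_iff] at *
    induction h generalizing t with
    | nil => exact h'
    | cons h₁ _ ih =>
      cases h' with
      | cons h₂ h' => exact .cons (fun h => h₁ (h₂ h)) (ih _ h')
  antisymm r s h h' := by
    rw [rowLE_iff] at *
    induction h with
    | nil => rfl
    | cons h₁ _ ih =>
      cases h' with
      | cons h₂ h' => rw [ih h', Bool.eq_iff_iff.2 ⟨h₂, h₁⟩]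

/-- Two elements lie in a common chain of a cover. -/
def sameChain (Cs : List (List Row)) (x y : Row) : Bool :=
  Cs.any fun K => decide (x ∈ K) && decide (y ∈ K)

/-- A list of pairs of pairs of elements, standing for the relation that two pairs of elements have
the same color. -/
abbrev PairRel : Type := List ((Row × Row) × (Row × Row))

/-- Pairs of elements with the same color of rank `0`, for the labels given by a cover. -/
def initialRel (Cs : List (List Row)) (U : List Row) : PairRel :=
  let pairs := U.flatMap fun x => U.map fun y => (x, y)
  (pairs.flatMap fun p => pairs.map fun q => (p, q)).filter fun e =>
    (sameChain Cs e.1.1 e.2.1 && sameChain Cs e.1.2 e.2.2) &&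
      (decide (rowLE e.1.1 e.1.2 = rowLE e.2.1 e.2.2) &&
        decide (rowLE e.1.2 e.1.1 = rowLE e.2.2 e.2.1))

/-- The passage from colors of rank `q` to colors of rank `q + 1`. -/
def refineRel (U : List Row) (E : PairRel) : PairRel :=
  E.filter fun e =>
    (U.all fun z => U.any fun z' =>
      decide (((e.1.1, z), (e.2.1, z')) ∈ E) && decide (((z, e.1.2), (z', e.2.2)) ∈ E)) &&
    (U.all fun z' => U.any fun z =>
      decide (((e.1.1, z), (e.2.1, z')) ∈ E) && decide (((z, e.1.2), (z', e.2.2)) ∈ E))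

/-- Two elements form pairs of the same colors with all entries of a tuple and with themselves. -/
def sameType (E : PairRel) (t : List Row) (y y' : Row) : Bool :=
  decide (((y, y), (y', y')) ∈ E) && t.all fun s => decide (((s, y), (s, y')) ∈ E)

/-- Representatives of the types of elements over a tuple. -/
def representatives (E : PairRel) (U : List Row) (t : List Row) : List Row :=
  U.foldl (fun R y => if R.any fun y' => sameType E t y' y then R else y :: R) []

/-- All extensions of the tuples in a list by representatives of the types over them.  The last
entry of a tuple is the head of the list. -/
def extendTuples (E : PairRel) (U : List Row) (T : List (List Row)) : List (List Row) :=
  T.flatMap fun t => (representatives E U t).map fun y => y :: t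

/-- A token of a formula: its kind, the number of free variables of the subformula that it starts,
and, for an atom, its two variables. -/
abbrev Token : Type := MCSymbol × (ℕ × (ℕ × ℕ))

/-- One step of the evaluation of a formula, whose tokens are treated from the last to the first.
The state is a stack of relations, the values of the subformulas read so far, on which the operands
of a token lie on top; the list `Ts` contains for each length the tuples over which formulas are
evaluated. -/
def evalStep (Ts : List (List (List Row))) (st : List (List (List Row))) (tok : Token) :
    List (List (List Row)) :=
  let T := Ts.getD tok.2.1 []
  let T' := Ts.getD (tok.2.1 + 1) []
  if decide (tok.1 = .eq) then
    (T.filter fun t => decide (t.reverse.getD tok.2.2.1 [] = t.reverse.getD tok.2.2.2 [])) :: st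
  else if decide (tok.1 = .le) then
    (T.filter fun t => rowLE (t.reverse.getD tok.2.2.1 []) (t.reverse.getD tok.2.2.2 [])) :: st
  else if decide (tok.1 = .and) then
    (T.filter fun t => decide (t ∈ st.getD 0 []) && decide (t ∈ st.getD 1 [])) :: st.tail.tail
  else if decide (tok.1 = .all) then
    (T.filter fun t => T'.all fun u => !decide (u.tail = t) || decide (u ∈ st.getD 0 [])) :: st.tail
  else
    (T.filter fun t => T'.any fun u => decide (u.tail = t) && decide (u ∈ st.getD 0 [])) :: st.tail

/-- Read the rows of the matrix, from right to left. -/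
def rowsStep (s : MCSymbol) (rows : List Row) : List Row :=
  if decide (s = .row) then [] :: rows
  else if decide (s = .bit true) then
    match rows with
    | [] => []
    | r :: rows => (true :: r) :: rows
  else if decide (s = .bit false) then
    match rows with
    | [] => []
    | r :: rows => (false :: r) :: rows
  else rows

/-- The state of the parser of formulas: the tokens read so far, the last one first; the numbers of
free variables of the subformulas that are still to be read; the kind of the current atom; its
variables read so far; and the part of the current variable read so far. -/
abbrev ParseState : Type := List Token × (List ℕ × (MCSymbol × (List ℕ × ℕ)))

/-- One step of the parser of formulas, which reads from left to right. -/
def parseStep (st : ParseState) (s : MCSymbol) : ParseState :=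
  let n := st.2.1.getD 0 0
  if decide (s = .tick) then (st.1, (st.2.1, (st.2.2.1, (st.2.2.2.1, st.2.2.2.2 + 1))))
  else if decide (s = .sep) then
    match st.2.2.2.1 with
    | [] => (st.1, (st.2.1, (st.2.2.1, ([st.2.2.2.2], 0))))
    | i :: _ => ((st.2.2.1, (n, (i, st.2.2.2.2))) :: st.1, (st.2.1.tail, (st.2.2.1, ([], 0))))
  else if decide (s = .eq) || decide (s = .le) then (st.1, (st.2.1, (s, ([], 0))))
  else if decide (s = .and) then ((s, (n, (0, 0))) :: st.1, (n :: st.2.1, st.2.2))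
  else if decide (s = .all) || decide (s = .ex) then
    ((s, (n, (0, 0))) :: st.1, ((n + 1) :: st.2.1.tail, st.2.2))
  else st

/-! ### Programs for the steps of the algorithm -/

namespace FPT

variable {α β : Type} [Enc α] [Enc β] {κ : α → ℕ}

/-- A function of the first component of a pair. -/
theorem ofFst {γ : Type} [Enc γ] {f : α → γ} (hf : FPT κ f) :
    FPT (fun p : α × β => κ p.1) fun p => f p.1 :=
  hf.comp fst fun _ => rfl

theorem fpt_rowLE {f g : α → Row} (hf : FPT κ f) (hg : FPT κ g) :
    FPT κ fun x => rowLE (f x) (g x) := by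
  have h₁ : PolyTime fun p : (Row × Row) × (Bool × (Bool × Row)) =>
      (match p.2.2.2 with
        | [] => ((false, []) : Bool × Row)
        | a :: r => (p.2.2.1 && (!p.2.1 || a), r)) := by
    refine (listCases (l := fun p : (Row × Row) × (Bool × (Bool × Row)) => p.2.2.2)
      (f := fun _ => ((false, []) : Bool × Row))
      (g := fun p a r => (p.2.2.1 && (!p.2.1 || a), r))
      (snd.comp₀ (snd.comp₀ snd)) (const _) ?_).congr fun p => by
        rcases p with ⟨_, _, _, _ | _⟩ <;> rfl
    exact pair (and (fst.comp₀ (snd.comp₀ (snd.comp₀ fst)))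
      (or (not (fst.comp₀ (snd.comp₀ fst))) (fst.comp₀ snd))) (snd.comp₀ snd)
  have h₂ : PolyTime fun p : Row × Row => p.2.foldl (fun (p : Bool × Row) b => match p.2 with
      | [] => (false, [])
      | a :: r => (p.1 && (!b || a), r)) (true, p.1) := by
    refine foldl_of_growth (g := fun _ (p : Bool × Row) b => match p.2 with
      | [] => (false, [])
      | a :: r => (p.1 && (!b || a), r)) snd ((const true).pair fst) h₁ (Bdd.const 5) ?_
    rintro - ⟨c, _ | ⟨a, r⟩⟩ b -
    · have := one_le_sz c
      have := sz_bool_le false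
      simp only [sz_pair]; omega
    · have := sz_bool_le (c && (!b || a))
      simp only [sz_pair, sz_cons]; omega
  have h₃ : PolyTime fun p : Row × Row => rowLE p.1 p.2 :=
    and (fst.comp₀ h₂) (beq (snd.comp₀ h₂) (const []))
  exact h₃.comp₀ (hf.pair hg)

theorem polyTime_linearize : PolyTime fun L : List Row => linearize rowLE L := by
  have hx : PolyTime fun p : ((List Row × (Row × List Row)) × Row) =>
      rowLE p.1.2.1 p.2 := fpt_rowLE (fst.comp₀ (snd.comp₀ fst)) snd
  refine foldl_of_growth (g := fun _ (S : List Row) a => S.filter (fun x => !rowLE a x) ++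
    a :: S.filter (fun x => rowLE a x)) id (const []) ?_ (Bdd.size.add (Bdd.const 2)) ?_
  · exact append (filter (snd.comp₀ snd) hx.not) (cons (fst.comp₀ snd) (filter (snd.comp₀ snd) hx))
  · intro L S a ha
    have h : ∀ S : List Row, sz (S.filter (fun x => !rowLE a x)) +
        sz (S.filter (fun x => rowLE a x)) = sz S + 1 := by
      intro S
      induction S with
      | nil => simp
      | cons b S ih => cases hb : rowLE a b <;> simp [hb] <;> omega
    have h₁ := h S
    have h₂ := sz_append (S.filter (fun x => !rowLE a x))
      (a :: S.filter (fun x => rowLE a x))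
    have h₃ := sz_le_of_mem ha
    rw [sz_cons] at h₂
    omega

theorem polyTime_hasAntichain (m : ℕ) : PolyTime fun L : List Row => hasAntichain rowLE m L := by
  induction m with
  | zero => exact const true
  | succ m ih =>
    refine any id (ih.comp₀ (filter fst ?_))
    exact and (fpt_rowLE (snd.comp₀ fst) snd).not (fpt_rowLE snd (snd.comp₀ fst)).not

theorem polyTime_chainCandidates :
    PolyTime fun p : List (List Row) × Row => chainCandidates rowLE p.1 p.2 := by
  refine cons (cons snd (const [])) (flatMap fst (map (filter snd ?_) (cons ?_ (filter ?_ ?_))))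
  · exact fpt_rowLE snd (snd.comp₀ (fst.comp₀ fst))
  · exact snd.comp₀ (fst.comp₀ fst)
  · exact snd.comp₀ fst
  · exact fpt_rowLE snd (snd.comp₀ fst)

theorem polyTime_chainCover (k : ℕ) : PolyTime fun L : List Row => chainCover rowLE k L := by
  induction k with
  | zero => exact const []
  | succ k ih =>
    obtain ⟨G, hG, hGL⟩ := Bdd.of_pair (κ := fun _ : List Row => 0)
      (t := fun p : List Row × List Row => sz (chainCover rowLE k p.2))
      (ih.comp₀ snd).size_bdd Bdd.size
    have hstep : PolyTime fun p : List Row × (Row × (List Row × List (List Row))) =>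
        coverStep rowLE k (chainCover rowLE k) p.2.2 p.2.1 := by
      have hR : PolyTime fun p : List Row × (Row × (List Row × List (List Row))) =>
          p.2.2.1 ++ [p.2.1] :=
        append (fst.comp₀ (snd.comp₀ snd)) (cons (fst.comp₀ snd) (const []))
      have hrest : PolyTime fun p : (List Row × (Row × (List Row × List (List Row)))) × List Row =>
          without (p.1.2.2.1 ++ [p.1.2.1]) p.2 :=
        filter hR.ofFst (mem snd (snd.comp₀ fst)).not
      refine pair hR ((listCases (g := fun p K _ => K :: chainCover rowLE k
        (without (p.2.2.1 ++ [p.2.1]) K)) (filter (κ := fun _ => 0) (p := fun p K =>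
          !hasAntichain rowLE (k + 1) (without (p.2.2.1 ++ [p.2.1]) K))
          (polyTime_chainCandidates.comp₀ (pair (snd.comp₀ (snd.comp₀ snd)) (fst.comp₀ snd)))
          ((polyTime_hasAntichain (k + 1)).comp₀ hrest).not)
        (const []) (cons (fst.comp₀ snd) (ih.comp₀ (hrest.comp₀ (pair fst (fst.comp₀ snd)))))).congr
        fun p => ?_)
      dsimp only
      cases (chainCandidates rowLE p.2.2.2 p.2.1).filter fun K =>
        !hasAntichain rowLE (k + 1) (without (p.2.2.1 ++ [p.2.1]) K) <;> rfl
    refine snd.comp₀ (foldl (g := fun _ s a =>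
      coverStep rowLE k (chainCover rowLE k) s a) id (const _) hstep
      (B := fun L => sz L + (1 + sz L * (2 * sz L + G L + 3)) + 1) ((Bdd.size.add
        ((Bdd.const 1).add (Bdd.size.mul ((((Bdd.const 2).mul Bdd.size).add hG).add
          (Bdd.const 3))))).add (Bdd.const 1)) fun L m hm => ?_)
    -- the first component is the prefix, the second one grows by a bounded amount in each step
    have key : ∀ m : List Row, m <+: L →
        (m.foldl (coverStep rowLE k (chainCover rowLE k)) ([], [])).1 = m ∧
        sz (m.foldl (coverStep rowLE k (chainCover rowLE k)) ([], [])).2 ≤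
          1 + m.length * (2 * sz L + G L + 3) := by
      intro m
      induction m using List.reverseRecOn with
      | nil => simp
      | append_singleton m a ihm =>
        intro hm
        obtain ⟨h₁, h₂⟩ := ihm ((List.prefix_append m [a]).trans hm)
        rw [List.foldl_append, List.foldl_cons, List.foldl_nil]
        set s := m.foldl (coverStep rowLE k (chainCover rowLE k)) ([], [])
        refine ⟨by simp [coverStep, h₁], ?_⟩
        rw [List.length_append, List.length_singleton, Nat.add_mul, Nat.one_mul]
        simp only [coverStep, h₁]
        have hrec : ∀ K : List Row, sz (chainCover rowLE k
            (without (m ++ [a]) K)) ≤ G L := fun K =>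
          hGL L _ (sz_sublist (List.filter_sublist.trans hm.sublist))
        have ha : sz a ≤ sz L := sz_le_of_mem (hm.subset (by simp))
        cases hf : (chainCandidates rowLE s.2 a).filter (fun K =>
          !hasAntichain rowLE (k + 1)
            (without (m ++ [a]) K)) with
        | nil => simp only [sz_nil]; omega
        | cons K Ks =>
          have hK : K ∈ chainCandidates rowLE s.2 a :=
            (List.mem_filter.1 (hf ▸ List.mem_cons_self : K ∈ List.filter _ _)).1
          have hKs : sz K ≤ sz a + sz s.2 + 1 := by
            rcases List.mem_cons.1 hK with rfl | hK
            · have := one_le_sz s.2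
              simp; omega
            · obtain ⟨C, hC, hK⟩ := List.mem_flatMap.1 hK
              obtain ⟨x, -, rfl⟩ := List.mem_map.1 hK
              have h₃ := sz_le_of_mem hC
              have h₄ : sz (C.filter fun z => rowLE z x) ≤ sz C :=
                sz_sublist List.filter_sublist
              rw [sz_cons]
              omega
          have := hrec K
          simp only [sz_cons]
          omega
    obtain ⟨h₁, h₂⟩ := key m hm
    have h₃ : sz m ≤ sz L := sz_sublist hm.sublist
    have h₄ := Nat.mul_le_mul_right (2 * sz L + G L + 3) ((length_le_sz m).trans h₃)
    generalize m.foldl (coverStep rowLE k (chainCover rowLE k))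
      ([], []) = s at h₁ h₂ ⊢
    obtain ⟨R, Cs⟩ := s
    dsimp only at h₁ h₂
    subst h₁
    rw [sz_pair]
    omega

theorem fpt_sameChain {f : α → List (List Row)} {g h : α → Row} (hf : FPT κ f)
    (hg : FPT κ g) (hh : FPT κ h) : FPT κ fun x => sameChain (f x) (g x) (h x) :=
  any hf (and (mem (hg.comp fst fun _ => rfl) snd) (mem (hh.comp fst fun _ => rfl) snd))

theorem polyTime_initialRel :
    PolyTime fun p : List (List Row) × List Row => initialRel p.1 p.2 := by
  have hpairs : PolyTime fun p : List (List Row) × List Row =>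
      p.2.flatMap fun x => p.2.map fun y => (x, y) :=
    flatMap snd (map (snd.comp₀ fst) (pair (snd.comp₀ fst) snd))
  refine filter (flatMap hpairs (map (hpairs.comp₀ fst) (pair (snd.comp₀ fst) snd))) ?_
  have h₁₁ : PolyTime fun p : (List (List Row) × List Row) × ((Row × Row) × (Row × Row)) =>
    p.2.1.1 := fst.comp₀ (fst.comp₀ snd)
  have h₁₂ : PolyTime fun p : (List (List Row) × List Row) × ((Row × Row) × (Row × Row)) =>
    p.2.1.2 := snd.comp₀ (fst.comp₀ snd)
  have h₂₁ : PolyTime fun p : (List (List Row) × List Row) × ((Row × Row) × (Row × Row)) =>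
    p.2.2.1 := fst.comp₀ (snd.comp₀ snd)
  have h₂₂ : PolyTime fun p : (List (List Row) × List Row) × ((Row × Row) × (Row × Row)) =>
    p.2.2.2 := snd.comp₀ (snd.comp₀ snd)
  exact and (and (fpt_sameChain (fst.comp₀ fst) h₁₁ h₂₁)
    (fpt_sameChain (fst.comp₀ fst) h₁₂ h₂₂))
    (and (beq (fpt_rowLE h₁₁ h₁₂) (fpt_rowLE h₂₁ h₂₂))
      (beq (fpt_rowLE h₁₂ h₁₁) (fpt_rowLE h₂₂ h₂₁)))

theorem polyTime_refineRel : PolyTime fun p : List Row × PairRel => refineRel p.1 p.2 := by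
  -- the arguments are the pair `(U, E)`, an element `e` of `E`, and two elements of `U`
  have h : PolyTime fun p : (((List Row × PairRel) × ((Row × Row) × (Row × Row))) × Row) × Row =>
      decide (((p.1.1.2.1.1, p.1.2), (p.1.1.2.2.1, p.2)) ∈ p.1.1.1.2) &&
        decide (((p.1.2, p.1.1.2.1.2), (p.2, p.1.1.2.2.2)) ∈ p.1.1.1.2) := by
    have he : PolyTime fun p : (((List Row × PairRel) × ((Row × Row) × (Row × Row))) × Row) × Row =>
      p.1.1.2 := snd.comp₀ (fst.comp₀ fst)
    have hz : PolyTime fun p : (((List Row × PairRel) × ((Row × Row) × (Row × Row))) × Row) × Row =>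
      p.1.2 := snd.comp₀ fst
    have hE : PolyTime fun p : (((List Row × PairRel) × ((Row × Row) × (Row × Row))) × Row) × Row =>
      p.1.1.1.2 := snd.comp₀ (fst.comp₀ (fst.comp₀ fst))
    exact and (mem (pair (pair (fst.comp₀ (fst.comp₀ he)) hz)
      (pair (fst.comp₀ (snd.comp₀ he)) snd)) hE) (mem (pair (pair hz (snd.comp₀ (fst.comp₀ he)))
      (pair snd (snd.comp₀ (snd.comp₀ he)))) hE)
  have hU₁ : PolyTime fun p : (List Row × PairRel) × ((Row × Row) × (Row × Row)) => p.1.1 :=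
    fst.comp₀ fst
  have hU₂ : PolyTime fun p : ((List Row × PairRel) × ((Row × Row) × (Row × Row))) × Row =>
    p.1.1.1 := hU₁.comp₀ fst
  exact filter snd (and (all hU₁ (any hU₂ h))
    (all hU₁ (any hU₂ (h.comp₀ (pair (pair (fst.comp₀ fst) snd) (snd.comp₀ fst))))))

theorem polyTime_representatives :
    PolyTime fun p : (PairRel × List Row) × List Row => representatives p.1.1 p.1.2 p.2 := by
  -- the arguments are `((E, U), t)`, the pair of `y` and the list of representatives, and `y'`
  have h : PolyTime fun p : (((PairRel × List Row) × List Row) × (Row × List Row)) × Row =>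
      sameType p.1.1.1.1 p.1.1.2 p.2 p.1.2.1 := by
    have hy : PolyTime fun p : (((PairRel × List Row) × List Row) × (Row × List Row)) × Row =>
      p.1.2.1 := fst.comp₀ (snd.comp₀ fst)
    have hE : PolyTime fun p : (((PairRel × List Row) × List Row) × (Row × List Row)) × Row =>
      p.1.1.1.1 := fst.comp₀ (fst.comp₀ (fst.comp₀ fst))
    exact and (mem (pair (pair snd snd) (pair hy hy)) hE) (all (snd.comp₀ (fst.comp₀ fst))
      (mem (pair (pair snd (snd.comp₀ fst)) (pair snd (hy.comp₀ fst))) (hE.comp₀ fst)))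
  refine foldl_of_growth (κ := fun _ => 0) (g := fun p R y =>
    if R.any fun y' => sameType p.1.1 p.2 y' y then R else y :: R) (snd.comp₀ fst) (const [])
    (cond (any (snd.comp₀ snd) h) (snd.comp₀ snd) (cons (fst.comp₀ snd) (snd.comp₀ snd)))
    (Bdd.size.add (Bdd.const 1)) fun p R y hy => ?_
  have h₁ := sz_le_of_mem hy
  obtain ⟨⟨E, U⟩, t⟩ := p
  simp only [sz_pair] at h₁ ⊢
  split
  · omega
  · rw [sz_cons]; omega

theorem polyTime_extendTuples : PolyTime fun p : (PairRel × List Row) × List (List Row) =>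
    extendTuples p.1.1 p.1.2 p.2 :=
  flatMap snd (map (polyTime_representatives.comp₀ (pair (fst.comp₀ fst) snd))
    (cons snd (snd.comp₀ fst)))

theorem polyTime_foldl_evalStep : PolyTime fun p : List (List (List Row)) × List Token =>
    p.2.foldl (evalStep p.1) [] := by
  refine foldl_of_growth (g := fun p st tok => evalStep p.1 st tok) snd (const []) ?_
    (Bdd.size.add (Bdd.const 2)) ?_
  · have htok : PolyTime fun p : (List (List (List Row)) × List Token) ×
      (Token × List (List (List Row))) => p.2.1 := fst.comp₀ snd
    have hst : PolyTime fun p : (List (List (List Row)) × List Token) ×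
      (Token × List (List (List Row))) => p.2.2 := snd.comp₀ snd
    have hn := fst.comp₀ (snd.comp₀ htok)
    have hT := getD (fst.comp₀ fst) hn (const []) (α := (List (List (List Row)) × List Token) ×
      (Token × List (List (List Row))))
    have hT' := getD (fst.comp₀ fst) (succ hn) (const []) (α := (List (List (List Row)) ×
      List Token) × (Token × List (List (List Row))))
    have hs₀ := getD hst (const 0) (const [])
    have hs₁ := getD hst (const 1) (const [])
    have hi := getD (snd (β := (List (List (List Row)) × List Token) ×
      (Token × List (List (List Row)))) (γ := List Row) (κ := fun _ => 0)).reverse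
      (fst.comp₀ (snd.comp₀ (snd.comp₀ (htok.comp₀ fst)))) (const [])
    have hj := getD (snd (β := (List (List (List Row)) × List Token) ×
      (Token × List (List (List Row)))) (γ := List Row) (κ := fun _ => 0)).reverse
      (snd.comp₀ (snd.comp₀ (snd.comp₀ (htok.comp₀ fst)))) (const [])
    refine cond (beq (fst.comp₀ htok) (const _)) (cons (filter hT (beq hi hj)) hst) (cond
      (beq (fst.comp₀ htok) (const _)) (cons (filter hT (fpt_rowLE hi hj)) hst) (cond
      (beq (fst.comp₀ htok) (const _)) (cons (filter hT (and (mem snd (hs₀.comp₀ fst))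
        (mem snd (hs₁.comp₀ fst)))) hst.tail.tail) (cond (beq (fst.comp₀ htok) (const _))
      (cons (filter hT (all (hT'.comp₀ fst) (or (not (beq (tail snd) (snd.comp₀ fst)))
        (mem snd (hs₀.comp₀ (fst.comp₀ fst)))))) hst.tail)
      (cons (filter hT (any (hT'.comp₀ fst) (and (beq (tail snd) (snd.comp₀ fst))
        (mem snd (hs₀.comp₀ (fst.comp₀ fst)))))) hst.tail))))
  · rintro ⟨Ts, toks⟩ st tok -
    have hT : sz (Ts.getD tok.2.1 []) ≤ sz Ts + 1 := by
      rw [List.getD_eq_getElem?_getD]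
      cases h : Ts[tok.2.1]? with
      | none => simp
      | some T => exact (sz_le_of_mem (List.mem_of_getElem? h)).trans (Nat.le_succ _)
    have hf : ∀ q, sz ((Ts.getD tok.2.1 []).filter q) ≤ sz Ts + 1 := fun q =>
      (sz_sublist List.filter_sublist).trans hT
    have ht : ∀ st : List (List (List Row)), sz st.tail ≤ sz st := fun st =>
      sz_sublist (List.tail_sublist _)
    have ht₁ := ht st
    have ht₂ := ht st.tail
    have hsz : sz (Ts, toks) = sz Ts + sz toks + 1 := sz_pair _ _
    simp only [evalStep, hsz]
    split_ifs
    all_goals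
      rw [sz_cons]
      refine (Nat.add_le_add_right (Nat.add_le_add_right (hf _) _) _).trans ?_
      omega

theorem polyTime_foldr_rowsStep : PolyTime fun l : List MCSymbol => l.foldr rowsStep [] := by
  refine foldr_of_growth (g := fun _ s rows => rowsStep s rows) id (const []) ?_ (Bdd.const 4) ?_
  · have h (b : Bool) := listCases (κ := fun _ => 0)
      (l := fun p : List MCSymbol × (MCSymbol × List Row) => p.2.2) (f := fun _ => [])
      (g := fun _ r rows => (b :: r) :: rows) (snd.comp₀ snd) (const [])
      (cons (cons (const b) (fst.comp₀ snd)) (snd.comp₀ snd))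
    refine (cond (beq (fst.comp₀ snd) (const MCSymbol.row)) (cons (const []) (snd.comp₀ snd)) (cond
      (beq (fst.comp₀ snd) (const (MCSymbol.bit true))) (h true) (cond
      (beq (fst.comp₀ snd) (const (MCSymbol.bit false))) (h false) (snd.comp₀ snd)))).congr ?_
    rintro ⟨_, s, _ | ⟨r, rows⟩⟩ <;> simp [rowsStep]
  · intro l rows s _
    have ht := sz_bool_le true
    have hf := sz_bool_le false
    simp only [rowsStep]
    split_ifs
    · simp; omega
    · cases rows <;> simp; omega
    · cases rows <;> simp; omega
    · omega

/-- A parser state whose numbers are at most `k` and whose size is at most `c`. -/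
structure BoundedState (k c : ℕ) (st : ParseState) : Prop where
  level : ∀ n ∈ st.2.1, n ≤ k
  var : ∀ i ∈ st.2.2.2.1, i ≤ k
  cur : st.2.2.2.2 ≤ k
  size : sz st ≤ c

/-- One step of the parser appends at most one token, whose numbers are at most `k`, and at most one
number to the stack; the constants are generous. -/
theorem BoundedState.step {k c : ℕ} {st : ParseState} (h : BoundedState k c st) (s : MCSymbol) :
    BoundedState (k + 1) (c + (6 * k + 60)) (parseStep st s) := by
  obtain ⟨toks, lv, kind, vars, cur⟩ := st
  obtain ⟨h₁, h₂, h₃, h₄⟩ := h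
  dsimp only at h₁ h₂ h₃
  simp only [sz_pair, sz_nat] at h₄
  have hs := sz_symbol_le s
  have hkind := sz_symbol_le kind
  have hk := one_le_sz kind
  have hn : lv.getD 0 0 ≤ k := by
    cases lv with
    | nil => simp
    | cons n lv => simpa using h₁ n
  have ht : ∀ n ∈ lv.tail, n ≤ k := fun n hn => h₁ n (List.mem_of_mem_tail hn)
  have htsz : sz lv.tail ≤ sz lv := sz_sublist (List.tail_sublist _)
  have h₁' : ∀ n ∈ lv, n ≤ k + 1 := fun n hn => (h₁ n hn).trans (Nat.le_succ k)
  have h₂' : ∀ n ∈ vars, n ≤ k + 1 := fun n hn => (h₂ n hn).trans (Nat.le_succ k)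
  have ht' : ∀ n ∈ lv.tail, n ≤ k + 1 := fun n hn => (ht n hn).trans (Nat.le_succ k)
  have hv := one_le_sz vars
  simp only [parseStep]
  generalize lv.getD 0 0 = n at hn
  split_ifs
  · exact ⟨h₁', h₂', by dsimp only; omega, by simp only [sz_pair, sz_nat]; omega⟩
  · cases vars with
    | nil =>
      refine ⟨h₁', by simp; omega, by simp, ?_⟩
      simp only [sz_pair, sz_cons, sz_nat, sz_nil]; omega
    | cons i vars =>
      have := h₂ i (by simp)
      refine ⟨ht', by simp, by simp, ?_⟩
      simp only [sz_pair, sz_cons, sz_nat, sz_nil] at h₄ ⊢; omega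
  · exact ⟨h₁', by simp, by simp, by simp only [sz_pair, sz_nat, sz_nil]; omega⟩
  · refine ⟨?_, h₂', by dsimp only; omega, ?_⟩
    · intro m hm
      rcases List.mem_cons.1 hm with rfl | hm
      · omega
      · exact h₁' m hm
    · simp only [sz_pair, sz_cons, sz_nat]; omega
  · refine ⟨?_, h₂', by dsimp only; omega, ?_⟩
    · intro m hm
      rcases List.mem_cons.1 hm with rfl | hm
      · omega
      · exact ht' m hm
    · simp only [sz_pair, sz_cons, sz_nat]; omega
  · exact ⟨h₁', h₂', by dsimp only; omega, by simp only [sz_pair, sz_nat]; omega⟩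

theorem polyTime_parseStep : PolyTime fun p : ParseState × MCSymbol => parseStep p.1 p.2 := by
  have h₁ : PolyTime fun p : ParseState × MCSymbol => p.1.1 := fst.comp₀ fst
  have hlv : PolyTime fun p : ParseState × MCSymbol => p.1.2.1 := fst.comp₀ (snd.comp₀ fst)
  have h₂ : PolyTime fun p : ParseState × MCSymbol => p.1.2.2 := snd.comp₀ (snd.comp₀ fst)
  have hkind := fst.comp₀ h₂
  have hvars := fst.comp₀ (snd.comp₀ h₂)
  have hcur := snd.comp₀ (snd.comp₀ h₂)
  have hn := getD hlv (const 0) (const 0)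
  have hnil : PolyTime fun p : ParseState × MCSymbol =>
      ((p.1.1, (p.1.2.1, (p.1.2.2.1, ([p.1.2.2.2.2], 0)))) : ParseState) :=
    pair h₁ (pair hlv (pair hkind (pair (cons hcur (const [])) (const 0))))
  have hcons : PolyTime fun p : (ParseState × MCSymbol) × (ℕ × List ℕ) =>
      (((p.1.1.2.2.1, (p.1.1.2.1.getD 0 0, (p.2.1, p.1.1.2.2.2.2))) :: p.1.1.1,
        (p.1.1.2.1.tail, (p.1.1.2.2.1, ([], 0)))) : ParseState) :=
    pair (cons (pair (hkind.comp₀ fst) (pair (hn.comp₀ fst) (pair (fst.comp₀ snd)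
      (hcur.comp₀ fst)))) (h₁.comp₀ fst)) (pair (hlv.tail.comp₀ fst) (pair (hkind.comp₀ fst)
      (const ([], 0))))
  refine (cond (beq snd (const MCSymbol.tick))
    (pair h₁ (pair hlv (pair hkind (pair hvars (succ hcur)))))
    (cond (beq snd (const MCSymbol.sep)) (listCases (g := fun p i _ =>
        ((p.1.2.2.1, (p.1.2.1.getD 0 0, (i, p.1.2.2.2.2))) :: p.1.1,
          (p.1.2.1.tail, (p.1.2.2.1, ([], 0))))) hvars hnil hcons)
    (cond (or (beq snd (const MCSymbol.eq)) (beq snd (const MCSymbol.le)))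
      (pair h₁ (pair hlv (pair snd (const ([], 0)))))
    (cond (beq snd (const MCSymbol.and)) (pair (cons (pair snd (pair hn (const (0, 0)))) h₁)
      (pair (cons hn hlv) h₂))
    (cond (or (beq snd (const MCSymbol.all)) (beq snd (const MCSymbol.ex)))
      (pair (cons (pair snd (pair hn (const (0, 0)))) h₁) (pair (cons (succ hn) hlv.tail) h₂))
      fst))))).congr ?_
  rintro ⟨⟨toks, lv, kind, _ | ⟨i, vars⟩, cur⟩, s⟩ <;> rfl

theorem polyTime_foldl_parseStep : PolyTime fun l : List MCSymbol =>
    l.foldl parseStep ([], ([0], (.eq, ([], 0)))) := by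
  refine foldl (g := fun _ st s => parseStep st s) id (const _)
    (polyTime_parseStep.comp₀ (pair (snd.comp₀ snd) (fst.comp₀ snd)))
    (B := fun l => 60 + sz l * (6 * sz l + 60)) ((Bdd.const 60).add (Bdd.size.mul
      (((Bdd.const 6).mul Bdd.size).add (Bdd.const 60)))) fun l m hm => ?_
  have key : ∀ m : List MCSymbol, m.length ≤ sz l →
      BoundedState m.length (60 + m.length * (6 * sz l + 60))
        (m.foldl parseStep ([], ([0], (.eq, ([], 0))))) := by
    intro m
    induction m using List.reverseRecOn with
    | nil =>
      intro _
      refine ⟨by simp, by simp, by simp, ?_⟩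
      have := sz_symbol_le .eq
      simp only [List.foldl_nil, sz_pair, sz_cons, sz_nil, sz_nat]
      omega
    | append_singleton m s ih =>
      intro h
      rw [List.length_append, List.length_singleton] at h ⊢
      have hb := (ih (by omega)).step s
      rw [List.foldl_append, List.foldl_cons, List.foldl_nil]
      refine ⟨hb.level, hb.var, hb.cur, hb.size.trans ?_⟩
      rw [Nat.add_mul]
      omega
  have hlen : m.length ≤ sz l := hm.length_le.trans (length_le_sz l)
  exact (key m hlen).size.trans (Nat.add_le_add_left (Nat.mul_le_mul_right _ hlen) _)

end FPT

/-! ### Reading the instance -/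

/-- The symbols of the formula of an instance. -/
def formulaSymbols (l : List MCSymbol) : List MCSymbol :=
  l.filter fun s => !((decide (s = .bit true) || decide (s = .bit false)) || decide (s = .row))

/-- The elements of the poset of an instance, sorted into a linear extension of the order. -/
def elements (l : List MCSymbol) : List Row := linearize rowLE (l.foldr rowsStep [])

/-- The tokens of the formula of an instance, the last one first. -/
def formulaTokens (l : List MCSymbol) : List Token :=
  ((formulaSymbols l).foldl parseStep ([], ([0], (.eq, ([], 0))))).1

/-- The tokens of a formula. -/
def CPFormula.tokens : {n : ℕ} → CPFormula n → List Token
  | n, .eq i j => [(.eq, (n, (i, j)))]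
  | n, .le i j => [(.le, (n, (i, j)))]
  | n, .and φ ψ => (.and, (n, (0, 0))) :: (φ.tokens ++ ψ.tokens)
  | n, .all φ => (.all, (n, (0, 0))) :: φ.tokens
  | n, .ex φ => (.ex, (n, (0, 0))) :: φ.tokens

theorem foldl_parseStep_encodeVar (i : ℕ) (out : List Token) (lv : List ℕ) (k : MCSymbol)
    (vars : List ℕ) (cur : ℕ) : (encodeVar i).foldl parseStep (out, (lv, (k, (vars, cur)))) =
      parseStep (out, (lv, (k, (vars, cur + i)))) .sep := by
  induction i generalizing cur with
  | zero => rfl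
  | succ i ih =>
    have h : encodeVar (i + 1) = .tick :: encodeVar i := rfl
    have h' : parseStep (out, (lv, (k, (vars, cur)))) .tick = (out, (lv, (k, (vars, cur + 1)))) :=
      rfl
    rw [h, List.foldl_cons, h', ih, Nat.add_right_comm, Nat.add_assoc]

/-- The parser reads a formula off the input, appends its tokens to the output and removes the
number of its free variables from the stack of subformulas to be read. -/
theorem foldl_parseStep_encode {n : ℕ} (φ : CPFormula n) (out : List Token) (lv : List ℕ)
    (c : MCSymbol × (List ℕ × ℕ)) : ∃ c', φ.encode.foldl parseStep (out, (n :: lv, c)) =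
      (φ.tokens.reverse ++ out, (lv, c')) := by
  induction φ generalizing out lv c with
  | @eq n i j =>
    have h : parseStep (out, (n :: lv, c)) .eq = (out, (n :: lv, (.eq, ([], 0)))) := rfl
    refine ⟨(.eq, ([], 0)), ?_⟩
    rw [CPFormula.encode, List.foldl_cons, List.foldl_append, h,
      foldl_parseStep_encodeVar i out (n :: lv) .eq [] 0]
    have h' : parseStep (out, (n :: lv, (.eq, ([], 0 + i.1)))) .sep =
      (out, (n :: lv, (.eq, ([0 + i.1], 0)))) := rfl
    rw [h', foldl_parseStep_encodeVar]
    simp [parseStep, CPFormula.tokens]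
  | @le n i j =>
    have h : parseStep (out, (n :: lv, c)) .le = (out, (n :: lv, (.le, ([], 0)))) := rfl
    refine ⟨(.le, ([], 0)), ?_⟩
    rw [CPFormula.encode, List.foldl_cons, List.foldl_append, h,
      foldl_parseStep_encodeVar i out (n :: lv) .le [] 0]
    have h' : parseStep (out, (n :: lv, (.le, ([], 0 + i.1)))) .sep =
      (out, (n :: lv, (.le, ([0 + i.1], 0)))) := rfl
    rw [h', foldl_parseStep_encodeVar]
    simp [parseStep, CPFormula.tokens]
  | @and n φ ψ ih₁ ih₂ =>
    have h : parseStep (out, (n :: lv, c)) .and =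
      ((.and, (n, (0, 0))) :: out, (n :: n :: lv, c)) := rfl
    obtain ⟨c₁, h₁⟩ := ih₁ ((.and, (n, (0, 0))) :: out) (n :: lv) c
    obtain ⟨c₂, h₂⟩ := ih₂ (φ.tokens.reverse ++ (.and, (n, (0, 0))) :: out) lv c₁
    refine ⟨c₂, ?_⟩
    rw [CPFormula.encode, List.foldl_cons, List.foldl_append, h, h₁, h₂]
    simp [CPFormula.tokens]
  | @all n φ ih =>
    have h : parseStep (out, (n :: lv, c)) .all =
      ((.all, (n, (0, 0))) :: out, ((n + 1) :: lv, c)) := rfl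
    obtain ⟨c₁, h₁⟩ := ih ((.all, (n, (0, 0))) :: out) lv c
    refine ⟨c₁, ?_⟩
    rw [CPFormula.encode, List.foldl_cons, h, h₁]
    simp [CPFormula.tokens]
  | @ex n φ ih =>
    have h : parseStep (out, (n :: lv, c)) .ex =
      ((.ex, (n, (0, 0))) :: out, ((n + 1) :: lv, c)) := rfl
    obtain ⟨c₁, h₁⟩ := ih ((.ex, (n, (0, 0))) :: out) lv c
    refine ⟨c₁, ?_⟩
    rw [CPFormula.encode, List.foldl_cons, h, h₁]
    simp [CPFormula.tokens]

theorem CPFormula.mem_encode {n : ℕ} (φ : CPFormula n) {s : MCSymbol} (hs : s ∈ φ.encode) :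
    s ≠ .row ∧ ∀ b, s ≠ .bit b := by
  induction φ <;> simp only [CPFormula.encode, encodeVar, List.mem_cons, List.mem_append,
    List.mem_replicate, List.not_mem_nil, or_false] at hs <;> aesop

theorem FinPoset.mem_encode (P : FinPoset) {s : MCSymbol} (hs : s ∈ P.encode) :
    s = .row ∨ ∃ b, s = .bit b := by
  simp only [FinPoset.encode, List.mem_flatMap, List.mem_append, List.mem_map,
    List.mem_singleton] at hs
  obtain ⟨i, -, ⟨j, -, rfl⟩ | rfl⟩ := hs
  · exact Or.inr ⟨_, rfl⟩
  · exact Or.inl rfl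

theorem formulaSymbols_encodeInstance (P : FinPoset) (φ : CPSentence) :
    formulaSymbols (encodeInstance P φ) = CPFormula.encode φ := by
  rw [formulaSymbols, encodeInstance, List.filter_append, List.filter_eq_nil_iff.2,
    List.filter_eq_self.2, List.nil_append]
  · intro s hs
    obtain ⟨h₁, h₂⟩ := CPFormula.mem_encode φ hs
    simp [h₁, h₂]
  · intro s hs
    rcases P.mem_encode hs with rfl | ⟨_ | _, rfl⟩ <;> simp

theorem formulaTokens_encodeInstance (P : FinPoset) (φ : CPSentence) :
    formulaTokens (encodeInstance P φ) = (CPFormula.tokens φ).reverse := by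
  obtain ⟨c, h⟩ := foldl_parseStep_encode φ [] [] (.eq, ([], 0))
  rw [formulaTokens, formulaSymbols_encodeInstance, h, List.append_nil]

/-- The list of all elements of a poset. -/
def FinPoset.elems (P : FinPoset) : List P.Carrier := List.finRange P.card

theorem FinPoset.mem_elems {P : FinPoset} (a : P.Carrier) : a ∈ P.elems := List.mem_finRange _

theorem FinPoset.nodup_elems (P : FinPoset) : P.elems.Nodup := List.nodup_finRange _

/-- The matrix of the order relation, with indices of type `P.Carrier`. -/
def FinPoset.leBool (P : FinPoset) (a b : P.Carrier) : Bool := P.rel a b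

/-- The row of an element of a poset in the matrix of the order relation. -/
def FinPoset.row (P : FinPoset) (a : P.Carrier) : Row := P.elems.map (P.leBool a)

theorem foldr_rowsStep_encodeInstance (P : FinPoset) (φ : CPSentence) :
    (encodeInstance P φ).foldr rowsStep [] = P.elems.map P.row := by
  have h₁ : ∀ l : List MCSymbol, (∀ s ∈ l, s ≠ .row ∧ ∀ b, s ≠ .bit b) →
      l.foldr rowsStep [] = [] := by
    intro l
    induction l with
    | nil => exact fun _ => rfl
    | cons s l ih =>
      intro h
      have hs := h s List.mem_cons_self
      rw [List.foldr_cons, ih fun s hs => h s (List.mem_cons_of_mem _ hs)]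
      simp [rowsStep, hs.1, hs.2]
  have h₂ : ∀ (l : List Bool) (r : Row) (rows : List Row),
      (l.map MCSymbol.bit).foldr rowsStep (r :: rows) = (l ++ r) :: rows := by
    intro l r rows
    induction l with
    | nil => rfl
    | cons b l ih =>
      rw [List.map_cons, List.foldr_cons, ih]
      cases b <;> rfl
  rw [encodeInstance, List.foldr_append, h₁ _ fun s hs => CPFormula.mem_encode φ hs,
    FinPoset.encode]
  suffices h : ∀ l : List P.Carrier, (l.flatMap fun a =>
      P.elems.map (MCSymbol.bit ∘ P.leBool a) ++ [MCSymbol.row]).foldr rowsStep [] =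
        l.map P.row from h P.elems
  intro l
  induction l with
  | nil => rfl
  | cons a l ih =>
    have := h₂ (P.row a) [] (l.map P.row)
    rw [FinPoset.row, List.map_map, List.append_nil] at this
    rw [List.flatMap_cons, List.foldr_append, ih, List.foldr_append]
    exact this

theorem FinPoset.rowLE_row (P : FinPoset) (a b : P.Carrier) :
    rowLE (P.row a) (P.row b) = true ↔ a ≤ b := by
  rw [rowLE_iff, FinPoset.row, FinPoset.row, List.forall₂_map_left_iff,
    List.forall₂_map_right_iff, List.forall₂_same]
  exact ⟨fun h => h b (FinPoset.mem_elems b) (P.rel_refl b), fun h c _ hc => P.rel_trans _ _ _ h hc⟩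

theorem FinPoset.row_injective (P : FinPoset) : Function.Injective P.row := fun a b h =>
  le_antisymm ((P.rowLE_row a b).1 (h ▸ rowLE_isPartialOrder.refl _))
    ((P.rowLE_row b a).1 (h ▸ rowLE_isPartialOrder.refl _))

theorem nodup_rows (P : FinPoset) : (P.elems.map P.row).Nodup :=
  P.nodup_elems.map P.row_injective

theorem mem_elements {P : FinPoset} {φ : CPSentence} {x : Row} :
    x ∈ elements (encodeInstance P φ) ↔ ∃ a, P.row a = x := by
  rw [elements, mem_linearize, foldr_rowsStep_encodeInstance, List.mem_map]
  exact ⟨fun ⟨a, _, h⟩ => ⟨a, h⟩, fun ⟨a, h⟩ => ⟨a, FinPoset.mem_elems a, h⟩⟩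

theorem ascending_elements (P : FinPoset) (φ : CPSentence) :
    Ascending rowLE (elements (encodeInstance P φ)) := by
  refine ascending_linearize rowLE_isPartialOrder ?_
  rw [foldr_rowsStep_encodeInstance]
  exact nodup_rows P

theorem hasAntichain_elements {P : FinPoset} {w : ℕ} (hw : P.width ≤ w) (φ : CPSentence) :
    hasAntichain rowLE (w + 1) (elements (encodeInstance P φ)) = false := by
  classical
  by_contra h
  rw [Bool.not_eq_false, hasAntichain_iff rowLE_isPartialOrder] at h
  obtain ⟨A, hA, hc, hanti⟩ := h
  simp only [mem_elements] at hA
  have hmem : ∀ a, a ∈ A.preimage P.row P.row_injective.injOn ↔ P.row a ∈ A := fun a =>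
    Finset.mem_preimage
  have hcard : (A.preimage P.row P.row_injective.injOn).card = w + 1 := by
    rw [Finset.card_preimage, Finset.filter_true_of_mem (p := (· ∈ Set.range P.row))
      (fun x hx => hA x hx), hc]
  have : (A.preimage P.row P.row_injective.injOn).card ≤ P.width := by
    refine Finset.le_sup (f := Finset.card) (Finset.mem_filter.2 ⟨Finset.mem_univ _, ?_⟩)
    intro a ha b hb hab hle
    rw [Finset.mem_coe, hmem] at ha hb
    have h := hanti _ ha _ hb (P.row_injective.ne hab)
    rw [(P.rowLE_row a b).2 hle] at h
    exact Bool.false_ne_true h.symm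
  omega

/-- The labels of the elements given by a cover with chains. -/
theorem exists_labels {P : FinPoset} {w : ℕ} (hw : P.width ≤ w) (φ : CPSentence) :
    ∃ lab : P.Carrier → Fin w, ChainLabels (fun a b : P.Carrier => a ≤ b) lab ∧ ∀ a b,
      sameChain (chainCover rowLE w (elements (encodeInstance P φ))) (P.row a) (P.row b) = true ↔
        lab a = lab b := by
  have hC := isChainCover_chainCover rowLE_isPartialOrder (ascending_elements P φ)
    (hasAntichain_elements hw φ)
  generalize chainCover rowLE w (elements (encodeInstance P φ)) = Cs at hC
  choose C hC₁ hC₂ using fun a : P.Carrier => hC.exists_mem (P.row a) (mem_elements.2 ⟨a, rfl⟩)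
  have hlab : ∀ a b, C a = C b ↔ Cs.idxOf (C a) = Cs.idxOf (C b) := fun a b =>
    (List.idxOf_inj (hC₁ a)).symm
  refine ⟨fun a => ⟨Cs.idxOf (C a), (List.idxOf_lt_length_of_mem (hC₁ a)).trans_le hC.length_le⟩,
    fun a b h => ?_, fun a b => ?_⟩
  · rw [Fin.mk.injEq, ← hlab] at h
    have := hC.total _ (hC₁ a) _ (hC₂ a) (P.row b) (h ▸ hC₂ b)
    rwa [P.rowLE_row, P.rowLE_row] at this
  · rw [Fin.mk.injEq, ← hlab]
    simp only [sameChain, List.any_eq_true, Bool.and_eq_true, decide_eq_true_eq]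
    constructor
    · rintro ⟨K, hK, ha, hb⟩
      rw [hC.disjoint _ (hC₁ a) K hK _ (hC₂ a) ha, hC.disjoint _ (hC₁ b) K hK _ (hC₂ b) hb]
    · exact fun h => ⟨C a, hC₁ a, hC₂ a, h ▸ hC₂ b⟩

theorem CPFormula.depth_le_size {n : ℕ} (φ : CPFormula n) : φ.depth ≤ φ.size := by
  induction φ <;> simp only [CPFormula.depth, CPFormula.size, CPFormula.encode, List.length_cons,
    List.length_append] at * <;> omega

theorem CPFormula.realize_iff {P : FinPoset} {n : ℕ} (φ : CPFormula n) (v : Fin n → P.Carrier) :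
    φ.toBoundedFormula.Realize Empty.elim v ↔ φ.Sat (fun a b : P.Carrier => a ≤ b) v := by
  induction φ with
  | eq i j => simp [CPFormula.toBoundedFormula, CPFormula.Sat]
  | le i j =>
    have : Language.order.OrderedStructure P.Carrier := ⟨fun _ => Iff.rfl⟩
    simp [CPFormula.toBoundedFormula, CPFormula.Sat]
  | and φ ψ ih₁ ih₂ => simp [CPFormula.toBoundedFormula, CPFormula.Sat, ih₁, ih₂]
  | all φ ih => simp [CPFormula.toBoundedFormula, CPFormula.Sat, ih]
  | ex φ ih => simp [CPFormula.toBoundedFormula, CPFormula.Sat, ih]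

theorem FinPoset.models_iff (P : FinPoset) (φ : CPSentence) :
    P.Models φ ↔ CPFormula.Sat (fun a b : P.Carrier => a ≤ b) φ Fin.elim0 := by
  rw [← CPFormula.realize_iff]
  unfold FinPoset.Models Language.Sentence.Realize Language.Formula.Realize CPSentence.toSentence
  rw [iff_iff_eq]
  congr
  exact Subsingleton.elim _ _

/-! ### Correctness of the evaluation -/

/-- The color relation, obtained by as many refinements as there are entries in the list `ticks`. -/
def colorRel (Cs : List (List Row)) (U : List Row) (ticks : List Bool) : PairRel :=
  ticks.foldl (fun E _ => refineRel U E) (initialRel Cs U)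

/-- A list whose length is the rank of the colors for a formula with the given symbols. -/
def rankTicks (fs : List MCSymbol) : List Bool :=
  fs.foldl (fun l _ => false :: false :: (l ++ l)) []

/-- For each `n` up to the length of `fs`, a list of representatives of the tuples of length `n`. -/
def tupleLists (E : PairRel) (U : List Row) (fs : List MCSymbol) : List (List (List Row)) :=
  (fs.foldl (fun acc _ => extendTuples E U (acc.getD 0 []) :: acc) [ [ [] ] ]).reverse

/-- The representatives of the tuples of length `n`. -/
def tupleList (E : PairRel) (U : List Row) : ℕ → List (List Row)
  | 0 => [ [] ]
  | n + 1 => extendTuples E U (tupleList E U n)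

theorem length_rankTicks (fs : List MCSymbol) : (rankTicks fs).length = rankFor fs.length := by
  induction fs using List.reverseRecOn with
  | nil => rfl
  | append_singleton fs s ih =>
    rw [rankTicks, List.foldl_append]
    change (false :: false :: (rankTicks fs ++ rankTicks fs)).length = _
    simp only [List.length_cons, List.length_append, List.length_nil, ih, rankFor]
    omega

theorem foldl_extendTuples (E : PairRel) (U : List Row) (fs : List MCSymbol) :
    fs.foldl (fun acc _ => extendTuples E U (acc.getD 0 []) :: acc) [ [ [] ] ] =
      ((List.range (fs.length + 1)).map (tupleList E U)).reverse := by
  induction fs using List.reverseRecOn with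
  | nil => rfl
  | append_singleton fs s ih =>
    rw [List.foldl_append, ih, List.length_append, List.length_singleton,
      List.range_succ (n := fs.length + 1)]
    simp [List.range_succ, tupleList]

theorem getD_tupleLists {E : PairRel} {U : List Row} {fs : List MCSymbol} {n : ℕ}
    (hn : n ≤ fs.length) : (tupleLists E U fs).getD n [] = tupleList E U n := by
  rw [tupleLists, foldl_extendTuples, List.reverse_reverse, List.getD_eq_getElem?_getD,
    List.getElem?_map, List.getElem?_range (by omega)]
  rfl

section

variable {V : Type} {w : ℕ} {r : V → V → Prop} {lab : V → Fin w} {ρ : V → Row} {U : List Row}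
  {Cs : List (List Row)} {E : PairRel} {q : ℕ}

/-- The list `E` represents the relation that two pairs have the same color of rank `q`; the
elements are represented by rows. -/
def IsColorRel (r : V → V → Prop) (lab : V → Fin w) (ρ : V → Row) (q : ℕ) (E : PairRel) : Prop :=
  ∀ a b a' b', ((ρ a, ρ b), (ρ a', ρ b')) ∈ E ↔ col r lab q a b = col r lab q a' b'

theorem isColorRel_initialRel (hU : ∀ x, x ∈ U ↔ ∃ a, ρ a = x)
    (hr : ∀ a b, rowLE (ρ a) (ρ b) = true ↔ r a b)
    (hCs : ∀ a b, sameChain Cs (ρ a) (ρ b) = true ↔ lab a = lab b) :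
    IsColorRel r lab ρ 0 (initialRel Cs U) := by
  intro a b a' b'
  have hmem : ∀ a, ρ a ∈ U := fun a => (hU _).2 ⟨a, rfl⟩
  simp only [initialRel, List.mem_filter, List.mem_flatMap, List.mem_map, Prod.mk.injEq]
  rw [col_zero_iff, ← hr, ← hr, ← hr, ← hr, ← hCs, ← hCs, ← Bool.eq_iff_iff, ← Bool.eq_iff_iff]
  constructor
  · rintro ⟨-, h⟩
    simpa only [Bool.and_eq_true, decide_eq_true_eq] using h
  · intro h
    refine ⟨⟨(ρ a, ρ b), ⟨_, hmem a, _, hmem b, rfl⟩, (ρ a', ρ b'), ⟨_, hmem a', _, hmem b', rfl⟩,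
      rfl, rfl⟩, ?_⟩
    simpa only [Bool.and_eq_true, decide_eq_true_eq] using h

theorem IsColorRel.refineRel (hU : ∀ x, x ∈ U ↔ ∃ a, ρ a = x) (hE : IsColorRel r lab ρ q E) :
    IsColorRel r lab ρ (q + 1) (refineRel U E) := by
  intro a b a' b'
  simp only [_root_.refineRel, List.mem_filter, col_succ_iff, Bool.and_eq_true, List.all_eq_true,
    List.any_eq_true, decide_eq_true_eq, hU, forall_exists_index, forall_apply_eq_imp_iff,
    exists_exists_eq_and, hE a b a' b', hE _ _ _ _]

theorem isColorRel_colorRel (hU : ∀ x, x ∈ U ↔ ∃ a, ρ a = x)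
    (hr : ∀ a b, rowLE (ρ a) (ρ b) = true ↔ r a b)
    (hCs : ∀ a b, sameChain Cs (ρ a) (ρ b) = true ↔ lab a = lab b) (ticks : List Bool) :
    IsColorRel r lab ρ ticks.length (colorRel Cs U ticks) := by
  induction ticks using List.reverseRecOn with
  | nil => exact isColorRel_initialRel hU hr hCs
  | append_singleton ticks b ih =>
    rw [colorRel, List.foldl_append, List.length_append]
    exact ih.refineRel hU

/-- The list that represents a tuple of elements; the last entry comes first. -/
def tupleRows (ρ : V → Row) {n : ℕ} (v : Fin n → V) : List Row :=
  (List.ofFn fun i => ρ (v i)).reverse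

theorem tupleRows_snoc {n : ℕ} (v : Fin n → V) (y : V) :
    tupleRows ρ (Fin.snoc (α := fun _ : Fin (n + 1) => V) v y) = ρ y :: tupleRows ρ v := by
  rw [tupleRows, List.ofFn_succ']
  simp [tupleRows]

theorem getD_reverse_tupleRows {n : ℕ} (v : Fin n → V) (i : Fin n) :
    (tupleRows ρ v).reverse.getD i [] = ρ (v i) := by
  simp [tupleRows, List.getD_eq_getElem?_getD]

/-- The type of an element over a tuple. -/
def typeOver (r : V → V → Prop) (lab : V → Fin w) (q : ℕ) {n : ℕ} (v : Fin n → V) (y : V) :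
    Color w q × (Fin n → Color w q) :=
  (col r lab q y y, fun i => col r lab q (v i) y)

theorem sameType_iff (hE : IsColorRel r lab ρ q E) {n : ℕ} (v : Fin n → V) (y y' : V) :
    sameType E (tupleRows ρ v) (ρ y) (ρ y') = true ↔
      typeOver r lab q v y = typeOver r lab q v y' := by
  simp only [sameType, tupleRows, Bool.and_eq_true, decide_eq_true_eq, List.all_eq_true,
    List.mem_reverse, List.mem_ofFn', Set.forall_mem_range, hE _ _ _ _, typeOver, Prod.mk.injEq,
    funext_iff]

theorem mem_of_mem_representatives {t : List Row} {y : Row} (hy : y ∈ representatives E U t) :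
    y ∈ U := by
  suffices h : ∀ L R : List Row, y ∈ L.foldl
      (fun R y => if R.any fun y' => sameType E t y' y then R else y :: R) R → y ∈ R ∨ y ∈ L by
    simpa using h U [] hy
  intro L
  induction L with
  | nil => exact fun R h => Or.inl h
  | cons a L ih =>
    intro R h
    have := ih _ h
    dsimp only at this
    split_ifs at this <;> simp only [List.mem_cons] at this ⊢ <;> tauto

theorem exists_mem_representatives {t : List Row} (ht : ∀ y ∈ U, sameType E t y y = true) {y : Row}
    (hy : y ∈ U) : ∃ y' ∈ representatives E U t, sameType E t y' y = true := by
  suffices h : ∀ L R : List Row, (∀ y ∈ L, sameType E t y y = true) →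
      (y ∈ L ∨ ∃ y' ∈ R, sameType E t y' y = true) → ∃ y' ∈ L.foldl
        (fun R y => if R.any fun y' => sameType E t y' y then R else y :: R) R,
        sameType E t y' y = true from h U [] ht (Or.inl hy)
  intro L
  induction L with
  | nil => exact fun R _ h => h.resolve_left List.not_mem_nil
  | cons a L ih =>
    intro R hL h
    refine ih _ (fun y hy => hL y (List.mem_cons_of_mem _ hy)) ?_
    rcases h with h | ⟨y', hy', h⟩
    · rcases List.mem_cons.1 h with rfl | h
      · dsimp only
        split_ifs with hR
        · exact Or.inr (List.any_eq_true.1 hR)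
        · exact Or.inr ⟨y, List.mem_cons_self, hL y List.mem_cons_self⟩
      · exact Or.inl h
    · dsimp only
      split_ifs
      · exact Or.inr ⟨y', hy', h⟩
      · exact Or.inr ⟨y', List.mem_cons_of_mem _ hy', h⟩

theorem pairwise_representatives (E : PairRel) (U t : List Row) :
    (representatives E U t).Pairwise fun y y' => sameType E t y' y = false := by
  suffices h : ∀ L R : List Row, (R.Pairwise fun y y' => sameType E t y' y = false) →
      (L.foldl (fun R y => if R.any fun y' => sameType E t y' y then R else y :: R) R).Pairwise
        fun y y' => sameType E t y' y = false from h U [] List.Pairwise.nil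
  intro L
  induction L with
  | nil => exact fun R h => h
  | cons a L ih =>
    intro R h
    refine ih _ ?_
    dsimp only
    split_ifs with hR
    · exact h
    · exact List.pairwise_cons.2 ⟨by simpa using hR, h⟩

/-- The number of representatives is at most the number of types. -/
theorem length_representatives_le (hU : ∀ x, x ∈ U ↔ ∃ a, ρ a = x)
    (hE : IsColorRel r lab ρ q E) {n : ℕ} (v : Fin n → V) :
    (representatives E U (tupleRows ρ v)).length ≤ colorCount w q ^ (n + 1) := by
  have hR : ∀ x ∈ representatives E U (tupleRows ρ v), ∃ a, ρ a = x := fun x hx =>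
    (hU x).1 (mem_of_mem_representatives hx)
  obtain ⟨L, hL⟩ : ∃ L : List V, L.map ρ = representatives E U (tupleRows ρ v) :=
    Set.mem_range.1 (Set.range_list_map ρ ▸ hR)
  have hp := pairwise_representatives E U (tupleRows ρ v)
  rw [← hL, List.pairwise_map] at hp
  have hnd : (L.map (typeOver r lab q v)).Nodup := by
    refine List.pairwise_map.2 (hp.imp fun {a b} h heq => ?_)
    rw [(sameType_iff hE v b a).2 heq.symm] at h
    exact Bool.false_ne_true h.symm
  have := Fintype.ofFinite (Color w q × (Fin n → Color w q))
  have hlen := hnd.length_le_card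
  rw [List.length_map, ← Nat.card_eq_fintype_card, Nat.card_prod, Nat.card_fun, Nat.card_fin,
    Color.card] at hlen
  rw [← hL, List.length_map, pow_succ']
  exact hlen

theorem exists_tupleRows_of_mem (hU : ∀ x, x ∈ U ↔ ∃ a, ρ a = x) {n : ℕ} {t : List Row}
    (ht : t ∈ tupleList E U n) : ∃ v : Fin n → V, t = tupleRows ρ v := by
  induction n generalizing t with
  | zero => exact ⟨Fin.elim0, by simpa [tupleList, tupleRows] using ht⟩
  | succ n ih =>
    obtain ⟨t', ht', hy⟩ := List.mem_flatMap.1 ht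
    obtain ⟨y, hy', rfl⟩ := List.mem_map.1 hy
    obtain ⟨v, rfl⟩ := ih ht'
    obtain ⟨a, rfl⟩ := (hU y).1 (mem_of_mem_representatives hy')
    exact ⟨_, (tupleRows_snoc v a).symm⟩

theorem length_tupleList_le (hU : ∀ x, x ∈ U ↔ ∃ a, ρ a = x) (hE : IsColorRel r lab ρ q E)
    {n k : ℕ} (hn : n ≤ k) :
    (tupleList E U n).length ≤ ((colorCount w q + 1) ^ (k + 1)) ^ n := by
  induction n with
  | zero => simp [tupleList]
  | succ n ih =>
    rw [tupleList, extendTuples, List.length_flatMap, pow_succ]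
    refine (List.sum_le_card_nsmul _ ((colorCount w q + 1) ^ (k + 1)) fun m hm => ?_).trans ?_
    · obtain ⟨t, ht, rfl⟩ := List.mem_map.1 hm
      obtain ⟨v, rfl⟩ := exists_tupleRows_of_mem hU ht
      rw [List.length_map]
      exact (length_representatives_le hU hE v).trans ((Nat.pow_le_pow_left (Nat.le_succ _) _).trans
        (Nat.pow_le_pow_right (Nat.succ_pos _) (by omega)))
    · rw [List.length_map, smul_eq_mul]
      exact Nat.mul_le_mul_right _ (ih (by omega))

/-- Some representative has the same type as a given element, and can thus replace it in formulas of
small quantifier depth. -/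
theorem exists_mem_tupleList_snoc [Finite V] [IsPartialOrder V r] (hlab : ChainLabels r lab)
    (hU : ∀ x, x ∈ U ↔ ∃ a, ρ a = x) (hE : IsColorRel r lab ρ q E) {n : ℕ} {v : Fin n → V}
    (hv : tupleRows ρ v ∈ tupleList E U n) (y : V) :
    ∃ y', tupleRows ρ (Fin.snoc (α := fun _ : Fin (n + 1) => V) v y') ∈ tupleList E U (n + 1) ∧
      ∀ φ : CPFormula (n + 1), rankFor φ.depth ≤ q →
        (φ.Sat r (Fin.snoc (α := fun _ : Fin (n + 1) => V) v y) ↔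
          φ.Sat r (Fin.snoc (α := fun _ : Fin (n + 1) => V) v y')) := by
  have hmem : ∀ a, ρ a ∈ U := fun a => (hU _).2 ⟨a, rfl⟩
  obtain ⟨x, hx, hxy⟩ := exists_mem_representatives (E := E) (U := U) (t := tupleRows ρ v)
    (fun x hx => by
      obtain ⟨a, rfl⟩ := (hU x).1 hx
      exact (sameType_iff hE v a a).2 rfl) (hmem y)
  obtain ⟨y', rfl⟩ := (hU x).1 (mem_of_mem_representatives hx)
  have h := (sameType_iff hE v y' y).1 hxy
  simp only [typeOver, Prod.mk.injEq, funext_iff] at h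
  refine ⟨y', ?_, fun φ hφ => ⟨sat_of_col hlab φ ?_, sat_of_col hlab φ ?_⟩⟩
  · rw [tupleRows_snoc]
    exact List.mem_flatMap.2 ⟨_, hv, List.mem_map.2 ⟨_, hx, rfl⟩⟩
  · exact fun i j => col_mono hφ (col_snoc (fun _ _ => rfl) (fun i => (h.2 i).symm) h.1.symm i j)
  · exact fun i j => col_mono hφ (col_snoc (fun _ _ => rfl) h.2 h.1 i j)

/-- The stack machine computes the tuples in the lists `tupleList E U n` that satisfy a formula. -/
theorem foldl_evalStep_tokens [Finite V] [IsPartialOrder V r] (hlab : ChainLabels r lab)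
    (hρ : Function.Injective ρ) (hU : ∀ x, x ∈ U ↔ ∃ a, ρ a = x)
    (hr : ∀ a b, rowLE (ρ a) (ρ b) = true ↔ r a b) {fs : List MCSymbol}
    (hE : IsColorRel r lab ρ (rankFor fs.length) E) {n : ℕ} (φ : CPFormula n)
    (hφ : n + φ.depth ≤ fs.length) (st : List (List (List Row))) :
    ∃ R : List (List Row), φ.tokens.reverse.foldl (evalStep (tupleLists E U fs)) st = R :: st ∧
      ∀ v : Fin n → V, tupleRows ρ v ∈ tupleList E U n → (tupleRows ρ v ∈ R ↔ φ.Sat r v) := by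
  -- the tuples of length `n + 1` that extend a given tuple
  have hext : ∀ {n : ℕ} {u t : List Row} {v : Fin n → V}, u ∈ tupleList E U (n + 1) →
      u.tail = tupleRows ρ v →
        ∃ y, u = tupleRows ρ (Fin.snoc (α := fun _ : Fin (n + 1) => V) v y) := by
    intro n u t v hu hut
    obtain ⟨t', ht', hy⟩ := List.mem_flatMap.1 hu
    obtain ⟨x, hx, rfl⟩ := List.mem_map.1 hy
    obtain ⟨y, rfl⟩ := (hU x).1 (mem_of_mem_representatives hx)
    exact ⟨y, by rw [tupleRows_snoc, ← hut, List.tail_cons]⟩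
  induction φ generalizing st with
  | @eq n i j =>
    refine ⟨_, rfl, fun v hv => ?_⟩
    rw [getD_tupleLists (n := n) (le_of_add_le_left hφ), List.mem_filter]
    simp only [hv, true_and, getD_reverse_tupleRows, decide_eq_true_eq, CPFormula.Sat, hρ.eq_iff]
  | @le n i j =>
    refine ⟨_, rfl, fun v hv => ?_⟩
    rw [getD_tupleLists (n := n) (le_of_add_le_left hφ), List.mem_filter]
    simp only [hv, true_and, getD_reverse_tupleRows, CPFormula.Sat, hr]
  | @and n φ ψ ih₁ ih₂ =>
    rw [CPFormula.depth] at hφ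
    obtain ⟨R₂, hR₂, h₂⟩ := ih₂ (by omega) st
    obtain ⟨R₁, hR₁, h₁⟩ := ih₁ (by omega) (R₂ :: st)
    rw [CPFormula.tokens, List.reverse_cons, List.reverse_append, List.foldl_append,
      List.foldl_append, hR₂, hR₁]
    refine ⟨_, rfl, fun v hv => ?_⟩
    rw [getD_tupleLists (n := n) (by omega), List.mem_filter]
    simp [hv, h₁ v hv, h₂ v hv, CPFormula.Sat]
  | @all n φ ih =>
    rw [CPFormula.depth] at hφ
    obtain ⟨R, hR, h⟩ := ih (by omega) st
    rw [CPFormula.tokens, List.reverse_cons, List.foldl_append, hR]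
    refine ⟨_, rfl, fun v hv => ?_⟩
    rw [getD_tupleLists (n := n) (by omega), getD_tupleLists (n := n + 1) (by omega),
      List.mem_filter]
    simp only [hv, true_and, List.all_eq_true, Bool.or_eq_true, Bool.not_eq_true',
      decide_eq_false_iff_not, decide_eq_true_eq, ← imp_iff_not_or, List.getD_cons_zero]
    constructor
    · intro hall y
      obtain ⟨y', hy', hsat⟩ := exists_mem_tupleList_snoc hlab hU hE hv y
      refine (hsat φ (rankFor_mono (by omega))).2 ((h _ hy').1 (hall _ hy' ?_))
      rw [tupleRows_snoc, List.tail_cons]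
    · intro hsat u hu hut
      obtain ⟨y, rfl⟩ := hext (t := u) hu hut
      exact (h _ hu).2 (hsat y)
  | @ex n φ ih =>
    rw [CPFormula.depth] at hφ
    obtain ⟨R, hR, h⟩ := ih (by omega) st
    rw [CPFormula.tokens, List.reverse_cons, List.foldl_append, hR]
    refine ⟨_, rfl, fun v hv => ?_⟩
    rw [getD_tupleLists (n := n) (by omega), getD_tupleLists (n := n + 1) (by omega),
      List.mem_filter]
    simp only [hv, true_and, List.any_eq_true, Bool.and_eq_true, decide_eq_true_eq,
      List.getD_cons_zero]
    constructor
    · rintro ⟨u, hu, hut, huR⟩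
      obtain ⟨y, rfl⟩ := hext (t := u) hu hut
      exact ⟨y, (h _ hu).1 huR⟩
    · rintro ⟨y, hy⟩
      obtain ⟨y', hy', hsat⟩ := exists_mem_tupleList_snoc hlab hU hE hv y
      refine ⟨_, hy', ?_, (h _ hy').2 ((hsat φ (rankFor_mono (by omega))).1 hy)⟩
      rw [tupleRows_snoc, List.tail_cons]

end

/-! ### The decision procedure -/

/-- The color relation that determines the truth of all subformulas of the formula of an
instance. -/
def instanceRel (w : ℕ) (l : List MCSymbol) : PairRel :=
  colorRel (chainCover rowLE w (elements l)) (elements l) (rankTicks (formulaSymbols l))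

/-- The decision procedure for posets of width at most `w`. -/
def modelCheck (w : ℕ) (l : List MCSymbol) : Bool :=
  decide ([] ∈ ((formulaTokens l).foldl (evalStep (tupleLists (instanceRel w l) (elements l)
    (formulaSymbols l))) []).getD 0 [])

theorem isColorRel_instanceRel {P : FinPoset} {w : ℕ} (hw : P.width ≤ w) (φ : CPSentence) :
    ∃ lab : P.Carrier → Fin w, ChainLabels (fun a b : P.Carrier => a ≤ b) lab ∧
      IsColorRel (fun a b : P.Carrier => a ≤ b) lab P.row (rankFor (CPFormula.encode φ).length)
        (instanceRel w (encodeInstance P φ)) := by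
  obtain ⟨lab, h₁, h₂⟩ := exists_labels hw φ
  have h := isColorRel_colorRel (fun _ => mem_elements (φ := φ)) P.rowLE_row h₂
    (rankTicks (CPFormula.encode φ))
  rw [length_rankTicks] at h
  rw [instanceRel, formulaSymbols_encodeInstance]
  exact ⟨lab, h₁, h⟩

theorem modelCheck_encodeInstance {P : FinPoset} {w : ℕ} (hw : P.width ≤ w) (φ : CPSentence) :
    modelCheck w (encodeInstance P φ) = true ↔ P.Models φ := by
  obtain ⟨lab, hlab, hE⟩ := isColorRel_instanceRel hw φ
  have hr : IsPartialOrder P.Carrier fun a b => a ≤ b := inferInstance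
  obtain ⟨R, hR, h⟩ := foldl_evalStep_tokens hlab P.row_injective (fun _ => mem_elements)
    P.rowLE_row hE φ (by
      have := CPFormula.depth_le_size φ
      rw [CPFormula.size] at this
      omega) []
  rw [P.models_iff, modelCheck, formulaTokens_encodeInstance, formulaSymbols_encodeInstance, hR,
    decide_eq_true_eq]
  exact h Fin.elim0 (by simp [tupleRows, tupleList])

/-! ### The running time of the decision procedure -/

/-- The instances of the model checking problem for a class of posets, encoded by the reversed list
of the symbols of the input word. -/
def MCInstance (C : Set FinPoset) : Type := C × CPSentence

namespace MCInstance

variable {C : Set FinPoset}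

/-- The input word of an instance. -/
def word (x : MCInstance C) : List MCSymbol := encodeInstance x.1.1 x.2

/-- The parameter of an instance. -/
def param (x : MCInstance C) : ℕ := x.2.size

instance : Enc (MCInstance C) where
  enc x := enc x.word.reverse
  enc_injective _ _ h :=
    have h := encodeInstance_inj (List.reverse_injective (Enc.enc_injective h))
    Prod.ext (Subtype.ext h.1) h.2

theorem fpt_word : FPT param (word (C := C)) :=
  (FPT.reverse (l := fun x : MCInstance C => x.word.reverse) (FPT.of_enc_eq fun _ => rfl)).congr
    fun x => List.reverse_reverse x.word

end MCInstance

namespace Bdd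

theorem primrec_pow {F G : ℕ → ℕ} (hF : Nat.Primrec F) (hG : Nat.Primrec G) :
    Nat.Primrec fun n => F n ^ G n :=
  have hpow : Primrec₂ fun m n : ℕ => m ^ n := Primrec₂.unpaired'.1 Nat.Primrec.pow
  Primrec.nat_iff.1 (hpow.comp (Primrec.nat_iff.2 hF) (Primrec.nat_iff.2 hG))

end Bdd

theorem primrec_colorCount (w : ℕ) : Nat.Primrec (colorCount w) := by
  have hpow : Primrec₂ fun m n : ℕ => m ^ n := Primrec₂.unpaired'.1 Nat.Primrec.pow
  have h : Primrec fun n : ℕ => n * 2 ^ (n * n) :=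
    Primrec.nat_mul.comp .id (hpow.comp (.const 2) (Primrec.nat_mul.comp .id .id))
  refine Primrec.nat_iff.1 ((Primrec.nat_iterate .id (.const (w * w * 4))
    (h.comp .snd).to₂).of_eq fun n => ?_)
  induction n with
  | zero => rfl
  | succ n ih =>
    simp only [id, Function.iterate_succ_apply'] at ih ⊢
    rw [ih, colorCount]

theorem primrec_rankFor : Nat.Primrec rankFor := by
  have h : Primrec fun n : ℕ => 2 * n + 2 :=
    Primrec.nat_add.comp (Primrec.nat_mul.comp (.const 2) .id) (.const 2)
  refine Primrec.nat_iff.1 ((Primrec.nat_iterate .id (.const 0) (h.comp .snd).to₂).of_eq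
    fun n => ?_)
  induction n with
  | zero => rfl
  | succ n ih =>
    simp only [id, Function.iterate_succ_apply'] at ih ⊢
    rw [ih, rankFor]

namespace FPT

theorem polyTime_formulaSymbols : PolyTime formulaSymbols :=
  filter id (not (or (or (beq snd (const _)) (beq snd (const _))) (beq snd (const _))))

theorem polyTime_elements : PolyTime elements :=
  polyTime_linearize.comp₀ polyTime_foldr_rowsStep

theorem polyTime_formulaTokens : PolyTime formulaTokens :=
  fst.comp₀ (polyTime_foldl_parseStep.comp₀ polyTime_formulaSymbols)

theorem polyTime_colorRel : PolyTime fun p : (List (List Row) × List Row) × List Bool =>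
    colorRel p.1.1 p.1.2 p.2 := by
  refine foldl_of_growth (κ := fun _ => 0)
    (g := fun (p : (List (List Row) × List Row) × List Bool) E _ => refineRel p.1.2 E) snd
    (polyTime_initialRel.comp₀ fst)
    (polyTime_refineRel.comp₀ (pair (snd.comp₀ (fst.comp₀ fst)) (snd.comp₀ snd))) (Bdd.const 0)
    fun p E b _ => sz_sublist List.filter_sublist

variable {C : Set FinPoset}

open MCInstance

theorem length_formulaSymbols (x : MCInstance C) : (formulaSymbols x.word).length = x.param := by
  rw [word, formulaSymbols_encodeInstance]
  rfl

theorem fpt_rankTicks :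
    FPT param fun x : MCInstance C => rankTicks (formulaSymbols x.word) := by
  refine foldl (g := fun _ l _ => false :: false :: (l ++ l))
    (polyTime_formulaSymbols.comp₀ fpt_word) (const _)
    (cons (const false) (cons (const false) (append (snd.comp₀ snd) (snd.comp₀ snd))))
    (B := fun x => rankFor x.param * 4 + 1)
    (((Bdd.param primrec_rankFor).mul (Bdd.const 4)).add (Bdd.const 1)) fun x m hm => ?_
  refine (sz_list_le (l := rankTicks m) (b := 3) fun b _ => sz_bool_le b).trans ?_
  have h := rankFor_mono (hm.length_le.trans_eq (length_formulaSymbols x))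
  rw [length_rankTicks]
  omega

theorem fpt_instanceRel (w : ℕ) : FPT param fun x : MCInstance C => instanceRel w x.word :=
  polyTime_colorRel.comp₀ (pair (pair ((polyTime_chainCover w).comp₀
    (polyTime_elements.comp₀ fpt_word)) (polyTime_elements.comp₀ fpt_word)) fpt_rankTicks)

/-- A bound on the size of the representatives of the tuples of length up to `k`, for elements of
size at most `s`. -/
def tupleBound (w k s : ℕ) : ℕ :=
  (k + 1) * ((((colorCount w (rankFor k) + 1) ^ (k + 1)) ^ k * ((k * (s + 1) + 1) + 1) + 1) + 1) + 1

theorem bdd_tupleBound (w : ℕ) : Bdd param fun x : MCInstance C =>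
    tupleBound w x.param (sz (elements x.word)) := by
  have hU : FPT param fun x : MCInstance C => elements x.word := polyTime_elements.comp₀ fpt_word
  have hD : Nat.Primrec fun k => ((colorCount w (rankFor k) + 1) ^ (k + 1)) ^ k :=
    Bdd.primrec_pow (Bdd.primrec_pow (Bdd.add_primrec ((primrec_colorCount w).comp primrec_rankFor)
      (Nat.Primrec.const 1)) (Bdd.add_primrec .id (Nat.Primrec.const 1))) .id
  have hD' : Bdd param fun x : MCInstance C =>
    ((colorCount w (rankFor x.param) + 1) ^ (x.param + 1)) ^ x.param := Bdd.param hD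
  have hk : Bdd param fun x : MCInstance C => x.param := Bdd.param (F := fun k => k) .id
  exact ((hk.add (Bdd.const 1)).mul (((hD'.mul (((hk.mul (hU.size_bdd.add (Bdd.const 1))).add
    (Bdd.const 1)).add (Bdd.const 1))).add (Bdd.const 1)).add (Bdd.const 1))).add (Bdd.const 1)

/-- The number of representatives is bounded in terms of the width and the parameter, since the
number of colors is. -/
theorem sz_map_tupleList_le {w : ℕ} (hw : ∀ P ∈ C, P.width ≤ w) (x : MCInstance C) {m : ℕ}
    (hm : m ≤ x.param) : sz ((List.range (m + 1)).map
      (tupleList (instanceRel w x.word) (elements x.word))).reverse ≤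
        tupleBound w x.param (sz (elements x.word)) := by
  obtain ⟨lab, -, hE⟩ := isColorRel_instanceRel (hw _ x.1.2) x.2
  refine (sz_list_le fun T hT => ?_).trans (Nat.add_le_add_right (Nat.mul_le_mul_right _ (by
    rw [List.length_reverse, List.length_map, List.length_range]; omega)) 1)
  obtain ⟨n, hn, rfl⟩ := List.mem_map.1 (List.mem_reverse.1 hT)
  have hn : n ≤ x.param := by rw [List.mem_range] at hn; omega
  have hlen := length_tupleList_le (k := x.param) (fun _ => mem_elements (φ := x.2)) hE hn
  refine (sz_list_le fun t ht => ?_).trans (Nat.add_le_add_right (Nat.mul_le_mul_right _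
    (hlen.trans (Nat.pow_le_pow_right (Nat.pow_pos (Nat.succ_pos _)) hn))) 1)
  obtain ⟨v, rfl⟩ := exists_tupleRows_of_mem (ρ := x.1.1.row) (fun _ => mem_elements) ht
  refine (sz_list_le fun y hy => ?_).trans (Nat.add_le_add_right (Nat.mul_le_mul_right _ ?_) 1)
  · rw [tupleRows, List.mem_reverse, List.mem_ofFn'] at hy
    obtain ⟨i, rfl⟩ := hy
    exact sz_le_of_mem (mem_elements.2 ⟨_, rfl⟩)
  · simpa [tupleRows] using hn

theorem fpt_tupleLists {w : ℕ} (hw : ∀ P ∈ C, P.width ≤ w) : FPT param fun x : MCInstance C =>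
    tupleLists (instanceRel w x.word) (elements x.word) (formulaSymbols x.word) := by
  have hU : FPT param fun x : MCInstance C => elements x.word := polyTime_elements.comp₀ fpt_word
  have hstep : FPT (fun p => p.1.param)
      fun p : MCInstance C × (MCSymbol × List (List (List Row))) =>
        extendTuples (instanceRel w p.1.word) (elements p.1.word) (p.2.2.getD 0 []) :: p.2.2 :=
    cons (polyTime_extendTuples.comp₀ (f := fun p : MCInstance C ×
      (MCSymbol × List (List (List Row))) => ((instanceRel w p.1.word, elements p.1.word),
        p.2.2.getD 0 [])) (pair (pair ((fpt_instanceRel w).comp fst fun _ => rfl)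
          (hU.comp fst fun _ => rfl)) (getD (snd.comp₀ snd) (const 0) (const []))))
      (snd.comp₀ snd)
  refine reverse (foldl (polyTime_formulaSymbols.comp₀ fpt_word) (const _) hstep
    (bdd_tupleBound w) fun x m hm => ?_)
  rw [foldl_extendTuples]
  exact sz_map_tupleList_le hw x (hm.length_le.trans_eq (length_formulaSymbols x))

theorem fpt_modelCheck {w : ℕ} (hw : ∀ P ∈ C, P.width ≤ w) :
    FPT param fun x : MCInstance C => modelCheck w x.word := by
  have h : FPT param fun x : MCInstance C => (formulaTokens x.word).foldl (evalStep
      (tupleLists (instanceRel w x.word) (elements x.word) (formulaSymbols x.word))) [] :=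
    polyTime_foldl_evalStep.comp₀ (f := fun x : MCInstance C => (tupleLists (instanceRel w x.word)
      (elements x.word) (formulaSymbols x.word), formulaTokens x.word))
      (pair (fpt_tupleLists hw) (polyTime_formulaTokens.comp₀ fpt_word))
  exact mem (const []) (getD h (const 0) (const []))

end FPT

theorem mainTheorem4 (C : Set FinPoset) (hC : BoundedWidth C) :
    (modelChecking C).IsFPT := by
  obtain ⟨w, hw⟩ := hC
  obtain ⟨M, F, p, hF, h⟩ := (FPT.fpt_modelCheck hw).exists_machine (code := MCInstance.word)
    fun _ => rfl
  refine ⟨M, F, p, hF, fun x => ?_⟩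
  have hx : modelCheck w (MCInstance.word x) = true ↔ (modelChecking C).yes x :=
    modelCheck_encodeInstance (hw _ x.1.2) x.2
  have hdec : ∀ _ : Decidable ((modelChecking C).yes x),
      decide ((modelChecking C).yes x) = modelCheck w (MCInstance.word x) := fun _ => by
    rw [Bool.eq_iff_iff, hx, decide_eq_true_eq]
  rw [hdec]
  exact h x
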